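/- Let $K$ be a commutative ring, let $A,B$ be (unital, associative) $K$-algebras and let $B\to A$ be a $K$-algebra homomorphism (not necessarily injective); it makes $A$ a $B$-bimodule. Let $R=\{r\in A : br=rb \text{ for all } b\in B\}$ be the centralizer, $S=\operatorname{End}({}_BA_B)$ with composition as product, and $T=(A\otimes_BA)^B$ with product $tt'=t'^1t^1\otimes t^2t'^2$ and unit $1\otimes1$, where $t=t^1\otimes t^2$ denotes a possible sum. The extension is *right D2* if $A\otimes_BA$ is, as an $A$-$B$-bimodule, a direct summand of $A^n$ for some $n$, and *left D2* if this holds as $B$-$A$-bimodules. For a left $R$-bialgebroid $(H,s,t,\Delta,\varepsilon)$ the $R$-bimodule structure is $r\cdot h\cdot r'=s(r)t(r')h$; for a right $R$-bialgebroid it is $r\cdot h\cdot r'=h\,s(r')t(r)$. Let $H$ be a left $R$-bialgebroid. * If $H_R$ is finitely generated projective, the *right dual* of $H$ is the right $R$-bialgebroid $H^*=\operatorname{Hom}(H_R,R_R)$ with $(\varphi\psi)(h)=\psi(\varphi(h_{(1)})\cdot h_{(2)})$, $1=\varepsilon$, $s(r)=\varepsilon(-\,s(r))$, $t(r)=r\,\varepsilon(-)$,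 $\varepsilon(\varphi)=\varphi(1)$, and $\Delta(\varphi)=\sum_i\varphi(-\,e_i)\otimes f_i$ for dual bases $e_i\in H$, $f_i\in H^*$ of $H_R$. * If ${}_RH$ is finitely generated projective, the *left dual* of $H$ is the right $R$-bialgebroid ${}^*H=\operatorname{Hom}({}_RH,{}_RR)$ with $(\varphi\psi)(h)=\psi(h_{(1)}\cdot\varphi(h_{(2)}))$, $1=\varepsilon$, $s(r)=\varepsilon(-)\,r$, $t(r)=\varepsilon(-\,t(r))$, $\varepsilon(\varphi)=\varphi(1)$, and $\Delta(\varphi)=\sum_i f_i\otimes\varphi(-\,e_i)$ for dual bases $e_i\in H$, $f_i\in{}^*H$ of ${}_RH$. **Statement.** 1. Suppose the extension is right D2. Then there are right D2 quasibases, i.e. finitely many $u_j\in T$, $\gamma_j\in S$ with $a\otimes a'=\sum_j a\gamma_j(a')u_j$ for all $a,a'\in A$. For every choice of them, $T$ is a right $R$-bialgebroid with $s(r)=1\otimes r$, $t(r)=r\otimes1$, $\Delta(t)=\sum_j(t^1\otimes\gamma_j(t^2))\otimes_R u_j$, $\varepsilon(t)=t^1t^2$; $S$ is a left $R$-bialgebroid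 with $s(r)=r\,(-)$, $t(r)=(-)\,r$, $\Delta(\alpha)=\sum_j\gamma_j\otimes_R u_j^1\alpha(u_j^2\,-)$, $\varepsilon(\alpha)=\alpha(1)$; the module $S_R$ is finitely generated projective; for every choice of finite dual bases of $S_R$ the right dual $S^*$ is a right $R$-bialgebroid; and $$\eta:T\to S^*,\qquad \eta(t)(\alpha)=\langle t\,|\,\alpha\rangle:=t^1\alpha(t^2)$$ is an isomorphism of right $R$-bialgebroids: a $K$-algebra isomorphism that commutes with source maps, target maps, coproducts and counits. 2. Suppose the extension is left D2. Then there are left D2 quasibases, i.e. finitely many $t_i\in T$, $\beta_i\in S$ with $a\otimes a'=\sum_i t_i\beta_i(a)a'$ for all $a,a'\in A$. For every choice of them, $T$ is a right $R$-bialgebroid with $s,t,\varepsilon$ as in 1 and $\Delta(t)=\sum_i t_i\otimes_R(\beta_i(t^1)\otimes t^2)$; $S$ is a left $R$-bialgebroid with $s,t,\varepsilon$ as in 1 and $\Delta(\alpha)=\sum_i\alpha(-\,t_i^1)t_i^2\otimes_R\beta_i$; the module ${}_RS$ is finitely generated projective; for every choice of finite dual bases of ${}_RS$ the left dual ${}^*S$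 is a right $R$-bialgebroid; and $$T\to{}^*S,\qquad t\mapsto[\,-\,|\,t\,],\qquad [\alpha\,|\,t]:=\alpha(t^1)t^2$$ is an isomorphism of right $R$-bialgebroids. -/

import Mathlib

open scoped TensorProduct
open MulOpposite

/-! ## Balanced tensor products

Let `H` be a `K`-module with a right action `ρ` and a left action `σ` of a (not necessarily
commutative) ring `R`.  `Bal ρ σ` is the tensor product `H ⊗_R H`, and `Bal3 ρ σ` is
`H ⊗_R H ⊗_R H`, both presented as quotients of tensor products over the ground ring `K`. -/

section Balanced

variable {K R H P : Type*} [CommRing K] [AddCommGroup H] [Module K H]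
  [AddCommGroup P] [Module K P]

/-- The relations `x·r ⊗ y = x ⊗ r·y`. -/
def balRel (ρ σ : R → H →ₗ[K] H) : Submodule K (H ⊗[K] H) :=
  Submodule.span K {w | ∃ r x y, w = ρ r x ⊗ₜ[K] y - x ⊗ₜ[K] σ r y}

/-- `H ⊗_R H`, where `x·r = ρ r x` and `r·y = σ r y`. -/
abbrev Bal (ρ σ : R → H →ₗ[K] H) : Type _ := (H ⊗[K] H) ⧸ balRel ρ σ

/-- The canonical projection `H ⊗_K H → H ⊗_R H`. -/
abbrev Bal.mk (ρ σ : R → H →ₗ[K] H) : H ⊗[K] H →ₗ[K] Bal ρ σ := (balRel ρ σ).mkQ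

/-- The universal property of `H ⊗_R H`. -/
def Bal.lift {ρ σ : R → H →ₗ[K] H} (g : H →ₗ[K] H →ₗ[K] P)
    (hg : ∀ r x y, g (ρ r x) y = g x (σ r y)) : Bal ρ σ →ₗ[K] P :=
  (balRel ρ σ).liftQ (TensorProduct.lift g) <| by
    refine Submodule.span_le.2 ?_
    rintro w ⟨r, x, y, rfl⟩
    simp [hg]

@[simp] theorem Bal.lift_mk {ρ σ : R → H →ₗ[K] H} (g : H →ₗ[K] H →ₗ[K] P)
    (hg : ∀ r x y, g (ρ r x) y = g x (σ r y)) (z : H ⊗[K] H) :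
    Bal.lift g hg (Bal.mk ρ σ z) = TensorProduct.lift g z := rfl

theorem Bal.balanced (ρ σ : R → H →ₗ[K] H) (r : R) (x y : H) :
    Bal.mk ρ σ (ρ r x ⊗ₜ y) = Bal.mk ρ σ (x ⊗ₜ σ r y) := by
  rw [← sub_eq_zero, ← map_sub]
  exact (Submodule.Quotient.mk_eq_zero _).2 (Submodule.subset_span ⟨r, x, y, rfl⟩)

theorem Bal.hom_ext {ρ σ : R → H →ₗ[K] H} {F G : Bal ρ σ →ₗ[K] P}
    (h : ∀ x y, F (Bal.mk ρ σ (x ⊗ₜ y)) = G (Bal.mk ρ σ (x ⊗ₜ y))) : F = G :=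
  Submodule.linearMap_qext _ (TensorProduct.ext' h)

theorem Bal.exists_rep {ρ σ : R → H →ₗ[K] H} (w : Bal ρ σ) : ∃ z, Bal.mk ρ σ z = w :=
  Submodule.mkQ_surjective _ w

/-- The relations `x·r ⊗ y ⊗ z = x ⊗ r·y ⊗ z` and `x ⊗ y·r ⊗ z = x ⊗ y ⊗ r·z`. -/
def bal3Rel (ρ σ : R → H →ₗ[K] H) : Submodule K (H ⊗[K] (H ⊗[K] H)) :=
  Submodule.span K
    ({w | ∃ r x y z, w = ρ r x ⊗ₜ[K] (y ⊗ₜ[K] z) - x ⊗ₜ[K] (σ r y ⊗ₜ[K] z)} ∪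
     {w | ∃ r x y z, w = x ⊗ₜ[K] (ρ r y ⊗ₜ[K] z) - x ⊗ₜ[K] (y ⊗ₜ[K] σ r z)})

/-- `H ⊗_R H ⊗_R H`. -/
abbrev Bal3 (ρ σ : R → H →ₗ[K] H) : Type _ := (H ⊗[K] (H ⊗[K] H)) ⧸ bal3Rel ρ σ

theorem Bal3.balanced_left (ρ σ : R → H →ₗ[K] H) (r : R) (x y z : H) :
    (bal3Rel ρ σ).mkQ (ρ r x ⊗ₜ (y ⊗ₜ z)) = (bal3Rel ρ σ).mkQ (x ⊗ₜ (σ r y ⊗ₜ z)) := by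
  rw [← sub_eq_zero, ← map_sub]
  exact (Submodule.Quotient.mk_eq_zero _).2
    (Submodule.subset_span (Or.inl ⟨r, x, y, z, rfl⟩))

theorem Bal3.balanced_right (ρ σ : R → H →ₗ[K] H) (r : R) (x y z : H) :
    (bal3Rel ρ σ).mkQ (x ⊗ₜ (ρ r y ⊗ₜ z)) = (bal3Rel ρ σ).mkQ (x ⊗ₜ (y ⊗ₜ σ r z)) := by
  rw [← sub_eq_zero, ← map_sub]
  exact (Submodule.Quotient.mk_eq_zero _).2
    (Submodule.subset_span (Or.inr ⟨r, x, y, z, rfl⟩))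

/-- The canonical map `(H ⊗_R H) ⊗_K H → H ⊗_R H ⊗_R H`, `(x ⊗ y) ⊗ z ↦ x ⊗ y ⊗ z`. -/
def Bal3.joinLeft (ρ σ : R → H →ₗ[K] H) : Bal ρ σ ⊗[K] H →ₗ[K] Bal3 ρ σ :=
  TensorProduct.lift <| Bal.lift
    (TensorProduct.curry (TensorProduct.curry
      ((bal3Rel ρ σ).mkQ ∘ₗ (TensorProduct.assoc K H H H).toLinearMap)))
    (fun r x y => LinearMap.ext fun z => Bal3.balanced_left ρ σ r x y z)

/-- The canonical map `H ⊗_K (H ⊗_R H) → H ⊗_R H ⊗_R H`, `x ⊗ (y ⊗ z) ↦ x ⊗ y ⊗ z`. -/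
def Bal3.joinRight (ρ σ : R → H →ₗ[K] H) : H ⊗[K] Bal ρ σ →ₗ[K] Bal3 ρ σ :=
  TensorProduct.lift <| LinearMap.flip <| Bal.lift
    (TensorProduct.curry
      (TensorProduct.curry (bal3Rel ρ σ).mkQ).flip)
    (fun r y z => LinearMap.ext fun x => Bal3.balanced_right ρ σ r x y z)

theorem Bal3.joinLeft_tmul (ρ σ : R → H →ₗ[K] H) (x y z : H) :
    Bal3.joinLeft ρ σ (Bal.mk ρ σ (x ⊗ₜ y) ⊗ₜ z) = (bal3Rel ρ σ).mkQ (x ⊗ₜ (y ⊗ₜ z)) := by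
  rw [Bal3.joinLeft, TensorProduct.lift.tmul, Bal.lift_mk, TensorProduct.lift.tmul]
  rfl

theorem Bal3.joinRight_tmul (ρ σ : R → H →ₗ[K] H) (x y z : H) :
    Bal3.joinRight ρ σ (x ⊗ₜ Bal.mk ρ σ (y ⊗ₜ z)) = (bal3Rel ρ σ).mkQ (x ⊗ₜ (y ⊗ₜ z)) := by
  rw [Bal3.joinRight, TensorProduct.lift.tmul, LinearMap.flip_apply, Bal.lift_mk,
    TensorProduct.lift.tmul]
  rfl

/-- The universal property of `H ⊗_R H ⊗_R H`. -/
def Bal3.lift {ρ σ : R → H →ₗ[K] H} (g : H ⊗[K] (H ⊗[K] H) →ₗ[K] P)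
    (h₁ : ∀ r x y z, g (ρ r x ⊗ₜ (y ⊗ₜ z)) = g (x ⊗ₜ (σ r y ⊗ₜ z)))
    (h₂ : ∀ r x y z, g (x ⊗ₜ (ρ r y ⊗ₜ z)) = g (x ⊗ₜ (y ⊗ₜ σ r z))) : Bal3 ρ σ →ₗ[K] P :=
  (bal3Rel ρ σ).liftQ g <| by
    refine Submodule.span_le.2 ?_
    rintro w (⟨r, x, y, z, rfl⟩ | ⟨r, x, y, z, rfl⟩)
    · simp [h₁]
    · simp [h₂]

theorem Bal3.lift_mk {ρ σ : R → H →ₗ[K] H} (g : H ⊗[K] (H ⊗[K] H) →ₗ[K] P)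
    (h₁ : ∀ r x y z, g (ρ r x ⊗ₜ (y ⊗ₜ z)) = g (x ⊗ₜ (σ r y ⊗ₜ z)))
    (h₂ : ∀ r x y z, g (x ⊗ₜ (ρ r y ⊗ₜ z)) = g (x ⊗ₜ (y ⊗ₜ σ r z))) (w) :
    Bal3.lift g h₁ h₂ ((bal3Rel ρ σ).mkQ w) = g w := rfl

end Balanced

/-! ## Left and right bialgebroids -/

section Bialgebroids

variable {K R H : Type*} [CommRing K] [Ring R] [Algebra K R] [Ring H] [Algebra K H]

/-- In a left bialgebroid the `R`-bimodule structure is `r·h·r' = s(r) t(r') h`; this is the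
right action of `R`. -/
abbrev leftTgtAct (tgt : Rᵐᵒᵖ →ₐ[K] H) (r : R) : H →ₗ[K] H := LinearMap.mulLeft K (tgt (op r))
/-- The left action `r·h = s(r) h` of `R` in a left bialgebroid. -/
abbrev leftSrcAct (src : R →ₐ[K] H) (r : R) : H →ₗ[K] H := LinearMap.mulLeft K (src r)

/-- In a right bialgebroid the `R`-bimodule structure is `r·h·r' = h s(r') t(r)`; this is the
right action of `R`. -/
abbrev rightSrcAct (src : R →ₐ[K] H) (r : R) : H →ₗ[K] H := LinearMap.mulRight K (src r)
/-- The left action `r·h = h t(r)` of `R` in a right bialgebroid. -/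
abbrev rightTgtAct (tgt : Rᵐᵒᵖ →ₐ[K] H) (r : R) : H →ₗ[K] H := LinearMap.mulRight K (tgt (op r))

variable (K R H) in
/-- The structure maps of a left bialgebroid `H` over `R`: source (a homomorphism), target (an
anti-homomorphism) with commuting images, coproduct `H → H ⊗_R H` and counit `H → R`. -/
structure LeftBialgebroidData where
  src : R →ₐ[K] H
  tgt : Rᵐᵒᵖ →ₐ[K] H
  src_comm_tgt : ∀ r r', src r * tgt r' = tgt r' * src r
  comul : H →ₗ[K] Bal (leftTgtAct tgt) (leftSrcAct src)
  counit : H →ₗ[K] R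

variable (K R H) in
/-- The structure maps of a right bialgebroid `H` over `R`. -/
structure RightBialgebroidData where
  src : R →ₐ[K] H
  tgt : Rᵐᵒᵖ →ₐ[K] H
  src_comm_tgt : ∀ r r', src r * tgt r' = tgt r' * src r
  comul : H →ₗ[K] Bal (rightSrcAct src) (rightTgtAct tgt)
  counit : H →ₗ[K] R

/-- The projection `H ⊗_K H → H ⊗_R H` for a left bialgebroid. -/
abbrev LeftBialgebroidData.mk₂ (D : LeftBialgebroidData K R H) :
    H ⊗[K] H →ₗ[K] Bal (leftTgtAct D.tgt) (leftSrcAct D.src) := Bal.mk _ _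

/-- The projection `H ⊗_K H → H ⊗_R H` for a right bialgebroid. -/
abbrev RightBialgebroidData.mk₂ (D : RightBialgebroidData K R H) :
    H ⊗[K] H →ₗ[K] Bal (rightSrcAct D.src) (rightTgtAct D.tgt) := Bal.mk _ _

/-- The axioms of a left bialgebroid.  Throughout, `z ∈ H ⊗_K H` is an arbitrary representative
of `Δ(h) ∈ H ⊗_R H`, i.e. `z` plays the role of the Sweedler expression `h₍₁₎ ⊗ h₍₂₎`. -/
structure IsLeftBialgebroid (D : LeftBialgebroidData K R H) : Prop where
  /-- `Δ(s(r) h) = s(r) h₍₁₎ ⊗ h₍₂₎` -/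
  comul_src : ∀ r h z, D.mk₂ z = D.comul h →
    D.comul (D.src r * h) = D.mk₂ ((D.src r ⊗ₜ 1) * z)
  /-- `Δ(t(r) h) = h₍₁₎ ⊗ t(r) h₍₂₎` -/
  comul_tgt : ∀ r h z, D.mk₂ z = D.comul h →
    D.comul (D.tgt r * h) = D.mk₂ ((1 ⊗ₜ D.tgt r) * z)
  /-- `(Δ ⊗ id) Δ(h) = (id ⊗ Δ) Δ(h)` in `H ⊗_R H ⊗_R H` -/
  coassoc : ∀ h z, D.mk₂ z = D.comul h →
    Bal3.joinLeft _ _ (D.comul.rTensor H z) = Bal3.joinRight _ _ (D.comul.lTensor H z)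
  /-- `ε(s(r) h) = r ε(h)` -/
  counit_src : ∀ r h, D.counit (D.src r * h) = r * D.counit h
  /-- `ε(t(r) h) = ε(h) r` -/
  counit_tgt : ∀ r h, D.counit (D.tgt (op r) * h) = D.counit h * r
  /-- `s(ε(h₍₁₎)) h₍₂₎ = h` -/
  counit_left : ∀ h z, D.mk₂ z = D.comul h →
    LinearMap.mul' K H ((D.src.toLinearMap ∘ₗ D.counit).rTensor H z) = h
  /-- `t(ε(h₍₂₎)) h₍₁₎ = h` -/
  counit_right : ∀ h z, D.mk₂ z = D.comul h →
    LinearMap.mul' K H ((D.tgt.toLinearMap ∘ₗ (opLinearEquiv K).toLinearMap ∘ₗ D.counit).rTensor H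
      (TensorProduct.comm K H H z)) = h
  /-- `h₍₁₎ t(r) ⊗ h₍₂₎ = h₍₁₎ ⊗ h₍₂₎ s(r)` -/
  takeuchi : ∀ r h z, D.mk₂ z = D.comul h →
    D.mk₂ (z * (D.tgt (op r) ⊗ₜ 1)) = D.mk₂ (z * (1 ⊗ₜ D.src r))
  comul_one : D.comul 1 = D.mk₂ (1 ⊗ₜ 1)
  /-- `Δ(h h') = h₍₁₎ h'₍₁₎ ⊗ h₍₂₎ h'₍₂₎` -/
  comul_mul : ∀ h h' z z', D.mk₂ z = D.comul h → D.mk₂ z' = D.comul h' →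
    D.comul (h * h') = D.mk₂ (z * z')
  counit_one : D.counit 1 = 1
  /-- `ε(h h') = ε(h s(ε(h')))` -/
  counit_mul_src : ∀ h h', D.counit (h * h') = D.counit (h * D.src (D.counit h'))
  /-- `ε(h h') = ε(h t(ε(h')))` -/
  counit_mul_tgt : ∀ h h', D.counit (h * h') = D.counit (h * D.tgt (op (D.counit h')))

/-- The axioms of a right bialgebroid; `z` stands for an arbitrary representative of `Δ(h)`. -/
structure IsRightBialgebroid (D : RightBialgebroidData K R H) : Prop where
  /-- `Δ(h s(r)) = h₍₁₎ ⊗ h₍₂₎ s(r)` -/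
  comul_src : ∀ r h z, D.mk₂ z = D.comul h →
    D.comul (h * D.src r) = D.mk₂ (z * (1 ⊗ₜ D.src r))
  /-- `Δ(h t(r)) = h₍₁₎ t(r) ⊗ h₍₂₎` -/
  comul_tgt : ∀ r h z, D.mk₂ z = D.comul h →
    D.comul (h * D.tgt r) = D.mk₂ (z * (D.tgt r ⊗ₜ 1))
  /-- `(Δ ⊗ id) Δ(h) = (id ⊗ Δ) Δ(h)` in `H ⊗_R H ⊗_R H` -/
  coassoc : ∀ h z, D.mk₂ z = D.comul h →
    Bal3.joinLeft _ _ (D.comul.rTensor H z) = Bal3.joinRight _ _ (D.comul.lTensor H z)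
  /-- `ε(h s(r)) = ε(h) r` -/
  counit_src : ∀ r h, D.counit (h * D.src r) = D.counit h * r
  /-- `ε(h t(r)) = r ε(h)` -/
  counit_tgt : ∀ r h, D.counit (h * D.tgt (op r)) = r * D.counit h
  /-- `h₍₂₎ t(ε(h₍₁₎)) = h` -/
  counit_left : ∀ h z, D.mk₂ z = D.comul h →
    LinearMap.mul' K H ((D.tgt.toLinearMap ∘ₗ (opLinearEquiv K).toLinearMap ∘ₗ D.counit).lTensor H
      (TensorProduct.comm K H H z)) = h
  /-- `h₍₁₎ s(ε(h₍₂₎)) = h` -/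
  counit_right : ∀ h z, D.mk₂ z = D.comul h →
    LinearMap.mul' K H ((D.src.toLinearMap ∘ₗ D.counit).lTensor H z) = h
  /-- `s(r) h₍₁₎ ⊗ h₍₂₎ = h₍₁₎ ⊗ t(r) h₍₂₎` -/
  takeuchi : ∀ r h z, D.mk₂ z = D.comul h →
    D.mk₂ ((D.src r ⊗ₜ 1) * z) = D.mk₂ ((1 ⊗ₜ D.tgt (op r)) * z)
  comul_one : D.comul 1 = D.mk₂ (1 ⊗ₜ 1)
  /-- `Δ(h h') = h₍₁₎ h'₍₁₎ ⊗ h₍₂₎ h'₍₂₎` -/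
  comul_mul : ∀ h h' z z', D.mk₂ z = D.comul h → D.mk₂ z' = D.comul h' →
    D.comul (h * h') = D.mk₂ (z * z')
  counit_one : D.counit 1 = 1
  /-- `ε(h h') = ε(s(ε(h)) h')` -/
  counit_mul_src : ∀ h h', D.counit (h * h') = D.counit (D.src (D.counit h) * h')
  /-- `ε(h h') = ε(t(ε(h)) h')` -/
  counit_mul_tgt : ∀ h h', D.counit (h * h') = D.counit (D.tgt (op (D.counit h)) * h')

/-- An algebra isomorphism `e` is an isomorphism of right bialgebroids over `R` if it
commutes with source, target, coproduct and counit. -/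
structure IsRightBialgebroidIso {H' : Type*} [Ring H'] [Algebra K H']
    (D : RightBialgebroidData K R H) (D' : RightBialgebroidData K R H') (e : H ≃ₐ[K] H') :
    Prop where
  src : ∀ r, e (D.src r) = D'.src r
  tgt : ∀ r, e (D.tgt r) = D'.tgt r
  counit : ∀ h, D'.counit (e h) = D.counit h
  /-- `Δ(e(h)) = e(h₍₁₎) ⊗ e(h₍₂₎)` -/
  comul : ∀ h z, D.mk₂ z = D.comul h →
    D'.comul (e h) = D'.mk₂ (TensorProduct.map e.toLinearMap e.toLinearMap z)

end Bialgebroids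

/-! ## The right dual of a left bialgebroid

For a left bialgebroid `H` over `R` the right dual is `H^* = Hom(H_R, R_R)`; if `H_R` is finitely
generated projective then `H^*` carries the structure maps of a right bialgebroid. -/

section RightDual

variable {K R H : Type*} [CommRing K] [Ring R] [Algebra K R] [Ring H] [Algebra K H]

/-- The right `R`-linear maps `H → R`, where `h·r = t(r) h`. -/
def rightDualSubmodule (D : LeftBialgebroidData K R H) : Submodule K (H →ₗ[K] R) where
  carrier := {φ | ∀ r h, φ (D.tgt (op r) * h) = φ h * r}
  add_mem' h₁ h₂ r h := by simp [h₁ r h, h₂ r h, add_mul]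
  zero_mem' r h := by simp
  smul_mem' k φ hφ r h := by simp [hφ r h]

/-- The right dual `Hom(H_R, R_R)` of the left bialgebroid `H`. -/
def RightDual {D : LeftBialgebroidData K R H} (_ : IsLeftBialgebroid D) : Type _ :=
  rightDualSubmodule D

namespace RightDual

variable {D : LeftBialgebroidData K R H} (hD : IsLeftBialgebroid D)

instance : AddCommGroup (RightDual hD) := inferInstanceAs (AddCommGroup (rightDualSubmodule D))
instance : Module K (RightDual hD) := inferInstanceAs (Module K (rightDualSubmodule D))
instance : FunLike (RightDual hD) H R where
  coe φ := φ.1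
  coe_injective _ _ h := Subtype.ext (DFunLike.coe_injective h)

instance : LinearMapClass (RightDual hD) K H R where
  map_add φ := φ.1.map_add
  map_smulₛₗ φ := φ.1.map_smul

variable {hD}

/-- Constructor for elements of the right dual. -/
def of (φ : H →ₗ[K] R) (h : ∀ r h, φ (D.tgt (op r) * h) = φ h * r) : RightDual hD := ⟨φ, h⟩

/-- The underlying `K`-linear map. -/
def toLin : RightDual hD →ₗ[K] H →ₗ[K] R := (rightDualSubmodule D).subtype

@[simp] theorem of_apply (φ : H →ₗ[K] R) (hφ) (h : H) : (of φ hφ : RightDual hD) h = φ h := rfl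
@[simp] theorem toLin_apply (φ : RightDual hD) (h : H) : toLin φ h = φ h := rfl
@[simp] theorem add_apply (φ ψ : RightDual hD) (h : H) : (φ + ψ) h = φ h + ψ h := rfl
@[simp] theorem smul_apply (k : K) (φ : RightDual hD) (h : H) : (k • φ) h = k • φ h := rfl
theorem map_tgt (φ : RightDual hD) (r : R) (h : H) : φ (D.tgt (op r) * h) = φ h * r := φ.2 r h
@[ext] theorem ext {φ ψ : RightDual hD} (h : ∀ x, φ x = ψ x) : φ = ψ := DFunLike.ext _ _ h

/-- `H ⊗_K H → H`, `x ⊗ y ↦ s(φ(x)) y`. -/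
def hookAux (φ : RightDual hD) : H ⊗[K] H →ₗ[K] H :=
  LinearMap.mul' K H ∘ₗ (D.src.toLinearMap ∘ₗ toLin φ).rTensor H

@[simp] theorem hookAux_tmul (φ : RightDual hD) (x y : H) :
    hookAux φ (x ⊗ₜ y) = D.src (φ x) * y := by simp [hookAux]

/-- `H ⊗_R H → H`, `x ⊗ y ↦ φ(x)·y = s(φ(x)) y`. -/
def hookBal (φ : RightDual hD) : Bal (leftTgtAct D.tgt) (leftSrcAct D.src) →ₗ[K] H :=
  Bal.lift (TensorProduct.curry (hookAux φ)) (by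
    intro r x y
    simp [map_tgt, mul_assoc])

/-- `H → H`, `h ↦ φ(h₍₁₎)·h₍₂₎`. -/
def hook (φ : RightDual hD) : H →ₗ[K] H := hookBal φ ∘ₗ D.comul

theorem hook_eq (φ : RightDual hD) {h : H} {z : H ⊗[K] H} (hz : D.mk₂ z = D.comul h) :
    hook φ h = hookAux φ z := by
  rw [hook, LinearMap.comp_apply, ← hz]
  change TensorProduct.lift (TensorProduct.curry (hookAux φ)) z = _
  congr 1
  exact TensorProduct.ext' fun x y => by simp

theorem hook_tgt (φ : RightDual hD) (r : Rᵐᵒᵖ) (h : H) :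
    hook φ (D.tgt r * h) = D.tgt r * hook φ h := by
  obtain ⟨z, hz⟩ := Bal.exists_rep (D.comul h)
  rw [hook_eq φ hz, hook_eq φ (hD.comul_tgt r h z hz).symm]
  clear hz
  induction z with
  | zero => simp
  | tmul x y => simp [← mul_assoc, D.src_comm_tgt]
  | add a b ha hb => simp only [mul_add, map_add, ha, hb]

theorem hook_src (φ : RightDual hD) (r : R) (h : H) (z : H ⊗[K] H)
    (hz : D.mk₂ z = D.comul h) :
    hook φ (D.src r * h) = hookAux φ ((D.src r ⊗ₜ 1) * z) :=
  hook_eq φ (hD.comul_src r h z hz).symm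

instance : One (RightDual hD) := ⟨of D.counit hD.counit_tgt⟩

/-- The product `(φψ)(h) = ψ(φ(h₍₁₎)·h₍₂₎)` of the right dual. -/
instance : Mul (RightDual hD) :=
  ⟨fun φ ψ => of (toLin ψ ∘ₗ hook φ) (fun r h => by simp [hook_tgt, map_tgt])⟩

@[simp] theorem one_apply (h : H) : (1 : RightDual hD) h = D.counit h := rfl
@[simp] theorem mul_apply (φ ψ : RightDual hD) (h : H) : (φ * ψ) h = ψ (hook φ h) := rfl

theorem hook_mul (φ ψ : RightDual hD) (h : H) : hook (φ * ψ) h = hook ψ (hook φ h) := by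
  obtain ⟨z, hz⟩ := Bal.exists_rep (D.comul h)
  rw [hook_eq _ hz, hook_eq _ hz]
  let g : H ⊗[K] (H ⊗[K] H) →ₗ[K] H :=
    hookAux ψ ∘ₗ (hookAux φ).rTensor H ∘ₗ (TensorProduct.assoc K H H H).symm.toLinearMap
  let G : Bal3 (leftTgtAct D.tgt) (leftSrcAct D.src) →ₗ[K] H := Bal3.lift g
    (by intro r x y z; simp [g, map_tgt, mul_assoc])
    (by intro r x y z
        simp only [g, LinearMap.comp_apply, LinearEquiv.coe_coe, TensorProduct.assoc_symm_tmul,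
          LinearMap.rTensor_tmul, hookAux_tmul, LinearMap.mulLeft_apply]
        rw [← mul_assoc, D.src_comm_tgt, mul_assoc, map_tgt, map_mul, mul_assoc])
  have key := congrArg G (hD.coassoc h z hz)
  have e₁ : ∀ z, G (Bal3.joinLeft _ _ (D.comul.rTensor H z)) = hookAux (φ * ψ) z := by
    intro z
    induction z with
    | zero => simp
    | add a b ha hb => simp only [map_add, ha, hb]
    | tmul x y =>
      obtain ⟨w, hw⟩ := Bal.exists_rep (D.comul x)
      rw [LinearMap.rTensor_tmul, ← hw, hookAux_tmul, mul_apply, hook_eq φ hw]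
      clear hw
      induction w with
      | zero => simp
      | add a b ha hb => simp only [map_add, TensorProduct.add_tmul, ha, hb, add_mul]
      | tmul a b =>
        rw [Bal3.joinLeft_tmul, Bal3.lift_mk]
        simp [g]
  have e₂ : ∀ z, G (Bal3.joinRight _ _ (D.comul.lTensor H z)) = hook ψ (hookAux φ z) := by
    intro z
    induction z with
    | zero => simp
    | add a b ha hb => simp only [map_add, ha, hb]
    | tmul x y =>
      obtain ⟨w, hw⟩ := Bal.exists_rep (D.comul y)
      rw [LinearMap.lTensor_tmul, ← hw, hookAux_tmul, hook_src ψ _ _ _ hw]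
      clear hw
      induction w with
      | zero => simp
      | add a b ha hb => simp only [map_add, TensorProduct.tmul_add, ha, hb, mul_add]
      | tmul a b =>
        rw [Bal3.joinRight_tmul, Bal3.lift_mk]
        simp [g]
  rw [← e₁, ← e₂, key]

theorem hook_one (h : H) : hook (1 : RightDual hD) h = h := by
  obtain ⟨z, hz⟩ := Bal.exists_rep (D.comul h)
  rw [hook_eq _ hz]
  exact hD.counit_left h z hz

theorem counit_hook (φ : RightDual hD) (h : H) : D.counit (hook φ h) = φ h := by
  obtain ⟨z, hz⟩ := Bal.exists_rep (D.comul h)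
  rw [hook_eq _ hz]
  conv_rhs => rw [← hD.counit_right h z hz]
  clear hz
  induction z with
  | zero => simp
  | add a b ha hb => simp only [map_add, ha, hb]
  | tmul x y => simp [hD.counit_src, map_tgt]

instance : Ring (RightDual hD) where
  __ := (inferInstance : AddCommGroup (RightDual hD))
  left_distrib φ ψ χ := by ext h; simp
  right_distrib φ ψ χ := by
    ext h
    simp only [mul_apply, add_apply]
    rw [← map_add χ]
    congr 1
    obtain ⟨z, hz⟩ := Bal.exists_rep (D.comul h)
    rw [hook_eq _ hz, hook_eq _ hz, hook_eq _ hz]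
    clear hz
    induction z with
    | zero => simp
    | add a b ha hb => simp only [map_add, ha, hb]; abel
    | tmul x y => simp [add_mul]
  zero_mul φ := by
    ext h
    obtain ⟨z, hz⟩ := Bal.exists_rep (D.comul h)
    rw [mul_apply, hook_eq _ hz]
    have : hookAux (0 : RightDual hD) z = 0 := by
      clear hz
      induction z with
      | zero => simp
      | add a b ha hb => simp only [map_add, ha, hb, add_zero]
      | tmul x y => rw [hookAux_tmul]; change D.src 0 * y = 0; simp
    rw [this]
    exact map_zero φ
  mul_zero φ := by ext h; rfl
  mul_assoc φ ψ χ := by ext h; simp [hook_mul]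
  one_mul φ := by ext h; simp [hook_one]
  mul_one φ := by ext h; simp [counit_hook]

instance : Algebra K (RightDual hD) := Algebra.ofModule
  (fun k φ ψ => by
    ext h
    simp only [mul_apply, smul_apply]
    rw [← map_smul ψ]
    congr 1
    obtain ⟨z, hz⟩ := Bal.exists_rep (D.comul h)
    rw [hook_eq _ hz, hook_eq _ hz]
    clear hz
    induction z with
    | zero => simp
    | add a b ha hb => simp only [map_add, ha, hb, smul_add]
    | tmul x y => simp)
  (fun k φ ψ => by ext h; simp)

variable (hD)

/-- The element `h ↦ ε(h s(r))`. -/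
def srcElt (r : R) : RightDual hD :=
  of (D.counit ∘ₗ LinearMap.mulRight K (D.src r)) (by
    intro r' h
    simp [mul_assoc, hD.counit_tgt])

/-- The element `h ↦ r ε(h)`. -/
def tgtElt (r : R) : RightDual hD :=
  of (LinearMap.mulLeft K r ∘ₗ D.counit) (by
    intro r' h
    simp [mul_assoc, hD.counit_tgt])

variable {hD}

@[simp] theorem srcElt_apply (r : R) (h : H) : srcElt hD r h = D.counit (h * D.src r) := rfl
@[simp] theorem tgtElt_apply (r : R) (h : H) : tgtElt hD r h = r * D.counit h := rfl

theorem hook_srcElt (r : R) (h : H) : hook (srcElt hD r) h = h * D.src r := by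
  obtain ⟨z, hz⟩ := Bal.exists_rep (D.comul h)
  have h₁ : D.mk₂ (D.src r ⊗ₜ 1) = D.comul (D.src r) := by
    have := hD.comul_src r 1 _ hD.comul_one.symm
    simpa using this.symm
  have h₂ := hD.counit_left _ _ (hD.comul_mul h (D.src r) z _ hz h₁).symm
  rw [hook_eq _ hz, ← h₂]
  clear hz h₂ h₁
  induction z with
  | zero => simp
  | add a b ha hb => simp only [map_add, ha, hb, add_mul]
  | tmul x y => simp

theorem hook_tgtElt (r : R) (h : H) : hook (tgtElt hD r) h = D.src r * h := by
  obtain ⟨z, hz⟩ := Bal.exists_rep (D.comul h)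
  have h₂ := hD.counit_left _ _ hz
  rw [hook_eq _ hz]
  conv_rhs => rw [← h₂]
  clear hz h₂
  induction z with
  | zero => simp
  | add a b ha hb => simp only [map_add, ha, hb, mul_add]
  | tmul x y => simp [mul_assoc]

variable (hD)

/-- The source map `s(r) = ε(- s(r))` of the right dual. -/
def src : R →ₐ[K] RightDual hD := AlgHom.ofLinearMap
  { toFun := srcElt hD
    map_add' := fun r r' => by ext h; simp [mul_add]
    map_smul' := fun k r => by ext h; simp }
  (by ext h; simp)
  (fun r r' => by ext h; simp [hook_srcElt, mul_assoc])

/-- The target map `t(r) = r ε(-)` of the right dual. -/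
def tgt : Rᵐᵒᵖ →ₐ[K] RightDual hD := AlgHom.ofLinearMap
  { toFun := fun r => tgtElt hD r.unop
    map_add' := fun r r' => by ext h; simp [add_mul]
    map_smul' := fun k r => by ext h; simp }
  (by ext h; simp)
  (fun r r' => by ext h; simp [hook_tgtElt, hD.counit_src, mul_assoc])

/-- The counit `φ ↦ φ(1)` of the right dual. -/
def counit : RightDual hD →ₗ[K] R := toLin.flip 1

/-- The functional `h ↦ φ(h e)`. -/
def translate (e : H) : RightDual hD →ₗ[K] RightDual hD where
  toFun φ := of (toLin φ ∘ₗ LinearMap.mulRight K e) (fun r h => by simp [mul_assoc, map_tgt])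
  map_add' φ ψ := rfl
  map_smul' k φ := rfl

/-- Finite dual bases of the right `R`-module `H_R`, `h·r = t(r) h`: elements `e i` of `H` and
`f i` of `Hom(H_R, R_R)` with `h = ∑ e i · f i (h)`.  They exist if and only if `H_R` is finitely
generated projective. -/
structure DualBasis where
  n : ℕ
  e : Fin n → H
  f : Fin n → RightDual hD
  sum_eq : ∀ h, ∑ i, D.tgt (op (f i h)) * e i = h

variable {hD}

/-- The structure maps of the right dual `H^* = Hom(H_R, R_R)` of a left bialgebroid whose
right `R`-module `H_R` has the finite dual bases `b`.  The coproduct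
`Δ(φ) = ∑ φ(- e i) ⊗ f i` is the unique one with `φ(h h') = (φ₍₁₎·φ₍₂₎(h'))(h)`, i.e. with
`φ(h h') = φ₍₁₎(h t(φ₍₂₎(h')))`. -/
def data (b : DualBasis hD) : RightBialgebroidData K R (RightDual hD) where
  src := src hD
  tgt := tgt hD
  src_comm_tgt r r' := by
    ext h
    change tgtElt hD r'.unop (hook (srcElt hD r) h) = srcElt hD r (hook (tgtElt hD r'.unop) h)
    simp [hook_srcElt, hook_tgtElt, mul_assoc, hD.counit_src]
  comul := ∑ i, Bal.mk _ _ ∘ₗ (TensorProduct.mk K _ _).flip (b.f i) ∘ₗ translate hD (b.e i)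
  counit := counit hD

end RightDual

end RightDual

/-! ## The left dual of a left bialgebroid

For a left bialgebroid `H` over `R` the left dual is `*H = Hom(_R H, _R R)`; if `_R H` is finitely
generated projective then `*H` carries the structure maps of a right bialgebroid. -/

section LeftDual

variable {K R H : Type*} [CommRing K] [Ring R] [Algebra K R] [Ring H] [Algebra K H]

/-- The left `R`-linear maps `H → R`, where `r·h = s(r) h`. -/
def leftDualSubmodule (D : LeftBialgebroidData K R H) : Submodule K (H →ₗ[K] R) where
  carrier := {φ | ∀ r h, φ (D.src r * h) = r * φ h}
  add_mem' h₁ h₂ r h := by simp [h₁ r h, h₂ r h, mul_add]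
  zero_mem' r h := by simp
  smul_mem' k φ hφ r h := by simp [hφ r h]

/-- The left dual `Hom(_R H, _R R)` of the left bialgebroid `H`. -/
def LeftDual {D : LeftBialgebroidData K R H} (_ : IsLeftBialgebroid D) : Type _ :=
  leftDualSubmodule D

namespace LeftDual

variable {D : LeftBialgebroidData K R H} (hD : IsLeftBialgebroid D)

instance : AddCommGroup (LeftDual hD) := inferInstanceAs (AddCommGroup (leftDualSubmodule D))
instance : Module K (LeftDual hD) := inferInstanceAs (Module K (leftDualSubmodule D))
instance : FunLike (LeftDual hD) H R where
  coe φ := φ.1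
  coe_injective _ _ h := Subtype.ext (DFunLike.coe_injective h)

instance : LinearMapClass (LeftDual hD) K H R where
  map_add φ := φ.1.map_add
  map_smulₛₗ φ := φ.1.map_smul

variable {hD}

/-- Constructor for elements of the left dual. -/
def of (φ : H →ₗ[K] R) (h : ∀ r h, φ (D.src r * h) = r * φ h) : LeftDual hD := ⟨φ, h⟩

/-- The underlying `K`-linear map. -/
def toLin : LeftDual hD →ₗ[K] H →ₗ[K] R := (leftDualSubmodule D).subtype

@[simp] theorem of_apply (φ : H →ₗ[K] R) (hφ) (h : H) : (of φ hφ : LeftDual hD) h = φ h := rfl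
@[simp] theorem toLin_apply (φ : LeftDual hD) (h : H) : toLin φ h = φ h := rfl
@[simp] theorem add_apply (φ ψ : LeftDual hD) (h : H) : (φ + ψ) h = φ h + ψ h := rfl
@[simp] theorem smul_apply (k : K) (φ : LeftDual hD) (h : H) : (k • φ) h = k • φ h := rfl
theorem map_src (φ : LeftDual hD) (r : R) (h : H) : φ (D.src r * h) = r * φ h := φ.2 r h
@[ext] theorem ext {φ ψ : LeftDual hD} (h : ∀ x, φ x = ψ x) : φ = ψ := DFunLike.ext _ _ h

/-- `H ⊗_K H → H`, `x ⊗ y ↦ t(φ(y)) x`. -/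
def hookAux (φ : LeftDual hD) : H ⊗[K] H →ₗ[K] H :=
  LinearMap.mul' K H ∘ₗ
    (D.tgt.toLinearMap ∘ₗ (opLinearEquiv K).toLinearMap ∘ₗ toLin φ).rTensor H ∘ₗ
    (TensorProduct.comm K H H).toLinearMap

@[simp] theorem hookAux_tmul (φ : LeftDual hD) (x y : H) :
    hookAux φ (x ⊗ₜ y) = D.tgt (op (φ y)) * x := by simp [hookAux]

/-- `H ⊗_R H → H`, `x ⊗ y ↦ x·φ(y) = t(φ(y)) x`. -/
def hookBal (φ : LeftDual hD) : Bal (leftTgtAct D.tgt) (leftSrcAct D.src) →ₗ[K] H :=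
  Bal.lift (TensorProduct.curry (hookAux φ)) (by
    intro r x y
    simp [map_src, mul_assoc])

/-- `H → H`, `h ↦ h₍₁₎·φ(h₍₂₎)`. -/
def hook (φ : LeftDual hD) : H →ₗ[K] H := hookBal φ ∘ₗ D.comul

theorem hook_eq (φ : LeftDual hD) {h : H} {z : H ⊗[K] H} (hz : D.mk₂ z = D.comul h) :
    hook φ h = hookAux φ z := by
  rw [hook, LinearMap.comp_apply, ← hz]
  change TensorProduct.lift (TensorProduct.curry (hookAux φ)) z = _
  congr 1
  exact TensorProduct.ext' fun x y => by simp

theorem hook_src (φ : LeftDual hD) (r : R) (h : H) :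
    hook φ (D.src r * h) = D.src r * hook φ h := by
  obtain ⟨z, hz⟩ := Bal.exists_rep (D.comul h)
  rw [hook_eq φ hz, hook_eq φ (hD.comul_src r h z hz).symm]
  clear hz
  induction z with
  | zero => simp
  | tmul x y => simp [← mul_assoc, D.src_comm_tgt]
  | add a b ha hb => simp only [mul_add, map_add, ha, hb]

theorem hook_tgt (φ : LeftDual hD) (r : Rᵐᵒᵖ) (h : H) (z : H ⊗[K] H)
    (hz : D.mk₂ z = D.comul h) :
    hook φ (D.tgt r * h) = hookAux φ ((1 ⊗ₜ D.tgt r) * z) :=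
  hook_eq φ (hD.comul_tgt r h z hz).symm

instance : One (LeftDual hD) := ⟨of D.counit hD.counit_src⟩

/-- The product `(φψ)(h) = ψ(h₍₁₎·φ(h₍₂₎))` of the left dual. -/
instance : Mul (LeftDual hD) :=
  ⟨fun φ ψ => of (toLin ψ ∘ₗ hook φ) (fun r h => by simp [hook_src, map_src])⟩

@[simp] theorem one_apply (h : H) : (1 : LeftDual hD) h = D.counit h := rfl
@[simp] theorem mul_apply (φ ψ : LeftDual hD) (h : H) : (φ * ψ) h = ψ (hook φ h) := rfl

theorem hook_mul (φ ψ : LeftDual hD) (h : H) : hook (φ * ψ) h = hook ψ (hook φ h) := by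
  obtain ⟨z, hz⟩ := Bal.exists_rep (D.comul h)
  rw [hook_eq _ hz, hook_eq _ hz]
  let g : H ⊗[K] (H ⊗[K] H) →ₗ[K] H := hookAux ψ ∘ₗ (hookAux φ).lTensor H
  let G : Bal3 (leftTgtAct D.tgt) (leftSrcAct D.src) →ₗ[K] H := Bal3.lift g
    (by intro r x y z
        simp only [g, LinearMap.comp_apply, LinearMap.lTensor_tmul, hookAux_tmul,
          LinearMap.mulLeft_apply]
        rw [← mul_assoc (D.tgt _) (D.src _), ← D.src_comm_tgt, mul_assoc (D.src _), map_src,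
          op_mul, map_mul D.tgt, mul_assoc])
    (by intro r x y z; simp [g, map_src, mul_assoc])
  have key := congrArg G (hD.coassoc h z hz)
  have e₁ : ∀ z, G (Bal3.joinLeft _ _ (D.comul.rTensor H z)) = hook ψ (hookAux φ z) := by
    intro z
    induction z with
    | zero => simp
    | add a b ha hb => simp only [map_add, ha, hb]
    | tmul x y =>
      obtain ⟨w, hw⟩ := Bal.exists_rep (D.comul x)
      rw [LinearMap.rTensor_tmul, ← hw, hookAux_tmul, hook_tgt ψ _ _ _ hw]
      clear hw
      induction w with
      | zero => simp
      | add a b ha hb => simp only [map_add, TensorProduct.add_tmul, ha, hb, mul_add]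
      | tmul a b =>
        rw [Bal3.joinLeft_tmul, Bal3.lift_mk]
        simp [g]
  have e₂ : ∀ z, G (Bal3.joinRight _ _ (D.comul.lTensor H z)) = hookAux (φ * ψ) z := by
    intro z
    induction z with
    | zero => simp
    | add a b ha hb => simp only [map_add, ha, hb]
    | tmul x y =>
      obtain ⟨w, hw⟩ := Bal.exists_rep (D.comul y)
      rw [LinearMap.lTensor_tmul, ← hw, hookAux_tmul, mul_apply, hook_eq φ hw]
      clear hw
      induction w with
      | zero => simp
      | add a b ha hb => simp only [map_add, TensorProduct.tmul_add, ha, hb, add_mul, op_add]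
      | tmul a b =>
        rw [Bal3.joinRight_tmul, Bal3.lift_mk]
        simp [g]
  rw [← e₁, ← e₂, key]

theorem hook_one (h : H) : hook (1 : LeftDual hD) h = h := by
  obtain ⟨z, hz⟩ := Bal.exists_rep (D.comul h)
  rw [hook_eq _ hz]
  exact hD.counit_right h z hz

theorem counit_hook (φ : LeftDual hD) (h : H) : D.counit (hook φ h) = φ h := by
  obtain ⟨z, hz⟩ := Bal.exists_rep (D.comul h)
  rw [hook_eq _ hz]
  conv_rhs => rw [← hD.counit_left h z hz]
  clear hz
  induction z with
  | zero => simp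
  | add a b ha hb => simp only [map_add, ha, hb]
  | tmul x y => simp [hD.counit_tgt, map_src]

instance : Ring (LeftDual hD) where
  __ := (inferInstance : AddCommGroup (LeftDual hD))
  left_distrib φ ψ χ := by ext h; simp
  right_distrib φ ψ χ := by
    ext h
    simp only [mul_apply, add_apply]
    rw [← map_add χ]
    congr 1
    obtain ⟨z, hz⟩ := Bal.exists_rep (D.comul h)
    rw [hook_eq _ hz, hook_eq _ hz, hook_eq _ hz]
    clear hz
    induction z with
    | zero => simp
    | add a b ha hb => simp only [map_add, ha, hb]; abel
    | tmul x y => simp [add_mul]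
  zero_mul φ := by
    ext h
    obtain ⟨z, hz⟩ := Bal.exists_rep (D.comul h)
    rw [mul_apply, hook_eq _ hz]
    have : hookAux (0 : LeftDual hD) z = 0 := by
      clear hz
      induction z with
      | zero => simp
      | add a b ha hb => simp only [map_add, ha, hb, add_zero]
      | tmul x y => rw [hookAux_tmul]; change D.tgt (op 0) * x = 0; simp
    rw [this]
    exact map_zero φ
  mul_zero φ := by ext h; rfl
  mul_assoc φ ψ χ := by ext h; simp [hook_mul]
  one_mul φ := by ext h; simp [hook_one]
  mul_one φ := by ext h; simp [counit_hook]

instance : Algebra K (LeftDual hD) := Algebra.ofModule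
  (fun k φ ψ => by
    ext h
    simp only [mul_apply, smul_apply]
    rw [← map_smul ψ]
    congr 1
    obtain ⟨z, hz⟩ := Bal.exists_rep (D.comul h)
    rw [hook_eq _ hz, hook_eq _ hz]
    clear hz
    induction z with
    | zero => simp
    | add a b ha hb => simp only [map_add, ha, hb, smul_add]
    | tmul x y => simp)
  (fun k φ ψ => by ext h; simp)

variable (hD)

/-- The element `h ↦ ε(h) r`. -/
def srcElt (r : R) : LeftDual hD :=
  of (LinearMap.mulRight K r ∘ₗ D.counit) (by
    intro r' h
    simp [mul_assoc, hD.counit_src])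

/-- The element `h ↦ ε(h t(r))`, which is also `h ↦ ε(h s(r))`. -/
def tgtElt (r : Rᵐᵒᵖ) : LeftDual hD :=
  of (D.counit ∘ₗ LinearMap.mulRight K (D.tgt r)) (by
    intro r' h
    simp [mul_assoc, hD.counit_src])

variable {hD}

@[simp] theorem srcElt_apply (r : R) (h : H) : srcElt hD r h = D.counit h * r := rfl
@[simp] theorem tgtElt_apply (r : Rᵐᵒᵖ) (h : H) :
    tgtElt hD r h = D.counit (h * D.tgt r) := rfl

theorem hook_srcElt (r : R) (h : H) : hook (srcElt hD r) h = D.tgt (op r) * h := by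
  obtain ⟨z, hz⟩ := Bal.exists_rep (D.comul h)
  have h₂ := hD.counit_right _ _ hz
  rw [hook_eq _ hz]
  conv_rhs => rw [← h₂]
  clear hz h₂
  induction z with
  | zero => simp
  | add a b ha hb => simp only [map_add, ha, hb, mul_add]
  | tmul x y => simp [mul_assoc]

theorem hook_tgtElt (r : Rᵐᵒᵖ) (h : H) : hook (tgtElt hD r) h = h * D.tgt r := by
  obtain ⟨z, hz⟩ := Bal.exists_rep (D.comul h)
  have h₁ : D.mk₂ (1 ⊗ₜ D.tgt r) = D.comul (D.tgt r) := by
    have := hD.comul_tgt r 1 _ hD.comul_one.symm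
    simpa using this.symm
  have h₂ := hD.counit_right _ _ (hD.comul_mul h (D.tgt r) z _ hz h₁).symm
  rw [hook_eq _ hz, ← h₂]
  clear hz h₂ h₁
  induction z with
  | zero => simp
  | add a b ha hb => simp only [map_add, ha, hb, add_mul]
  | tmul x y => simp

variable (hD)

/-- The source map `s(r) = ε(-) r` of the left dual. -/
def src : R →ₐ[K] LeftDual hD := AlgHom.ofLinearMap
  { toFun := srcElt hD
    map_add' := fun r r' => by ext h; simp [mul_add]
    map_smul' := fun k r => by ext h; simp }
  (by ext h; simp)
  (fun r r' => by ext h; simp [hook_srcElt, hD.counit_tgt, mul_assoc])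

/-- The target map `t(r) = ε(- t(r))` of the left dual. -/
def tgt : Rᵐᵒᵖ →ₐ[K] LeftDual hD := AlgHom.ofLinearMap
  { toFun := tgtElt hD
    map_add' := fun r r' => by ext h; simp [mul_add]
    map_smul' := fun k r => by ext h; simp }
  (by ext h; simp)
  (fun r r' => by ext h; simp [hook_tgtElt, mul_assoc])

/-- The counit `φ ↦ φ(1)` of the left dual. -/
def counit : LeftDual hD →ₗ[K] R := toLin.flip 1

/-- The functional `h ↦ φ(h e)`. -/
def translate (e : H) : LeftDual hD →ₗ[K] LeftDual hD where
  toFun φ := of (toLin φ ∘ₗ LinearMap.mulRight K e) (fun r h => by simp [mul_assoc, map_src])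
  map_add' φ ψ := rfl
  map_smul' k φ := rfl

/-- Finite dual bases of the left `R`-module `_R H`, `r·h = s(r) h`: elements `e i` of `H` and
`f i` of `Hom(_R H, _R R)` with `h = ∑ f i (h) · e i`.  They exist if and only if `_R H` is
finitely generated projective. -/
structure DualBasis where
  n : ℕ
  e : Fin n → H
  f : Fin n → LeftDual hD
  sum_eq : ∀ h, ∑ i, D.src (f i h) * e i = h

variable {hD}

/-- The structure maps of the left dual `*H = Hom(_R H, _R R)` of a left bialgebroid whose
left `R`-module `_R H` has the finite dual bases `b`.  The coproduct
`Δ(φ) = ∑ f i ⊗ φ(- e i)` is the unique one with `φ(h h') = (φ₍₁₎(h')·φ₍₂₎)(h)`, i.e. with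
`φ(h h') = φ₍₂₎(h s(φ₍₁₎(h')))`. -/
def data (b : DualBasis hD) : RightBialgebroidData K R (LeftDual hD) where
  src := src hD
  tgt := tgt hD
  src_comm_tgt r r' := by
    ext h
    change tgtElt hD r' (hook (srcElt hD r) h) = srcElt hD r (hook (tgtElt hD r') h)
    simp [hook_srcElt, hook_tgtElt, mul_assoc, hD.counit_tgt]
  comul := ∑ i, Bal.mk _ _ ∘ₗ TensorProduct.mk K _ _ (b.f i) ∘ₗ translate hD (b.e i)
  counit := counit hD

end LeftDual

end LeftDual

/-! ## Depth two extensions -/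

namespace DepthTwo

section

variable {K A B : Type*} [CommRing K] [Ring A] [Ring B] [Algebra K A] [Algebra K B]
  (f : B →ₐ[K] A)

/-- `A ⊗_B A`. -/
abbrev TensorSq : Type _ :=
  Bal (fun b : B => LinearMap.mulRight K (f b)) (fun b : B => LinearMap.mulLeft K (f b))

/-- The pure tensor `x ⊗_B y`. -/
def tm (x y : A) : TensorSq f := Bal.mk _ _ (x ⊗ₜ[K] y)

theorem tm_add (x y y' : A) : tm f x (y + y') = tm f x y + tm f x y' := by
  simp [tm, TensorProduct.tmul_add]
theorem add_tm (x x' y : A) : tm f (x + x') y = tm f x y + tm f x' y := by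
  simp [tm, TensorProduct.add_tmul]
theorem tm_smul (k : K) (x y : A) : tm f x (k • y) = k • tm f x y := by
  simp [tm]
theorem smul_tm (k : K) (x y : A) : tm f (k • x) y = k • tm f x y := by
  simp [tm, ← TensorProduct.smul_tmul']
theorem tm_balanced (b : B) (x y : A) : tm f (x * f b) y = tm f x (f b * y) :=
  Bal.balanced (fun b : B => LinearMap.mulRight K (f b)) (fun b : B => LinearMap.mulLeft K (f b))
    b x y

theorem tensorSq_induction {p : TensorSq f → Prop} (w : TensorSq f) (h0 : p 0)
    (htm : ∀ x y, p (tm f x y)) (hadd : ∀ v w, p v → p w → p (v + w)) : p w := by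
  obtain ⟨z, rfl⟩ := Bal.exists_rep w
  induction z with
  | zero => simpa using h0
  | tmul x y => exact htm x y
  | add a b ha hb => rw [map_add]; exact hadd _ _ ha hb

/-- The `A`-bimodule structure of `A ⊗_B A`: `sandwich w a a' = a·w·a'`, i.e.
`a·(x ⊗ y)·a' = a x ⊗ y a'`. -/
def sandwich : TensorSq f →ₗ[K] A →ₗ[K] A →ₗ[K] TensorSq f :=
  Bal.lift
    (LinearMap.mk₂ K
      (fun x y => LinearMap.mk₂ K (fun a a' => tm f (a * x) (y * a'))
        (fun _ _ _ => by rw [add_mul, add_tm]) (fun _ _ _ => by rw [smul_mul_assoc, smul_tm])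
        (fun _ _ _ => by rw [mul_add, tm_add]) (fun _ _ _ => by rw [mul_smul_comm, tm_smul]))
      (fun _ _ _ => by ext; simp [mul_add, add_tm])
      (fun _ _ _ => by ext; simp [smul_tm])
      (fun _ _ _ => by ext; simp [add_mul, tm_add])
      (fun _ _ _ => by ext; simp [tm_smul]))
    (fun b x y => by ext a a'; simp [← mul_assoc, tm_balanced])

@[simp] theorem sandwich_tm (x y a a' : A) :
    sandwich f (tm f x y) a a' = tm f (a * x) (y * a') := rfl

theorem sandwich_sandwich (w : TensorSq f) (a a' c c' : A) :
    sandwich f (sandwich f w a a') c c' = sandwich f w (c * a) (a' * c') := by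
  induction w using tensorSq_induction with
  | h0 => simp
  | htm x y => simp [mul_assoc]
  | hadd v w hv hw => simp only [map_add, LinearMap.add_apply, hv, hw]

theorem sandwich_one (w : TensorSq f) : sandwich f w 1 1 = w := by
  induction w using tensorSq_induction with
  | h0 => simp
  | htm x y => simp
  | hadd v w hv hw => simp only [map_add, LinearMap.add_apply, hv, hw]

/-- `A ∣ B` is right depth two: `A ⊗_B A` is, as an `A`-`B`-bimodule, a direct summand of `A^n`
for some `n`, i.e. there are `A`-`B`-bimodule maps `i : A ⊗_B A → A^n` and `p : A^n → A ⊗_B A`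
with `p ∘ i = id`.  (Such maps are automatically `K`-linear.) -/
def IsRightD2 : Prop :=
  ∃ (n : ℕ) (i : TensorSq f →ₗ[K] (Fin n → A)) (p : (Fin n → A) →ₗ[K] TensorSq f),
    (∀ (a : A) (b : B) (w : TensorSq f), i (sandwich f w a (f b)) = fun j => a * i w j * f b) ∧
    (∀ (a : A) (b : B) (v : Fin n → A),
      p (fun j => a * v j * f b) = sandwich f (p v) a (f b)) ∧
    ∀ w, p (i w) = w

/-- `A ∣ B` is left depth two: `A ⊗_B A` is, as a `B`-`A`-bimodule, a direct summand of `A^n`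
for some `n`. -/
def IsLeftD2 : Prop :=
  ∃ (n : ℕ) (i : TensorSq f →ₗ[K] (Fin n → A)) (p : (Fin n → A) →ₗ[K] TensorSq f),
    (∀ (b : B) (a : A) (w : TensorSq f), i (sandwich f w (f b) a) = fun j => f b * i w j * a) ∧
    (∀ (b : B) (a : A) (v : Fin n → A),
      p (fun j => f b * v j * a) = sandwich f (p v) (f b) a) ∧
    ∀ w, p (i w) = w

/-- The centralizer of (the image of) `B` in `A`. -/
abbrev R : Subalgebra K A := Subalgebra.centralizer K (Set.range f)

theorem R_comm (r : R f) (b : B) : f b * r = r * f b :=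
  (Subalgebra.mem_centralizer_iff K).1 r.2 _ ⟨b, rfl⟩

/-- `S = End(_B A_B)`, with composition as multiplication. -/
def S : Subalgebra K (Module.End K A) where
  carrier := {α | (∀ b a, α (f b * a) = f b * α a) ∧ ∀ b a, α (a * f b) = α a * f b}
  mul_mem' h₁ h₂ := ⟨fun b a => by simp [h₂.1, h₁.1], fun b a => by simp [h₂.2, h₁.2]⟩
  add_mem' h₁ h₂ := ⟨fun b a => by simp [h₂.1, h₁.1, mul_add],
    fun b a => by simp [h₂.2, h₁.2, add_mul]⟩
  algebraMap_mem' k := ⟨fun b a => by simp [Module.algebraMap_end_apply],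
    fun b a => by simp [Module.algebraMap_end_apply]⟩

/-- `(A ⊗_B A)^B`, as a submodule of `A ⊗_B A`. -/
def TSub : Submodule K (TensorSq f) where
  carrier := {t | ∀ b : B, sandwich f t (f b) 1 = sandwich f t 1 (f b)}
  add_mem' h₁ h₂ b := by simp [h₁ b, h₂ b]
  zero_mem' b := by simp
  smul_mem' k t ht b := by simp [ht b]

/-- `T = (A ⊗_B A)^B`. -/
def T : Type _ := TSub f

namespace T

instance : AddCommGroup (T f) := inferInstanceAs (AddCommGroup (TSub f))
instance : Module K (T f) := inferInstanceAs (Module K (TSub f))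

/-- The inclusion of `T` in `A ⊗_B A`. -/
def val : T f →ₗ[K] TensorSq f := (TSub f).subtype

variable {f}

/-- Constructor for elements of `T`. -/
def of (w : TensorSq f) (h : ∀ b : B, sandwich f w (f b) 1 = sandwich f w 1 (f b)) : T f := ⟨w, h⟩

@[simp] theorem val_of (w : TensorSq f) (h) : val f (of w h) = w := rfl
@[ext] theorem ext {t t' : T f} (h : val f t = val f t') : t = t' := Subtype.ext h
theorem central (t : T f) (b : B) : sandwich f (val f t) (f b) 1 = sandwich f (val f t) 1 (f b) :=
  t.2 b

/-- The map `A ⊗_B A → A ⊗_B A`, `x ⊗ y ↦ x·t·y`. -/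
def insert (t : T f) : TensorSq f →ₗ[K] TensorSq f :=
  Bal.lift (sandwich f (val f t)) (fun b x y => by
    have h₁ := sandwich_sandwich f (val f t) (f b) 1 x y
    have h₂ := sandwich_sandwich f (val f t) 1 (f b) x y
    rw [central, h₂] at h₁
    simpa using h₁.symm)

@[simp] theorem insert_tm (t : T f) (x y : A) : insert t (tm f x y) = sandwich f (val f t) x y := rfl

theorem insert_sandwich (t : T f) (w : TensorSq f) (a a' : A) :
    insert t (sandwich f w a a') = sandwich f (insert t w) a a' := by
  induction w using tensorSq_induction with
  | h0 => simp
  | htm x y => simp [sandwich_sandwich]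
  | hadd v w hv hw => simp only [map_add, LinearMap.add_apply, hv, hw]

instance : One (T f) := ⟨of (tm f 1 1) (fun b => by simpa using tm_balanced f b 1 1)⟩

/-- The product of `T`: `t t' = t'¹ t¹ ⊗ t² t'²`. -/
instance : Mul (T f) :=
  ⟨fun t t' => of (insert t (val f t')) (fun b => by
    rw [← insert_sandwich, central, insert_sandwich])⟩

@[simp] theorem val_one : val f (1 : T f) = tm f 1 1 := rfl
@[simp] theorem val_mul (t t' : T f) : val f (t * t') = insert t (val f t') := rfl

theorem insert_insert (t t' : T f) (w : TensorSq f) :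
    insert t (insert t' w) = insert (t * t') w := by
  induction w using tensorSq_induction with
  | h0 => simp
  | htm x y => simp [insert_sandwich]
  | hadd v w hv hw => simp only [map_add, hv, hw]

instance : Ring (T f) where
  __ := (inferInstance : AddCommGroup (T f))
  left_distrib t u v := by ext; simp
  right_distrib t u v := by
    apply T.ext
    rw [val_mul, map_add, val_mul, val_mul]
    generalize val f v = w
    induction w using tensorSq_induction with
    | h0 => simp
    | htm x y => simp
    | hadd v w hv hw => simp only [map_add, hv, hw]; abel
  zero_mul t := by
    apply T.ext
    rw [val_mul, map_zero]
    generalize val f t = w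
    induction w using tensorSq_induction with
    | h0 => simp
    | htm x y => simp
    | hadd v w hv hw => simp only [map_add, hv, hw, add_zero]
  mul_zero t := by apply T.ext; simp
  mul_assoc t u v := by apply T.ext; simp [insert_insert]
  one_mul t := by
    apply T.ext
    rw [val_mul]
    generalize val f t = w
    induction w using tensorSq_induction with
    | h0 => simp
    | htm x y => simp
    | hadd v w hv hw => simp only [map_add, hv, hw]
  mul_one t := by apply T.ext; simp [sandwich_one]

instance : Algebra K (T f) := Algebra.ofModule
  (fun k t u => by
    apply T.ext
    rw [val_mul, map_smul, val_mul]
    generalize val f u = w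
    induction w using tensorSq_induction with
    | h0 => simp
    | htm x y => simp
    | hadd v w hv hw => simp only [map_add, hv, hw, smul_add])
  (fun k t u => by apply T.ext; simp)

variable (f)

/-- The source map `r ↦ 1 ⊗ r` of `T`. -/
def src : R f →ₐ[K] T f := AlgHom.ofLinearMap
  { toFun := fun r => of (tm f 1 r) (fun b => by
      rw [sandwich_tm, sandwich_tm, mul_one, mul_one, mul_one, ← R_comm, ← tm_balanced, one_mul])
    map_add' := fun r r' => by apply T.ext; simp [tm_add]
    map_smul' := fun k r => by apply T.ext; simp [tm_smul] }
  rfl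
  (fun r r' => by apply T.ext; simp)

/-- The target map `r ↦ r ⊗ 1` of `T`. -/
def tgt : (R f)ᵐᵒᵖ →ₐ[K] T f := AlgHom.ofLinearMap
  { toFun := fun r => of (tm f r.unop 1) (fun b => by
      simp only [sandwich_tm, one_mul, mul_one]
      rw [R_comm, tm_balanced, mul_one])
    map_add' := fun r r' => by apply T.ext; simp [add_tm]
    map_smul' := fun k r => by apply T.ext; simp [smul_tm] }
  rfl
  (fun r r' => by apply T.ext; simp)

/-- The multiplication map `A ⊗_B A → A`. -/
def mulMap : TensorSq f →ₗ[K] A := Bal.lift (LinearMap.mul K A) (fun b x y => by simp [mul_assoc])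

@[simp] theorem mulMap_tm (x y : A) : mulMap f (tm f x y) = x * y := rfl

theorem mulMap_sandwich (w : TensorSq f) (a a' : A) :
    mulMap f (sandwich f w a a') = a * mulMap f w * a' := by
  induction w using tensorSq_induction with
  | h0 => simp
  | htm x y => simp [mul_assoc]
  | hadd v w hv hw => simp only [map_add, LinearMap.add_apply, hv, hw, mul_add, add_mul]

/-- The counit `t ↦ t¹ t²` of `T`. -/
def counit : T f →ₗ[K] R f :=
  (mulMap f ∘ₗ val f).codRestrict (Subalgebra.toSubmodule (R f)) (fun t => by
    refine (Subalgebra.mem_centralizer_iff K).2 ?_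
    rintro _ ⟨b, rfl⟩
    have h := congrArg (mulMap f) (central t b)
    simpa [mulMap_sandwich] using h)

end T

namespace S

/-- The source map `r ↦ (a ↦ r a)` of `S`. -/
def src : R f →ₐ[K] S f :=
  ((Algebra.lmul K A).comp (R f).val).codRestrict (S f) (fun r =>
    ⟨fun b a => by simp [← mul_assoc, R_comm], fun b a => by simp [mul_assoc]⟩)

/-- The target map `r ↦ (a ↦ a r)` of `S`. -/
def tgt : (R f)ᵐᵒᵖ →ₐ[K] S f := AlgHom.ofLinearMap
  { toFun := fun r => ⟨LinearMap.mulRight K (r.unop : A),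
      fun b a => by simp [mul_assoc], fun b a => by simp [mul_assoc, R_comm]⟩
    map_add' := fun r r' => by ext; simp [mul_add]
    map_smul' := fun k r => by ext; simp }
  (by ext; simp)
  (fun r r' => by ext; simp [mul_assoc])

@[simp] theorem src_apply (r : R f) (a : A) : (src f r : Module.End K A) a = r * a := rfl
@[simp] theorem tgt_apply (r : (R f)ᵐᵒᵖ) (a : A) :
    (tgt f r : Module.End K A) a = a * (r.unop : A) := rfl

/-- The counit `α ↦ α(1)` of `S`. -/
def counit : S f →ₗ[K] R f where
  toFun α := ⟨(α : Module.End K A) 1, (Subalgebra.mem_centralizer_iff K).2 (by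
    rintro _ ⟨b, rfl⟩
    rw [← α.2.1, ← α.2.2, mul_one, one_mul])⟩
  map_add' _ _ := rfl
  map_smul' _ _ := rfl

end S

/-- The pairing `⟨w ∣ α⟩ = w¹ α(w²)`. -/
def rightPairing : TensorSq f →ₗ[K] S f →ₗ[K] A :=
  Bal.lift
    (LinearMap.mk₂ K
      (fun x y => (LinearMap.mulLeft K x ∘ₗ LinearMap.applyₗ y) ∘ₗ (S f).val.toLinearMap)
      (fun _ _ _ => by ext; simp [add_mul])
      (fun _ _ _ => by ext; simp)
      (fun _ _ _ => by ext; simp [mul_add])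
      (fun _ _ _ => by ext; simp))
    (fun b x y => by ext α; simp [α.2.1])

/-- The pairing `[α ∣ w] = α(w¹) w²`. -/
def leftPairing : TensorSq f →ₗ[K] S f →ₗ[K] A :=
  Bal.lift
    (LinearMap.mk₂ K
      (fun x y => (LinearMap.mulRight K y ∘ₗ LinearMap.applyₗ x) ∘ₗ (S f).val.toLinearMap)
      (fun _ _ _ => by ext; simp [add_mul])
      (fun _ _ _ => by ext; simp)
      (fun _ _ _ => by ext; simp [mul_add])
      (fun _ _ _ => by ext; simp))
    (fun b x y => by ext α; simp [mul_assoc, α.2.2])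

@[simp] theorem rightPairing_tm (x y : A) (α : S f) :
    rightPairing f (tm f x y) α = x * (α : Module.End K A) y := rfl
@[simp] theorem leftPairing_tm (x y : A) (α : S f) :
    leftPairing f (tm f x y) α = (α : Module.End K A) x * y := rfl

/-- `w ↦ w¹ ⊗ γ(w²)` on `A ⊗_B A`. -/
def applyRight (γ : S f) : TensorSq f →ₗ[K] TensorSq f :=
  Bal.lift
    (LinearMap.mk₂ K (fun x y => tm f x ((γ : Module.End K A) y))
      (fun _ _ _ => add_tm ..) (fun _ _ _ => smul_tm ..)
      (fun _ _ _ => by rw [map_add, tm_add]) (fun _ _ _ => by rw [map_smul, tm_smul]))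
    (fun b x y => by simp [γ.2.1, tm_balanced])

/-- `w ↦ β(w¹) ⊗ w²` on `A ⊗_B A`. -/
def applyLeft (β : S f) : TensorSq f →ₗ[K] TensorSq f :=
  Bal.lift
    (LinearMap.mk₂ K (fun x y => tm f ((β : Module.End K A) x) y)
      (fun _ _ _ => by rw [map_add, add_tm]) (fun _ _ _ => by rw [map_smul, smul_tm])
      (fun _ _ _ => tm_add ..) (fun _ _ _ => tm_smul ..))
    (fun b x y => by simp [β.2.2, tm_balanced])

@[simp] theorem applyRight_tm (γ : S f) (x y : A) :
    applyRight f γ (tm f x y) = tm f x ((γ : Module.End K A) y) := rfl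
@[simp] theorem applyLeft_tm (β : S f) (x y : A) :
    applyLeft f β (tm f x y) = tm f ((β : Module.End K A) x) y := rfl

theorem applyRight_sandwich (γ : S f) (w : TensorSq f) (a : A) (b : B) :
    applyRight f γ (sandwich f w a (f b)) = sandwich f (applyRight f γ w) a (f b) := by
  induction w using tensorSq_induction with
  | h0 => simp
  | htm x y => simp [γ.2.2]
  | hadd v w hv hw => simp only [map_add, LinearMap.add_apply, hv, hw]

theorem applyLeft_sandwich (β : S f) (w : TensorSq f) (b : B) (a : A) :
    applyLeft f β (sandwich f w (f b) a) = sandwich f (applyLeft f β w) (f b) a := by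
  induction w using tensorSq_induction with
  | h0 => simp
  | htm x y => simp [β.2.1]
  | hadd v w hv hw => simp only [map_add, LinearMap.add_apply, hv, hw]

/-- `t ↦ t¹ ⊗ γ(t²)` on `T`. -/
def T.applyRight (γ : S f) : T f →ₗ[K] T f where
  toFun t := T.of (DepthTwo.applyRight f γ (T.val f t)) (fun b => by
    have h₁ := applyRight_sandwich f γ (T.val f t) (f b) 1
    have h₂ := applyRight_sandwich f γ (T.val f t) 1 b
    rw [map_one] at h₁
    rw [← h₁, ← h₂, T.central])
  map_add' t u := by apply T.ext; simp
  map_smul' k t := by apply T.ext; simp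

/-- `t ↦ β(t¹) ⊗ t²` on `T`. -/
def T.applyLeft (β : S f) : T f →ₗ[K] T f where
  toFun t := T.of (DepthTwo.applyLeft f β (T.val f t)) (fun b => by
    have h₁ := applyLeft_sandwich f β (T.val f t) b 1
    have h₂ := applyLeft_sandwich f β (T.val f t) 1 (f b)
    rw [map_one] at h₂
    rw [← h₁, ← h₂, T.central])
  map_add' t u := by apply T.ext; simp
  map_smul' k t := by apply T.ext; simp

theorem rightPairing_sandwich (w : TensorSq f) (α : S f) (a : A) (b : B) :
    rightPairing f (sandwich f w a (f b)) α = a * rightPairing f w α * f b := by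
  induction w using tensorSq_induction with
  | h0 => simp
  | htm x y => simp [α.2.2, mul_assoc]
  | hadd v w hv hw => simp only [map_add, LinearMap.add_apply, hv, hw, mul_add, add_mul]

/-- `α ↦ (x ↦ w¹ α(w² x))`, with values in `End_K(A)`, for `w ∈ A ⊗_B A`. -/
def endRight : TensorSq f →ₗ[K] S f →ₗ[K] Module.End K A :=
  Bal.lift
    (LinearMap.mk₂ K
      (fun x y =>
        ({ toFun := fun α => LinearMap.mulLeft K x ∘ₗ (α : Module.End K A) ∘ₗ LinearMap.mulLeft K y
           map_add' := fun _ _ => by ext; simp [mul_add]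
           map_smul' := fun _ _ => by ext; simp } : S f →ₗ[K] Module.End K A))
      (fun _ _ _ => by ext; simp [add_mul])
      (fun _ _ _ => by ext; simp)
      (fun _ _ _ => by ext; simp [add_mul, mul_add])
      (fun _ _ _ => by ext; simp))
    (fun b x y => by ext α a; simp [α.2.1])

/-- `α ↦ (x ↦ α(x w¹) w²)`, with values in `End_K(A)`, for `w ∈ A ⊗_B A`. -/
def endLeft : TensorSq f →ₗ[K] S f →ₗ[K] Module.End K A :=
  Bal.lift
    (LinearMap.mk₂ K
      (fun x y =>
        ({ toFun := fun α => LinearMap.mulRight K y ∘ₗ (α : Module.End K A) ∘ₗ LinearMap.mulRight K x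
           map_add' := fun _ _ => by ext; simp [add_mul]
           map_smul' := fun _ _ => by ext; simp } : S f →ₗ[K] Module.End K A))
      (fun _ _ _ => by ext; simp [add_mul, mul_add])
      (fun _ _ _ => by ext; simp)
      (fun _ _ _ => by ext; simp [mul_add])
      (fun _ _ _ => by ext; simp))
    (fun b x y => by ext α a; simp [α.2.2])

@[simp] theorem endRight_tm (x y : A) (α : S f) (a : A) :
    endRight f (tm f x y) α a = x * (α : Module.End K A) (y * a) := rfl
@[simp] theorem endLeft_tm (x y : A) (α : S f) (a : A) :
    endLeft f (tm f x y) α a = (α : Module.End K A) (a * x) * y := rfl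

theorem endRight_sandwich (w : TensorSq f) (α : S f) (c c' a : A) :
    endRight f (sandwich f w c c') α a = c * endRight f w α (c' * a) := by
  induction w using tensorSq_induction with
  | h0 => simp
  | htm x y => simp [mul_assoc]
  | hadd v w hv hw => simp only [map_add, LinearMap.add_apply, hv, hw, mul_add]

theorem endLeft_sandwich (w : TensorSq f) (α : S f) (c c' a : A) :
    endLeft f (sandwich f w c c') α a = endLeft f w α (a * c) * c' := by
  induction w using tensorSq_induction with
  | h0 => simp
  | htm x y => simp [mul_assoc]
  | hadd v w hv hw => simp only [map_add, LinearMap.add_apply, hv, hw, add_mul]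

theorem endRight_mul (w : TensorSq f) (α : S f) (a : A) (b : B) :
    endRight f w α (a * f b) = endRight f w α a * f b := by
  induction w using tensorSq_induction with
  | h0 => simp
  | htm x y => simp [← mul_assoc, α.2.2]
  | hadd v w hv hw => simp only [map_add, LinearMap.add_apply, hv, hw, add_mul]

theorem endLeft_mul (w : TensorSq f) (α : S f) (a : A) (b : B) :
    endLeft f w α (f b * a) = f b * endLeft f w α a := by
  induction w using tensorSq_induction with
  | h0 => simp
  | htm x y => simp [mul_assoc, α.2.1]
  | hadd v w hv hw => simp only [map_add, LinearMap.add_apply, hv, hw, mul_add]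

/-- `α ↦ (x ↦ u¹ α(u² x))` on `S`, for `u ∈ T`. -/
def S.twistRight (u : T f) : S f →ₗ[K] S f :=
  (endRight f (T.val f u)).codRestrict (Subalgebra.toSubmodule (S f)) (fun α => by
    refine ⟨fun b a => ?_, fun b a => endRight_mul ..⟩
    have h := congrArg (fun w => endRight f w α a) (T.central u b)
    simpa [endRight_sandwich] using h.symm)

/-- `α ↦ (x ↦ α(x t¹) t²)` on `S`, for `t ∈ T`. -/
def S.twistLeft (t : T f) : S f →ₗ[K] S f :=
  (endLeft f (T.val f t)).codRestrict (Subalgebra.toSubmodule (S f)) (fun α => by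
    refine ⟨fun b a => endLeft_mul .., fun b a => ?_⟩
    have h := congrArg (fun w => endLeft f w α a) (T.central t b)
    simpa [endLeft_sandwich] using h)

/-- Right D2 quasibases: `u j ∈ T`, `γ j ∈ S` with `a ⊗ a' = ∑ a γ_j(a') u_j`. -/
structure RightQuasibasis where
  n : ℕ
  u : Fin n → T f
  γ : Fin n → S f
  sum_eq : ∀ a a' : A,
    tm f a a' = ∑ j, sandwich f (T.val f (u j)) (a * (γ j : Module.End K A) a') 1

/-- Left D2 quasibases: `t i ∈ T`, `β i ∈ S` with `a ⊗ a' = ∑ t_i β_i(a) a'`. -/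
structure LeftQuasibasis where
  n : ℕ
  t : Fin n → T f
  β : Fin n → S f
  sum_eq : ∀ a a' : A,
    tm f a a' = ∑ i, sandwich f (T.val f (t i)) 1 ((β i : Module.End K A) a * a')

variable {f}

/-- The right bialgebroid structure maps of `T` over the centralizer, for a right D2 extension:
`s(r) = 1 ⊗ r`, `t(r) = r ⊗ 1`, `Δ(t) = ∑ (t¹ ⊗ γ_j(t²)) ⊗ u_j`, `ε(t) = t¹ t²`. -/
def RightQuasibasis.bialgebroidT (q : RightQuasibasis f) : RightBialgebroidData K (R f) (T f) where
  src := T.src f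
  tgt := T.tgt f
  src_comm_tgt r r' := by
    apply T.ext
    simp [T.src, T.tgt]
  comul := ∑ j, Bal.mk _ _ ∘ₗ (TensorProduct.mk K _ _).flip (q.u j) ∘ₗ T.applyRight f (q.γ j)
  counit := T.counit f

/-- The right bialgebroid structure maps of `T` over the centralizer, for a left D2 extension:
`s(r) = 1 ⊗ r`, `t(r) = r ⊗ 1`, `Δ(t) = ∑ t_i ⊗ (β_i(t¹) ⊗ t²)`, `ε(t) = t¹ t²`. -/
def LeftQuasibasis.bialgebroidT (q : LeftQuasibasis f) : RightBialgebroidData K (R f) (T f) where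
  src := T.src f
  tgt := T.tgt f
  src_comm_tgt r r' := by
    apply T.ext
    simp [T.src, T.tgt]
  comul := ∑ i, Bal.mk _ _ ∘ₗ TensorProduct.mk K _ _ (q.t i) ∘ₗ T.applyLeft f (q.β i)
  counit := T.counit f

/-- The left bialgebroid structure maps of `S` over the centralizer, for a right D2 extension:
`s(r) = r·`, `t(r) = ·r`, `Δ(α) = ∑ γ_j ⊗ u_j¹ α(u_j² -)`, `ε(α) = α(1)`. -/
def RightQuasibasis.bialgebroidS (q : RightQuasibasis f) : LeftBialgebroidData K (R f) (S f) where
  src := S.src f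
  tgt := S.tgt f
  src_comm_tgt r r' := by ext; simp [mul_assoc]
  comul := ∑ j, Bal.mk _ _ ∘ₗ TensorProduct.mk K _ _ (q.γ j) ∘ₗ S.twistRight f (q.u j)
  counit := S.counit f

/-- The left bialgebroid structure maps of `S` over the centralizer, for a left D2 extension:
`s(r) = r·`, `t(r) = ·r`, `Δ(α) = ∑ α(- t_i¹) t_i² ⊗ β_i`, `ε(α) = α(1)`. -/
def LeftQuasibasis.bialgebroidS (q : LeftQuasibasis f) : LeftBialgebroidData K (R f) (S f) where
  src := S.src f
  tgt := S.tgt f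
  src_comm_tgt r r' := by ext; simp [mul_assoc]
  comul := ∑ i, Bal.mk _ _ ∘ₗ (TensorProduct.mk K _ _).flip (q.β i) ∘ₗ S.twistLeft f (q.t i)
  counit := S.counit f

end

end DepthTwo

/-! Two-variable evaluation carries the whole argument: each coproduct is pinned down by what it
does to a product, and each balanced tensor product is shown to be separated by evaluations. An
identity in `H ⊗_R H` or `H ⊗_R H ⊗_R H` then becomes an identity between functions.

For `S`, evaluate `g ⊗ h` as `g(x) h(y)` in `A`. The right quasibasis identity for `1 ⊗ a` gives `α
= ∑ γ_j · ⟨u_j ∣ α⟩`, so the `γ_j` and `⟨u_j ∣ -⟩` are dual bases of `S_R`. Because the coefficient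
functionals are themselves built from evaluations, the tensor square and cube of `S` embed into
functions on powers of `A`. The coproduct satisfies `α₍₁₎(x) α₍₂₎(y) = α(x y)`, and the axioms
become the associativity and unit laws of `A` (`EndRep.isLeftBialgebroid`,
`EndRep.isLeftBialgebroid_of_rightExpansion`).

For the right dual of any left bialgebroid `H` with dual bases, evaluate `φ ⊗ ψ` as `φ(x t(ψ(y)))`.
Dual bases make this separate points, and the coproduct is characterized by the value `φ(x y)`. The
axioms again follow by evaluation (`RightDual.isRightBialgebroid`); multiplicativity is the
substantial one. The characterization does not mention the dual bases, so they can be arbitrary.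

For `η`, the map `α ↦ φ(α₍₁₎)·α₍₂₎` belonging to `φ = ⟨t ∣ -⟩` is `α ↦ t¹ α(t² -)`, which makes `η`
multiplicative. Injectivity holds because `w = ∑ ⟨w ∣ γ_j⟩ u_j`. Surjectivity holds because every
functional is a combination of the `⟨u_j ∣ -⟩` with coefficients from the target map. Compatibility
with coproducts amounts to `∑ t¹ α(γ_j(t²) ⟨u_j ∣ β⟩) = ⟨t ∣ α β⟩`.

The axioms for `T` are never checked in `T ⊗_R T`: they are pulled back along `η` from the dual
(`IsRightBialgebroidIso.isRightBialgebroid`). The left D2 case is the mirror image, with evaluation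
`ψ(x s(φ(y)))` on the left dual. -/

/-! ### Functoriality of the balanced tensor square and cube -/

section Functoriality

variable {K R H H' : Type*} [CommRing K] [AddCommGroup H] [Module K H]
  [AddCommGroup H'] [Module K H']

/-- The map `H ⊗_R H → H' ⊗_R H'` induced by an `R`-bimodule map `H → H'`. -/
def Bal.map {ρ σ : R → H →ₗ[K] H} {ρ' σ' : R → H' →ₗ[K] H'} (g : H →ₗ[K] H')
    (hρ : ∀ r x, g (ρ r x) = ρ' r (g x)) (hσ : ∀ r x, g (σ r x) = σ' r (g x)) :
    Bal ρ σ →ₗ[K] Bal ρ' σ' :=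
  Submodule.mapQ _ _ (TensorProduct.map g g) <| by
    refine Submodule.span_le.2 ?_
    rintro w ⟨r, x, y, rfl⟩
    exact Submodule.subset_span ⟨r, g x, g y, by simp [hρ, hσ]⟩

theorem Bal.map_mk {ρ σ : R → H →ₗ[K] H} {ρ' σ' : R → H' →ₗ[K] H'} (g : H →ₗ[K] H')
    (hρ : ∀ r x, g (ρ r x) = ρ' r (g x)) (hσ : ∀ r x, g (σ r x) = σ' r (g x)) (z : H ⊗[K] H) :
    Bal.map g hρ hσ (Bal.mk ρ σ z) = Bal.mk ρ' σ' (TensorProduct.map g g z) := rfl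

/-- The map `H ⊗_R H ⊗_R H → H' ⊗_R H' ⊗_R H'` induced by an `R`-bimodule map `H → H'`. -/
def Bal3.map {ρ σ : R → H →ₗ[K] H} {ρ' σ' : R → H' →ₗ[K] H'} (g : H →ₗ[K] H')
    (hρ : ∀ r x, g (ρ r x) = ρ' r (g x)) (hσ : ∀ r x, g (σ r x) = σ' r (g x)) :
    Bal3 ρ σ →ₗ[K] Bal3 ρ' σ' :=
  Submodule.mapQ _ _ (TensorProduct.map g (TensorProduct.map g g)) <| by
    refine Submodule.span_le.2 ?_
    rintro w (⟨r, x, y, z, rfl⟩ | ⟨r, x, y, z, rfl⟩)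
    · exact Submodule.subset_span (Or.inl ⟨r, g x, g y, g z, by simp [hρ, hσ]⟩)
    · exact Submodule.subset_span (Or.inr ⟨r, g x, g y, g z, by simp [hρ, hσ]⟩)

theorem Bal3.map_mk {ρ σ : R → H →ₗ[K] H} {ρ' σ' : R → H' →ₗ[K] H'} (g : H →ₗ[K] H')
    (hρ : ∀ r x, g (ρ r x) = ρ' r (g x)) (hσ : ∀ r x, g (σ r x) = σ' r (g x)) (z) :
    Bal3.map g hρ hσ ((bal3Rel ρ σ).mkQ z) =
      (bal3Rel ρ' σ').mkQ (TensorProduct.map g (TensorProduct.map g g) z) := rfl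

/-- The inverse of `g` also commutes with the two actions (check after applying `g`), so
functoriality supplies a left inverse. Injectivity of `g` alone would not suffice, since tensor
products need not preserve it. -/
theorem Bal.map_injective {ρ σ : R → H →ₗ[K] H} {ρ' σ' : R → H' →ₗ[K] H'} (g : H →ₗ[K] H')
    (hρ : ∀ r x, g (ρ r x) = ρ' r (g x)) (hσ : ∀ r x, g (σ r x) = σ' r (g x))
    (hg : Function.Bijective g) : Function.Injective (Bal.map g hρ hσ) := by
  let e := LinearEquiv.ofBijective g hg
  have he : ∀ x, e.symm (g x) = x := e.symm_apply_apply
  have he' : ∀ x, g (e.symm x) = x := e.apply_symm_apply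
  refine Function.LeftInverse.injective (g := Bal.map e.symm.toLinearMap
    (fun r x => hg.1 ?_) (fun r x => hg.1 ?_)) fun w => ?_
  · simp [hρ, he']
  · simp [hσ, he']
  · obtain ⟨z, rfl⟩ := Bal.exists_rep w
    rw [Bal.map_mk, Bal.map_mk]
    congr 1
    induction z with
    | zero => simp
    | tmul x y => simp [he]
    | add a b ha hb => simp only [map_add, ha, hb]

theorem Bal3.map_injective {ρ σ : R → H →ₗ[K] H} {ρ' σ' : R → H' →ₗ[K] H'} (g : H →ₗ[K] H')
    (hρ : ∀ r x, g (ρ r x) = ρ' r (g x)) (hσ : ∀ r x, g (σ r x) = σ' r (g x))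
    (hg : Function.Bijective g) : Function.Injective (Bal3.map g hρ hσ) := by
  let e := LinearEquiv.ofBijective g hg
  have he : ∀ x, e.symm (g x) = x := e.symm_apply_apply
  have he' : ∀ x, g (e.symm x) = x := e.apply_symm_apply
  refine Function.LeftInverse.injective (g := Bal3.map e.symm.toLinearMap
    (fun r x => hg.1 ?_) (fun r x => hg.1 ?_)) fun w => ?_
  · simp [hρ, he']
  · simp [hσ, he']
  · obtain ⟨z, rfl⟩ := Submodule.mkQ_surjective _ w
    rw [Bal3.map_mk, Bal3.map_mk]
    congr 1
    have : ∀ y : H ⊗[K] H, TensorProduct.map e.symm.toLinearMap e.symm.toLinearMap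
        (TensorProduct.map g g y) = y := by
      intro y
      induction y with
      | zero => simp
      | tmul x y => simp [he]
      | add a b ha hb => simp only [map_add, ha, hb]
    induction z with
    | zero => simp
    | tmul x y => rw [TensorProduct.map_tmul, TensorProduct.map_tmul, this]; simp [he]
    | add a b ha hb => simp only [map_add, ha, hb]

end Functoriality

/-! ### Explicit representatives of coproducts given by finite sums -/

section Sums

variable {K R H : Type*} [CommRing K] [Ring R] [Algebra K R] [Ring H] [Algebra K H]

theorem LeftBialgebroidData.comul_apply_of_eq_sum {D : LeftBialgebroidData K R H} {ι : Type*}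
    {s : Finset ι} {g : ι → H →ₗ[K] H ⊗[K] H} (hD : D.comul = ∑ i ∈ s, D.mk₂ ∘ₗ g i) (h : H) :
    D.comul h = D.mk₂ (∑ i ∈ s, g i h) := by
  rw [hD, LinearMap.sum_apply, map_sum]
  rfl

theorem RightBialgebroidData.comul_apply_of_eq_sum {D : RightBialgebroidData K R H} {ι : Type*}
    {s : Finset ι} {g : ι → H →ₗ[K] H ⊗[K] H} (hD : D.comul = ∑ i ∈ s, D.mk₂ ∘ₗ g i) (h : H) :
    D.comul h = D.mk₂ (∑ i ∈ s, g i h) := by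
  rw [hD, LinearMap.sum_apply, map_sum]
  rfl

end Sums

/-! ### Transport of right bialgebroid axioms along an isomorphism -/

section Transport

variable {K R H H' : Type*} [CommRing K] [Ring R] [Algebra K R] [Ring H] [Algebra K H]
  [Ring H'] [Algebra K H'] {D : RightBialgebroidData K R H} {D' : RightBialgebroidData K R H'}
  {e : H ≃ₐ[K] H'}

/-- To check that an algebra isomorphism commutes with the coproducts, one representative of each
`Δ(h)` is enough. -/
theorem IsRightBialgebroidIso.of_exists_rep (hsrc : ∀ r, e (D.src r) = D'.src r)
    (htgt : ∀ r, e (D.tgt r) = D'.tgt r) (hcounit : ∀ h, D'.counit (e h) = D.counit h)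
    (hcomul : ∀ h, ∃ z, D.mk₂ z = D.comul h ∧
      D'.comul (e h) = D'.mk₂ (TensorProduct.map e.toLinearMap e.toLinearMap z)) :
    IsRightBialgebroidIso D D' e where
  src := hsrc
  tgt := htgt
  counit := hcounit
  comul h z hz := by
    have hρ : ∀ r x, e.toLinearMap (rightSrcAct D.src r x) =
        rightSrcAct D'.src r (e.toLinearMap x) := fun r x => by simp [hsrc]
    have hσ : ∀ r x, e.toLinearMap (rightTgtAct D.tgt r x) =
        rightTgtAct D'.tgt r (e.toLinearMap x) := fun r x => by simp [htgt]
    obtain ⟨z', hz', h'⟩ := hcomul h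
    -- The required right-hand side depends only on the class of `z` in `H ⊗_R H`: it is the image
    -- of that class under `Bal.map`.
    exact h'.trans (congrArg (Bal.map e.toLinearMap hρ hσ) (hz'.trans hz.symm))

/-- The axioms of a right bialgebroid can be pulled back along an isomorphism. -/
theorem IsRightBialgebroidIso.isRightBialgebroid (he : IsRightBialgebroidIso D D' e)
    (hD : IsRightBialgebroid D') : IsRightBialgebroid D := by
  have hρ : ∀ r x, e.toLinearMap (rightSrcAct D.src r x) = rightSrcAct D'.src r (e.toLinearMap x) :=
    fun r x => by simp [he.src]
  have hσ : ∀ r x, e.toLinearMap (rightTgtAct D.tgt r x) = rightTgtAct D'.tgt r (e.toLinearMap x) :=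
    fun r x => by simp [he.tgt]
  have hinj := Bal.map_injective e.toLinearMap hρ hσ e.bijective
  have hinj₃ := Bal3.map_injective e.toLinearMap hρ hσ e.bijective
  -- As an algebra map, `E` carries the products of representatives occurring in the axioms to the
  -- corresponding products for `D'`.
  let E : H ⊗[K] H →ₐ[K] H' ⊗[K] H' := Algebra.TensorProduct.map (e : H →ₐ[K] H') (e : H →ₐ[K] H')
  have hE : ∀ x y, E (x ⊗ₜ y) = e x ⊗ₜ e y := fun x y => rfl
  have hmk : ∀ z, Bal.map e.toLinearMap hρ hσ (D.mk₂ z) = D'.mk₂ (E z) := fun z => rfl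
  have hrep : ∀ h z, D.mk₂ z = D.comul h → D'.mk₂ (E z) = D'.comul (e h) :=
    fun h z hz => (he.comul h z hz).symm
  have hcomul : ∀ h, Bal.map e.toLinearMap hρ hσ (D.comul h) = D'.comul (e h) := by
    intro h
    obtain ⟨z, hz⟩ := Bal.exists_rep (D.comul h)
    rw [← hz, hmk, hrep h z hz]
  exact
  { comul_src := fun r h z hz => hinj <| by
      rw [hcomul, hmk, map_mul e, map_mul E, hE, he.src, map_one, hD.comul_src _ _ _ (hrep h z hz)]
    comul_tgt := fun r h z hz => hinj <| by
      rw [hcomul, hmk, map_mul e, map_mul E, hE, ← op_unop r, he.tgt, map_one,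
        hD.comul_tgt _ _ _ (hrep h z hz)]
    coassoc := fun h z hz => hinj₃ <| by
      have e₁ : ∀ z, Bal3.map e.toLinearMap hρ hσ (Bal3.joinLeft _ _ (D.comul.rTensor H z)) =
          Bal3.joinLeft _ _ (D'.comul.rTensor H' (E z)) := by
        intro z
        induction z with
        | zero => simp
        | add a b ha hb => simp only [map_add, ha, hb]
        | tmul x y =>
          obtain ⟨w, hw⟩ := Bal.exists_rep (D.comul x)
          rw [LinearMap.rTensor_tmul, hE, LinearMap.rTensor_tmul, ← hrep x w hw, ← hw]
          clear hw
          induction w with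
          | zero => simp
          | add a b ha hb => simp only [map_add, TensorProduct.add_tmul, ha, hb]
          | tmul a b =>
            rw [Bal3.joinLeft_tmul, hE, Bal3.joinLeft_tmul, Bal3.map_mk]
            rfl
      have e₂ : ∀ z, Bal3.map e.toLinearMap hρ hσ (Bal3.joinRight _ _ (D.comul.lTensor H z)) =
          Bal3.joinRight _ _ (D'.comul.lTensor H' (E z)) := by
        intro z
        induction z with
        | zero => simp
        | add a b ha hb => simp only [map_add, ha, hb]
        | tmul x y =>
          obtain ⟨w, hw⟩ := Bal.exists_rep (D.comul y)
          rw [LinearMap.lTensor_tmul, hE, LinearMap.lTensor_tmul, ← hrep y w hw, ← hw]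
          clear hw
          induction w with
          | zero => simp
          | add a b ha hb => simp only [map_add, TensorProduct.tmul_add, ha, hb]
          | tmul a b =>
            rw [Bal3.joinRight_tmul, hE, Bal3.joinRight_tmul, Bal3.map_mk]
            rfl
      rw [e₁, e₂, hD.coassoc _ _ (hrep h z hz)]
    counit_src := fun r h => by
      rw [← he.counit, map_mul e, he.src, hD.counit_src, he.counit]
    counit_tgt := fun r h => by
      rw [← he.counit, map_mul e, he.tgt, hD.counit_tgt, he.counit]
    counit_left := fun h z hz => e.injective <| by
      rw [← hD.counit_left _ _ (hrep h z hz)]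
      clear hz
      induction z with
      | zero => simp
      | add a b ha hb => simp only [map_add, ha, hb]
      | tmul x y => simp [hE, he.tgt, he.counit]
    counit_right := fun h z hz => e.injective <| by
      rw [← hD.counit_right _ _ (hrep h z hz)]
      clear hz
      induction z with
      | zero => simp
      | add a b ha hb => simp only [map_add, ha, hb]
      | tmul x y => simp [hE, he.src, he.counit]
    takeuchi := fun r h z hz => hinj <| by
      rw [hmk, hmk, map_mul E, map_mul E, hE, hE, he.src, he.tgt, map_one,
        hD.takeuchi _ _ _ (hrep h z hz)]
    comul_one := hinj <| by rw [hcomul, hmk, hE, map_one, hD.comul_one]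
    comul_mul := fun h h' z z' hz hz' => hinj <| by
      rw [hcomul, hmk, map_mul e, map_mul E, hD.comul_mul _ _ _ _ (hrep h z hz) (hrep h' z' hz')]
    counit_one := by rw [← he.counit, map_one, hD.counit_one]
    counit_mul_src := fun h h' => by
      rw [← he.counit, ← he.counit, map_mul e, map_mul e, he.src, hD.counit_mul_src, he.counit h]
    counit_mul_tgt := fun h h' => by
      rw [← he.counit, ← he.counit, map_mul e, map_mul e, he.tgt, hD.counit_mul_tgt, he.counit h] }

end Transport

/-! ### The right dual as a right bialgebroid -/

section RightDual

variable {K R H : Type*} [CommRing K] [Ring R] [Algebra K R] [Ring H] [Algebra K H]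

namespace RightDual

variable {D : LeftBialgebroidData K R H} {hD : IsLeftBialgebroid D}

@[simp] theorem zero_apply (h : H) : (0 : RightDual hD) h = 0 := rfl

/-- Since `Δ(t(r)) = 1 ⊗ t(r)`, right multiplication by `t(r)` affects only the second leg, which
`hook φ` keeps as its right factor. -/
theorem hook_mul_tgt (φ : RightDual hD) (r : R) (h : H) :
    hook φ (h * D.tgt (op r)) = hook φ h * D.tgt (op r) := by
  obtain ⟨z, hz⟩ := Bal.exists_rep (D.comul h)
  have h₁ : D.mk₂ (1 ⊗ₜ D.tgt (op r)) = D.comul (D.tgt (op r)) := by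
    simpa using (hD.comul_tgt (op r) 1 _ hD.comul_one.symm).symm
  rw [hook_eq φ hz, hook_eq φ (hD.comul_mul h _ z _ hz h₁).symm]
  clear hz
  induction z with
  | zero => simp
  | add a b ha hb => simp only [map_add, ha, hb, add_mul]
  | tmul x y => simp [mul_assoc]

theorem hook_apply_one (φ : RightDual hD) : hook φ 1 = D.src (φ 1) := by
  rw [hook_eq φ hD.comul_one.symm]
  simp

/-- The counit does not distinguish `s(r)` from `t(r)` as a right factor, so the source on the right
turns into a translation by `t(r)`, which passes through `hook φ`. With the next three lemmas this
describes all products with source and target elements in terms of arguments in `H`. -/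
theorem mul_src_apply (φ : RightDual hD) (r : R) (h : H) :
    (φ * src hD r) h = φ (h * D.tgt (op r)) := by
  have h₂ := hD.counit_mul_tgt (hook φ h) (D.src r)
  rw [show D.counit (D.src r) = r by simpa [hD.counit_one] using hD.counit_src r 1,
    ← hook_mul_tgt, counit_hook] at h₂
  exact h₂

theorem mul_tgt_apply (φ : RightDual hD) (r : R) (h : H) :
    (φ * tgt hD (op r)) h = r * φ h := by
  change r * D.counit (hook φ h) = _
  rw [counit_hook]

theorem src_mul_apply (φ : RightDual hD) (r : R) (h : H) :
    (src hD r * φ) h = φ (h * D.src r) := by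
  change φ (hook (srcElt hD r) h) = _
  rw [hook_srcElt]

theorem tgt_mul_apply (φ : RightDual hD) (r : R) (h : H) :
    (tgt hD (op r) * φ) h = φ (D.src r * h) := by
  change φ (hook (tgtElt hD r) h) = _
  rw [hook_tgtElt]

variable (hD) in
/-- `φ ⊗ ψ ↦ φ(- t(ψ(h)))`. -/
def evalSnd (h : H) : RightDual hD ⊗[K] RightDual hD →ₗ[K] RightDual hD :=
  TensorProduct.lift <| LinearMap.mk₂ K
    (fun φ ψ => translate hD (D.tgt (op (ψ h))) φ)
    (fun _ _ _ => map_add ..) (fun _ _ _ => map_smul ..)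
    (fun φ ψ χ => by
      ext x
      change φ (x * D.tgt (op (ψ h + χ h))) = φ _ + φ _
      rw [op_add, map_add, mul_add, map_add]
      rfl)
    (fun k φ ψ => by
      ext x
      change φ (x * D.tgt (op (k • ψ h))) = k • φ (x * D.tgt (op (ψ h)))
      rw [op_smul, map_smul, mul_smul_comm, map_smul])

@[simp] theorem evalSnd_tmul (φ ψ : RightDual hD) (h x : H) :
    evalSnd hD h (φ ⊗ₜ ψ) x = φ (x * D.tgt (op (ψ h))) := rfl

variable (hD) in
/-- `φ ⊗ ψ ↦ φ(- t(ψ(h)))` on `H^* ⊗_R H^*`. -/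
def evalBal (h : H) :
    Bal (rightSrcAct (src hD)) (rightTgtAct (tgt hD)) →ₗ[K] RightDual hD :=
  Bal.lift (TensorProduct.curry (evalSnd hD h)) (by
    intro r φ ψ
    ext x
    simp only [TensorProduct.curry_apply, LinearMap.mulRight_apply, evalSnd_tmul]
    rw [mul_src_apply, mul_tgt_apply, mul_assoc, ← map_mul, ← op_mul])

theorem evalBal_mk (h : H) (z : RightDual hD ⊗[K] RightDual hD) :
    evalBal hD h (Bal.mk _ _ z) = evalSnd hD h z := by
  rw [evalBal, Bal.lift_mk]
  rfl

/-- Right linearity of `φ` applied to `h = ∑ e_i · f_i(h)` gives `φ(h) = ∑ φ(e_i) f_i(h)`, and right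
multiplication by the target of `r` is left multiplication of values by `r`. -/
theorem eq_sum_mul_tgt (b : DualBasis hD) (φ : RightDual hD) :
    φ = ∑ i, b.f i * tgt hD (op (φ (b.e i))) := by
  ext h
  rw [← toLin_apply (∑ i, _), map_sum, LinearMap.sum_apply]
  conv_lhs => rw [← b.sum_eq h, map_sum]
  exact Finset.sum_congr rfl fun i _ => by rw [map_tgt, toLin_apply, mul_tgt_apply]

theorem mk_tmul_mul_tgt (φ ψ : RightDual hD) (r : R) :
    Bal.mk (rightSrcAct (src hD)) (rightTgtAct (tgt hD)) (φ ⊗ₜ (ψ * tgt hD (op r))) =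
      Bal.mk _ _ (translate hD (D.tgt (op r)) φ ⊗ₜ ψ) := by
  rw [show translate hD (D.tgt (op r)) φ = φ * src hD r by
    ext h; rw [mul_src_apply]; rfl]
  exact (Bal.balanced (rightSrcAct (src hD)) (rightTgtAct (tgt hD)) r φ ψ).symm

/-- Expand the second leg in the dual bases and move the coefficients across `⊗_R`. Hence a class in
`H^* ⊗_R H^*` is determined by the function `(x, y) ↦ φ(x t(ψ(y)))`, which is how equalities in this
tensor square are proved. -/
theorem mk_eq_sum_evalSnd (b : DualBasis hD) (z : RightDual hD ⊗[K] RightDual hD) :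
    Bal.mk (rightSrcAct (src hD)) (rightTgtAct (tgt hD)) z =
      ∑ i, Bal.mk _ _ (evalSnd hD (b.e i) z ⊗ₜ b.f i) := by
  induction z with
  | zero => simp
  | add x y hx hy =>
    rw [map_add, hx, hy, ← Finset.sum_add_distrib]
    exact Finset.sum_congr rfl fun i _ => by rw [map_add, TensorProduct.add_tmul, map_add]
  | tmul φ ψ =>
    conv_lhs => rw [eq_sum_mul_tgt b ψ, TensorProduct.tmul_sum, map_sum]
    exact Finset.sum_congr rfl fun i _ => mk_tmul_mul_tgt ..

theorem mk_eq_of_evalSnd (b : DualBasis hD) {w w' : RightDual hD ⊗[K] RightDual hD}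
    (h : ∀ x y, evalSnd hD y w x = evalSnd hD y w' x) :
    Bal.mk (rightSrcAct (src hD)) (rightTgtAct (tgt hD)) w = Bal.mk _ _ w' := by
  rw [mk_eq_sum_evalSnd b w, mk_eq_sum_evalSnd b w']
  exact Finset.sum_congr rfl fun i _ => by rw [RightDual.ext fun x => h x (b.e i)]

theorem bal_ext (b : DualBasis hD) {w w' : Bal (rightSrcAct (src hD)) (rightTgtAct (tgt hD))}
    (h : ∀ x y, evalBal hD y w x = evalBal hD y w' x) : w = w' := by
  obtain ⟨z, rfl⟩ := Bal.exists_rep w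
  obtain ⟨z', rfl⟩ := Bal.exists_rep w'
  exact mk_eq_of_evalSnd b fun x y => by simpa only [evalBal_mk] using h x y

theorem comul_apply (b : DualBasis hD) (φ : RightDual hD) :
    (data b).comul φ = (data b).mk₂ (∑ i, translate hD (b.e i) φ ⊗ₜ b.f i) :=
  RightBialgebroidData.comul_apply_of_eq_sum (s := Finset.univ)
    (g := fun i => (TensorProduct.mk K _ _).flip (b.f i) ∘ₗ translate hD (b.e i)) rfl φ

/-- The summands are `φ(x t(f_i(y)) e_i)`, and `∑ t(f_i(y)) e_i = y`. The resulting value no longer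
involves `b`, so the coproduct is independent of the dual bases. -/
theorem evalBal_comul (b : DualBasis hD) (φ : RightDual hD) (x y : H) :
    evalBal hD y ((data b).comul φ) x = φ (x * y) := by
  rw [comul_apply]
  refine (congrArg (fun ψ : RightDual hD => ψ x) (evalBal_mk y _)).trans ?_
  rw [map_sum, ← toLin_apply, map_sum, LinearMap.sum_apply]
  conv_rhs => rw [← b.sum_eq y, Finset.mul_sum, map_sum]
  refine Finset.sum_congr rfl fun i _ => ?_
  rw [toLin_apply, evalSnd_tmul, ← mul_assoc]
  rfl

theorem evalSnd_rep (b : DualBasis hD) {φ : RightDual hD} {z : RightDual hD ⊗[K] RightDual hD}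
    (hz : (data b).mk₂ z = (data b).comul φ) (x y : H) : evalSnd hD y z x = φ (x * y) := by
  rw [← evalBal_comul b, ← hz]
  exact (congrArg (fun ψ : RightDual hD => ψ x) (evalBal_mk y z)).symm

/-- The working criterion for every coproduct formula in the dual: it suffices that the proposed
representative have the evaluations `φ(x y)`. -/
theorem comul_eq_mk (b : DualBasis hD) {φ : RightDual hD} {z : RightDual hD ⊗[K] RightDual hD}
    (h : ∀ x y, evalSnd hD y z x = φ (x * y)) : (data b).comul φ = (data b).mk₂ z :=
  bal_ext b fun x y => by
    rw [evalBal_comul, ← h]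
    exact (congrArg (fun ψ : RightDual hD => ψ x) (evalBal_mk y z)).symm

variable (hD) in
/-- `φ ⊗ (ψ ⊗ χ) ↦ φ ⊗ ψ(- t(χ(h)))` on `H^* ⊗_R H^* ⊗_R H^*`. -/
def evalThird (h : H) : Bal3 (rightSrcAct (src hD)) (rightTgtAct (tgt hD)) →ₗ[K]
    Bal (rightSrcAct (src hD)) (rightTgtAct (tgt hD)) :=
  Bal3.lift (Bal.mk _ _ ∘ₗ (evalSnd hD h).lTensor _)
    (by
      intro r φ ψ χ
      simp only [LinearMap.comp_apply, LinearMap.lTensor_tmul]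
      rw [Bal.balanced]
      congr 2
      ext x
      simp only [LinearMap.mulRight_apply, evalSnd_tmul]
      rw [mul_tgt_apply, mul_tgt_apply, evalSnd_tmul])
    (by
      intro r φ ψ χ
      simp only [LinearMap.comp_apply, LinearMap.lTensor_tmul]
      congr 2
      ext x
      simp only [LinearMap.mulRight_apply, evalSnd_tmul]
      rw [mul_src_apply, mul_tgt_apply, mul_assoc, ← map_mul, ← op_mul])

theorem evalThird_joinRight (h : H) (φ : RightDual hD)
    (w : Bal (rightSrcAct (src hD)) (rightTgtAct (tgt hD))) :
    evalThird hD h (Bal3.joinRight _ _ (φ ⊗ₜ w)) = Bal.mk _ _ (φ ⊗ₜ evalBal hD h w) := by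
  obtain ⟨z, rfl⟩ := Bal.exists_rep w
  rw [evalBal_mk]
  induction z with
  | zero => simp
  | add a b ha hb => simp only [map_add, TensorProduct.tmul_add, ha, hb]
  | tmul a b => rw [Bal3.joinRight_tmul]; rfl

theorem evalThird_joinLeft (h : H) (w : Bal (rightSrcAct (src hD)) (rightTgtAct (tgt hD)))
    (χ : RightDual hD) (x y : H) :
    evalBal hD y (evalThird hD h (Bal3.joinLeft _ _ (w ⊗ₜ χ))) x =
      evalBal hD (y * D.tgt (op (χ h))) w x := by
  obtain ⟨z, rfl⟩ := Bal.exists_rep w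
  induction z with
  | zero => simp
  | add a b ha hb => simp only [map_add, TensorProduct.add_tmul, ha, hb, add_apply]
  | tmul a b => rw [Bal3.joinLeft_tmul]; rfl

/-- With the coproduct as `C`, evaluating `(Δ ⊗ id)(z)` at `x, y, h` means evaluating `z` at `(x y,
h)`; the companion lemma gives `(x, y h)` for `id ⊗ Δ`. Coassociativity is thereby reduced to
associativity in `H`. -/
theorem evalThird_rTensor
    {C : RightDual hD →ₗ[K] Bal (rightSrcAct (src hD)) (rightTgtAct (tgt hD))}
    (hC : ∀ φ x y, evalBal hD y (C φ) x = φ (x * y)) (z : RightDual hD ⊗[K] RightDual hD)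
    (h x y : H) : evalBal hD y (evalThird hD h (Bal3.joinLeft _ _ (C.rTensor _ z))) x =
      evalSnd hD h z (x * y) := by
  induction z with
  | zero => simp
  | add a b ha hb => simp only [map_add, add_apply, ha, hb]
  | tmul φ ψ => rw [LinearMap.rTensor_tmul, evalThird_joinLeft, hC, evalSnd_tmul, mul_assoc]

theorem evalThird_lTensor
    {C : RightDual hD →ₗ[K] Bal (rightSrcAct (src hD)) (rightTgtAct (tgt hD))}
    (hC : ∀ φ x y, evalBal hD y (C φ) x = φ (x * y)) (z : RightDual hD ⊗[K] RightDual hD)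
    (h x y : H) : evalBal hD y (evalThird hD h (Bal3.joinRight _ _ (C.lTensor _ z))) x =
      evalSnd hD (y * h) z x := by
  induction z with
  | zero => simp
  | add a b ha hb => simp only [map_add, add_apply, ha, hb]
  | tmul φ ψ =>
    rw [LinearMap.lTensor_tmul, evalThird_joinRight, evalBal_mk, evalSnd_tmul, evalSnd_tmul, hC]

/-- Expanding the third leg in the dual bases recovers an element of the tensor cube from its
evaluations in that leg, which lie in the tensor square. -/
theorem bal3_ext (b : DualBasis hD) {w w' : Bal3 (rightSrcAct (src hD)) (rightTgtAct (tgt hD))}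
    (h : ∀ y, evalThird hD y w = evalThird hD y w') : w = w' := by
  have key : ∀ w : Bal3 (rightSrcAct (src hD)) (rightTgtAct (tgt hD)),
      w = ∑ i, Bal3.joinLeft _ _ (evalThird hD (b.e i) w ⊗ₜ b.f i) := by
    intro w
    obtain ⟨z, rfl⟩ := Submodule.mkQ_surjective _ w
    induction z with
    | zero => simp
    | add x y hx hy =>
      rw [map_add]
      nth_rewrite 1 [hx, hy]
      rw [← Finset.sum_add_distrib]
      exact Finset.sum_congr rfl fun i _ => by rw [map_add, TensorProduct.add_tmul, map_add]
    | tmul φ z =>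
      have := mk_eq_sum_evalSnd b z
      have h₂ : ∀ h, evalThird hD h ((bal3Rel _ _).mkQ (φ ⊗ₜ z)) =
          Bal.mk _ _ (φ ⊗ₜ evalSnd hD h z) := fun h => rfl
      have h₁ : ∀ z, (bal3Rel (rightSrcAct (src hD)) (rightTgtAct (tgt hD))).mkQ (φ ⊗ₜ z) =
          Bal3.joinRight _ _ (φ ⊗ₜ Bal.mk _ _ z) := by
        intro z
        induction z with
        | zero => simp
        | add x y hx hy => simp only [map_add, TensorProduct.tmul_add, hx, hy]
        | tmul x y => rw [Bal3.joinRight_tmul]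
      refine (h₁ z).trans ?_
      rw [this, TensorProduct.tmul_sum, map_sum]
      refine Finset.sum_congr rfl fun i _ => ?_
      rw [Bal3.joinRight_tmul, h₂, Bal3.joinLeft_tmul]
  rw [key w, key w']
  exact Finset.sum_congr rfl fun i _ => by rw [h]

/-- A product in the dual evaluates its right factor after hooking with the left one. The target
factor inside the first argument passes through `hook φ₁`, so left multiplication by `φ₁ ⊗ φ₂` only
changes the two arguments. -/
theorem evalSnd_mul_tmul (φ₁ φ₂ : RightDual hD) (z : RightDual hD ⊗[K] RightDual hD) (x y : H) :
    evalSnd hD y ((φ₁ ⊗ₜ φ₂) * z) x = evalSnd hD (hook φ₂ y) z (hook φ₁ x) := by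
  induction z with
  | zero => simp
  | add a b ha hb => simp only [mul_add, map_add, add_apply, ha, hb]
  | tmul ψ₁ ψ₂ => simp [hook_mul_tgt]

theorem hook_add (φ ψ : RightDual hD) (h : H) : hook (φ + ψ) h = hook φ h + hook ψ h := by
  obtain ⟨z, hz⟩ := Bal.exists_rep (D.comul h)
  simp only [hook_eq _ hz]
  clear hz
  induction z with
  | zero => simp
  | add a b ha hb => simp only [map_add, ha, hb]; abel
  | tmul x y => simp [add_mul]

theorem hook_zero (h : H) : hook (0 : RightDual hD) h = 0 := by
  simpa using hook_add (0 : RightDual hD) 0 h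

theorem hook_translate_tgt (φ : RightDual hD) (r : R) (h : H) :
    hook (translate hD (D.tgt (op r)) φ) h = hook φ h * D.src r := by
  rw [show translate hD (D.tgt (op r)) φ = φ * src hD r by
    ext h; rw [mul_src_apply]; rfl, hook_mul]
  exact hook_srcElt ..

/-- From `Δ(x y) = x₍₁₎ y₍₁₎ ⊗ x₍₂₎ y₍₂₎`, the hook is `s(φ(x₍₁₎ y₍₁₎)) x₍₂₎ y₍₂₎`. The
characterization of `Δ(φ)` splits `φ(x₍₁₎ y₍₁₎)` into a functional of `x₍₁₎` depending on `y₍₁₎`. -/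
theorem hook_mul_apply (b : DualBasis hD) {φ : RightDual hD} {z : RightDual hD ⊗[K] RightDual hD}
    (hz : (data b).mk₂ z = (data b).comul φ) {ι : Type*} (s : Finset ι) (y₁ y₂ : ι → H) (x y : H)
    (hv : D.mk₂ (∑ i ∈ s, y₁ i ⊗ₜ y₂ i) = D.comul y) :
    hook φ (x * y) = ∑ i ∈ s, hook (evalSnd hD (y₁ i) z) x * y₂ i := by
  obtain ⟨u, hu⟩ := Bal.exists_rep (D.comul x)
  rw [hook_eq φ (hD.comul_mul x y u _ hu hv).symm, Finset.mul_sum, map_sum]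
  refine Finset.sum_congr rfl fun i _ => ?_
  rw [hook_eq _ hu]
  clear hu
  induction u with
  | zero => simp
  | add a b ha hb => simp only [map_add, add_mul, ha, hb]
  | tmul a c => simp [evalSnd_rep b hz, mul_assoc]

/-- This is multiplicativity of the coproduct of the dual, in evaluated form. For `z = φ₁ ⊗ φ₂` the
left side is `ψ(hook φ₁ x * hook φ₂ y)`. Writing `hook φ₂ y = s(φ₂(y₍₁₎)) y₍₂₎` and absorbing the
source factor into `φ₁` yields the formula of `hook_mul_apply`. -/
theorem evalSnd_mul (b : DualBasis hD) {φ ψ : RightDual hD}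
    {z z' : RightDual hD ⊗[K] RightDual hD} (hz : (data b).mk₂ z = (data b).comul φ)
    (hz' : (data b).mk₂ z' = (data b).comul ψ) (x y : H) :
    evalSnd hD y (z * z') x = (φ * ψ) (x * y) := by
  obtain ⟨v, hv⟩ := Bal.exists_rep (D.comul y)
  obtain ⟨s, rfl⟩ := TensorProduct.exists_finset v
  rw [mul_apply, hook_mul_apply b hz s _ _ x y hv]
  -- After the rewriting, `φ` has disappeared and both sides are additive in `z`, so induction over
  -- arbitrary tensors is possible.
  clear hz
  induction z with
  | zero => simp [hook_zero]
  | add a c ha hc =>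
    simp only [add_mul, map_add, add_apply, ha, hc, hook_add, Finset.sum_add_distrib]
  | tmul φ₁ φ₂ =>
    rw [evalSnd_mul_tmul, evalSnd_rep b hz', hook_eq φ₂ hv, map_sum, Finset.mul_sum]
    refine congrArg ψ (Finset.sum_congr rfl fun i _ => ?_)
    rw [hookAux_tmul, ← mul_assoc, ← hook_translate_tgt]
    rfl

/-- The right dual of a left bialgebroid with `H_R` finitely generated projective is a right
bialgebroid. -/
theorem isRightBialgebroid (b : DualBasis hD) : IsRightBialgebroid (data b) where
  comul_src r φ z hz := comul_eq_mk b fun x y => by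
    have h : evalSnd hD y (z * 1 ⊗ₜ src hD r) x = evalSnd hD (y * D.tgt (op r)) z x := by
      clear hz
      induction z with
      | zero => simp
      | add a b ha hb => simp only [add_mul, map_add, add_apply, ha, hb]
      | tmul φ ψ => simp [-mul_apply, mul_src_apply]
    exact h.trans (by rw [evalSnd_rep b hz, ← mul_assoc, ← mul_src_apply]; rfl)
  comul_tgt r φ z hz := comul_eq_mk b fun x y => by
    have h : evalSnd hD y (z * tgt hD r ⊗ₜ 1) x = r.unop * evalSnd hD y z x := by
      clear hz
      induction z with
      | zero => simp
      | add a b ha hb => simp only [add_mul, map_add, add_apply, ha, hb, mul_add]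
      | tmul φ ψ => simpa [-mul_apply] using mul_tgt_apply φ r.unop _
    exact h.trans (by rw [evalSnd_rep b hz]; exact (mul_tgt_apply φ r.unop _).symm)
  coassoc φ z hz := bal3_ext b fun h => bal_ext b fun x y => by
    -- Both sides evaluate to `φ(x y h)`.
    refine (evalThird_rTensor (evalBal_comul b) z h x y).trans ?_
    rw [evalSnd_rep b hz, mul_assoc, ← evalSnd_rep b hz]
    exact (evalThird_lTensor (evalBal_comul b) z h x y).symm
  counit_src r φ := by
    refine (mul_src_apply φ r 1).trans ?_
    rw [one_mul, ← mul_one (D.tgt (op r)), map_tgt]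
    rfl
  counit_tgt r φ := mul_tgt_apply φ r 1
  counit_left φ z hz := by
    ext h
    -- Putting `x = 1` in `φ₍₁₎(x t(φ₍₂₎(y))) = φ(x y)` and using right linearity gives `φ₍₁₎(1)
    -- φ₍₂₎(h) = φ(h)`. The other counit axiom comes from `y = 1`.
    rw [← one_mul h, ← evalSnd_rep b hz]
    clear hz
    induction z with
    | zero => simp
    | add a b ha hb => simp only [map_add, add_apply, ha, hb]
    | tmul φ ψ =>
      refine (mul_tgt_apply ψ (φ 1) (1 * h)).trans ?_
      rw [evalSnd_tmul, one_mul, one_mul, ← map_tgt, mul_one]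
  counit_right φ z hz := by
    ext h
    rw [← mul_one h, ← evalSnd_rep b hz]
    clear hz
    induction z with
    | zero => simp
    | add a b ha hb => simp only [map_add, add_apply, ha, hb]
    | tmul φ ψ =>
      refine (mul_src_apply φ (ψ 1) (h * 1)).trans ?_
      rw [evalSnd_tmul, mul_one]
  -- Both sides evaluate to `φ(x s(r) y)`: the source factor enters at the end of the first
  -- argument, the target factor at the beginning of the second.
  takeuchi r φ z hz := mk_eq_of_evalSnd b fun x y => by
    have h₁ : ∀ z, evalSnd hD y (src hD r ⊗ₜ 1 * z) x = evalSnd hD y z (x * D.src r) := by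
      intro z
      induction z with
      | zero => simp
      | add a b ha hb => simp only [mul_add, map_add, add_apply, ha, hb]
      | tmul φ ψ => simp [-mul_apply, src_mul_apply, mul_assoc, D.src_comm_tgt]
    have h₂ : ∀ z, evalSnd hD y (1 ⊗ₜ tgt hD (op r) * z) x = evalSnd hD (D.src r * y) z x := by
      intro z
      induction z with
      | zero => simp
      | add a b ha hb => simp only [mul_add, map_add, add_apply, ha, hb]
      | tmul φ ψ => simp [-mul_apply, tgt_mul_apply]
    exact (h₁ z).trans ((h₂ z).trans
      (by rw [evalSnd_rep b hz, evalSnd_rep b hz, mul_assoc])).symm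
  comul_one := comul_eq_mk b fun x y => (hD.counit_mul_tgt x y).symm
  comul_mul φ ψ z z' hz hz' := comul_eq_mk b (evalSnd_mul b hz hz')
  counit_one := hD.counit_one
  -- The value `(φ ψ)(1)` is `ψ(s(φ(1)))`, so it depends on `φ` only through `φ(1)`; the source and
  -- target elements of `φ(1)` have the same hook at `1`.
  counit_mul_src φ ψ := congrArg ψ <| (hook_apply_one φ).trans <|
    ((hook_srcElt (φ 1) 1).trans (one_mul _)).symm
  counit_mul_tgt φ ψ := congrArg ψ <| (hook_apply_one φ).trans <|
    ((hook_tgtElt (φ 1) 1).trans (mul_one _)).symm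

end RightDual

end RightDual

/-! ### The left dual as a right bialgebroid (mirror image) -/

section LeftDual

variable {K R H : Type*} [CommRing K] [Ring R] [Algebra K R] [Ring H] [Algebra K H]

namespace LeftDual

variable {D : LeftBialgebroidData K R H} {hD : IsLeftBialgebroid D}

@[simp] theorem zero_apply (h : H) : (0 : LeftDual hD) h = 0 := rfl

/-- Here `Δ(s(r)) = s(r) ⊗ 1`, and the leg that `hook φ` retains is the first one. -/
theorem hook_mul_src (φ : LeftDual hD) (r : R) (h : H) :
    hook φ (h * D.src r) = hook φ h * D.src r := by
  obtain ⟨z, hz⟩ := Bal.exists_rep (D.comul h)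
  have h₁ : D.mk₂ (D.src r ⊗ₜ 1) = D.comul (D.src r) := by
    simpa using (hD.comul_src r 1 _ hD.comul_one.symm).symm
  rw [hook_eq φ hz, hook_eq φ (hD.comul_mul h _ z _ hz h₁).symm]
  clear hz
  induction z with
  | zero => simp
  | add a b ha hb => simp only [map_add, ha, hb, add_mul]
  | tmul x y => simp [mul_assoc]

theorem hook_apply_one (φ : LeftDual hD) : hook φ 1 = D.tgt (op (φ 1)) := by
  rw [hook_eq φ hD.comul_one.symm]
  simp

theorem mul_src_apply (φ : LeftDual hD) (r : R) (h : H) :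
    (φ * src hD r) h = φ h * r := by
  change D.counit (hook φ h) * r = _
  rw [counit_hook]

/-- Again the counit does not distinguish `t(r)` from `s(r)` as a right factor; here it is right
multiplication by the target that becomes a translation, by `s(r)`. -/
theorem mul_tgt_apply (φ : LeftDual hD) (r : R) (h : H) :
    (φ * tgt hD (op r)) h = φ (h * D.src r) := by
  have h₂ := hD.counit_mul_src (hook φ h) (D.tgt (op r))
  rw [show D.counit (D.tgt (op r)) = r by simpa [hD.counit_one] using hD.counit_tgt r 1,
    ← hook_mul_src, counit_hook] at h₂
  exact h₂

theorem src_mul_apply (φ : LeftDual hD) (r : R) (h : H) :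
    (src hD r * φ) h = φ (D.tgt (op r) * h) := by
  change φ (hook (srcElt hD r) h) = _
  rw [hook_srcElt]

theorem tgt_mul_apply (φ : LeftDual hD) (r : R) (h : H) :
    (tgt hD (op r) * φ) h = φ (h * D.tgt (op r)) := by
  change φ (hook (tgtElt hD (op r)) h) = _
  rw [hook_tgtElt]

variable (hD) in
/-- `φ ⊗ ψ ↦ ψ(- s(φ(h)))`. -/
def evalFst (h : H) : LeftDual hD ⊗[K] LeftDual hD →ₗ[K] LeftDual hD :=
  TensorProduct.lift <| LinearMap.mk₂ K
    (fun φ ψ => translate hD (D.src (φ h)) ψ)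
    (fun φ χ ψ => by
      ext x
      change ψ (x * D.src (φ h + χ h)) = ψ _ + ψ _
      rw [map_add, mul_add, map_add]
      rfl)
    (fun k φ ψ => by
      ext x
      change ψ (x * D.src (k • φ h)) = k • ψ (x * D.src (φ h))
      rw [map_smul, mul_smul_comm, map_smul])
    (fun _ _ _ => map_add ..) (fun _ _ _ => map_smul ..)

@[simp] theorem evalFst_tmul (φ ψ : LeftDual hD) (h x : H) :
    evalFst hD h (φ ⊗ₜ ψ) x = ψ (x * D.src (φ h)) := rfl

variable (hD) in
/-- `φ ⊗ ψ ↦ ψ(- s(φ(h)))` on `*H ⊗_R *H`. -/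
def evalBal (h : H) :
    Bal (rightSrcAct (src hD)) (rightTgtAct (tgt hD)) →ₗ[K] LeftDual hD :=
  Bal.lift (TensorProduct.curry (evalFst hD h)) (by
    intro r φ ψ
    ext x
    simp only [TensorProduct.curry_apply, LinearMap.mulRight_apply, evalFst_tmul]
    rw [mul_src_apply, mul_tgt_apply, mul_assoc, ← map_mul])

theorem evalBal_mk (h : H) (z : LeftDual hD ⊗[K] LeftDual hD) :
    evalBal hD h (Bal.mk _ _ z) = evalFst hD h z := by
  rw [evalBal, Bal.lift_mk]
  rfl

theorem eq_sum_mul_src (b : DualBasis hD) (φ : LeftDual hD) :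
    φ = ∑ i, b.f i * src hD (φ (b.e i)) := by
  ext h
  rw [← toLin_apply (∑ i, _), map_sum, LinearMap.sum_apply]
  conv_lhs => rw [← b.sum_eq h, map_sum]
  exact Finset.sum_congr rfl fun i _ => by rw [map_src, toLin_apply, mul_src_apply]

theorem mk_mul_src_tmul (φ ψ : LeftDual hD) (r : R) :
    Bal.mk (rightSrcAct (src hD)) (rightTgtAct (tgt hD)) ((φ * src hD r) ⊗ₜ ψ) =
      Bal.mk _ _ (φ ⊗ₜ translate hD (D.src r) ψ) := by
  rw [show translate hD (D.src r) ψ = ψ * tgt hD (op r) by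
    ext h; rw [mul_tgt_apply]; rfl]
  exact Bal.balanced (rightSrcAct (src hD)) (rightTgtAct (tgt hD)) r φ ψ

/-- The roles of the legs are exchanged: the first leg is expanded, its coefficients move to the
second, and a class is determined by `(x, y) ↦ ψ(x s(φ(y)))`. -/
theorem mk_eq_sum_evalFst (b : DualBasis hD) (z : LeftDual hD ⊗[K] LeftDual hD) :
    Bal.mk (rightSrcAct (src hD)) (rightTgtAct (tgt hD)) z =
      ∑ i, Bal.mk _ _ (b.f i ⊗ₜ evalFst hD (b.e i) z) := by
  induction z with
  | zero => simp
  | add x y hx hy =>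
    rw [map_add, hx, hy, ← Finset.sum_add_distrib]
    exact Finset.sum_congr rfl fun i _ => by rw [map_add, TensorProduct.tmul_add, map_add]
  | tmul φ ψ =>
    conv_lhs => rw [eq_sum_mul_src b φ, TensorProduct.sum_tmul, map_sum]
    exact Finset.sum_congr rfl fun i _ => mk_mul_src_tmul ..

theorem mk_eq_of_evalFst (b : DualBasis hD) {w w' : LeftDual hD ⊗[K] LeftDual hD}
    (h : ∀ x y, evalFst hD y w x = evalFst hD y w' x) :
    Bal.mk (rightSrcAct (src hD)) (rightTgtAct (tgt hD)) w = Bal.mk _ _ w' := by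
  rw [mk_eq_sum_evalFst b w, mk_eq_sum_evalFst b w']
  exact Finset.sum_congr rfl fun i _ => by rw [LeftDual.ext fun x => h x (b.e i)]

theorem bal_ext (b : DualBasis hD) {w w' : Bal (rightSrcAct (src hD)) (rightTgtAct (tgt hD))}
    (h : ∀ x y, evalBal hD y w x = evalBal hD y w' x) : w = w' := by
  obtain ⟨z, rfl⟩ := Bal.exists_rep w
  obtain ⟨z', rfl⟩ := Bal.exists_rep w'
  exact mk_eq_of_evalFst b fun x y => by simpa only [evalBal_mk] using h x y

theorem comul_apply (b : DualBasis hD) (φ : LeftDual hD) :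
    (data b).comul φ = (data b).mk₂ (∑ i, b.f i ⊗ₜ translate hD (b.e i) φ) :=
  RightBialgebroidData.comul_apply_of_eq_sum (s := Finset.univ)
    (g := fun i => TensorProduct.mk K _ _ (b.f i) ∘ₗ translate hD (b.e i)) rfl φ

theorem evalBal_comul (b : DualBasis hD) (φ : LeftDual hD) (x y : H) :
    evalBal hD y ((data b).comul φ) x = φ (x * y) := by
  rw [comul_apply]
  refine (congrArg (fun ψ : LeftDual hD => ψ x) (evalBal_mk y _)).trans ?_
  rw [map_sum, ← toLin_apply, map_sum, LinearMap.sum_apply]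
  conv_rhs => rw [← b.sum_eq y, Finset.mul_sum, map_sum]
  refine Finset.sum_congr rfl fun i _ => ?_
  rw [toLin_apply, evalFst_tmul, ← mul_assoc]
  rfl

theorem evalFst_rep (b : DualBasis hD) {φ : LeftDual hD} {z : LeftDual hD ⊗[K] LeftDual hD}
    (hz : (data b).mk₂ z = (data b).comul φ) (x y : H) : evalFst hD y z x = φ (x * y) := by
  rw [← evalBal_comul b, ← hz]
  exact (congrArg (fun ψ : LeftDual hD => ψ x) (evalBal_mk y z)).symm

theorem comul_eq_mk (b : DualBasis hD) {φ : LeftDual hD} {z : LeftDual hD ⊗[K] LeftDual hD}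
    (h : ∀ x y, evalFst hD y z x = φ (x * y)) : (data b).comul φ = (data b).mk₂ z :=
  bal_ext b fun x y => by
    rw [evalBal_comul, ← h]
    exact (congrArg (fun ψ : LeftDual hD => ψ x) (evalBal_mk y z)).symm

variable (hD) in
/-- `φ ⊗ (ψ ⊗ χ) ↦ ψ(- s(φ(h))) ⊗ χ` on `*H ⊗_R *H ⊗_R *H`. -/
def evalFirst (h : H) : Bal3 (rightSrcAct (src hD)) (rightTgtAct (tgt hD)) →ₗ[K]
    Bal (rightSrcAct (src hD)) (rightTgtAct (tgt hD)) :=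
  Bal3.lift (Bal.mk _ _ ∘ₗ (evalFst hD h).rTensor _ ∘ₗ
      (TensorProduct.assoc K _ _ _).symm.toLinearMap)
    (by
      intro r φ ψ χ
      simp only [LinearMap.comp_apply, LinearEquiv.coe_coe, TensorProduct.assoc_symm_tmul,
        LinearMap.rTensor_tmul]
      congr 2
      ext x
      simp only [LinearMap.mulRight_apply, evalFst_tmul]
      rw [mul_src_apply, mul_tgt_apply, mul_assoc, ← map_mul])
    (by
      intro r φ ψ χ
      simp only [LinearMap.comp_apply, LinearEquiv.coe_coe, TensorProduct.assoc_symm_tmul,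
        LinearMap.rTensor_tmul]
      rw [← Bal.balanced]
      congr 2
      ext x
      simp only [LinearMap.mulRight_apply, evalFst_tmul]
      rw [mul_src_apply, mul_src_apply, evalFst_tmul])

theorem evalFirst_joinLeft (h : H) (χ : LeftDual hD)
    (w : Bal (rightSrcAct (src hD)) (rightTgtAct (tgt hD))) :
    evalFirst hD h (Bal3.joinLeft _ _ (w ⊗ₜ χ)) = Bal.mk _ _ (evalBal hD h w ⊗ₜ χ) := by
  obtain ⟨z, rfl⟩ := Bal.exists_rep w
  rw [evalBal_mk]
  induction z with
  | zero => simp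
  | add a b ha hb => simp only [map_add, TensorProduct.add_tmul, ha, hb]
  | tmul a b => rw [Bal3.joinLeft_tmul]; rfl

theorem evalFirst_joinRight (h : H) (w : Bal (rightSrcAct (src hD)) (rightTgtAct (tgt hD)))
    (φ : LeftDual hD) (x y : H) :
    evalBal hD y (evalFirst hD h (Bal3.joinRight _ _ (φ ⊗ₜ w))) x =
      evalBal hD (y * D.src (φ h)) w x := by
  obtain ⟨z, rfl⟩ := Bal.exists_rep w
  induction z with
  | zero => simp
  | add a b ha hb => simp only [map_add, TensorProduct.tmul_add, ha, hb, add_apply]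
  | tmul a b => rw [Bal3.joinRight_tmul]; rfl

theorem evalFirst_lTensor
    {C : LeftDual hD →ₗ[K] Bal (rightSrcAct (src hD)) (rightTgtAct (tgt hD))}
    (hC : ∀ φ x y, evalBal hD y (C φ) x = φ (x * y)) (z : LeftDual hD ⊗[K] LeftDual hD)
    (h x y : H) : evalBal hD y (evalFirst hD h (Bal3.joinRight _ _ (C.lTensor _ z))) x =
      evalFst hD h z (x * y) := by
  induction z with
  | zero => simp
  | add a b ha hb => simp only [map_add, add_apply, ha, hb]
  | tmul φ ψ => rw [LinearMap.lTensor_tmul, evalFirst_joinRight, hC, evalFst_tmul, mul_assoc]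

theorem evalFirst_rTensor
    {C : LeftDual hD →ₗ[K] Bal (rightSrcAct (src hD)) (rightTgtAct (tgt hD))}
    (hC : ∀ φ x y, evalBal hD y (C φ) x = φ (x * y)) (z : LeftDual hD ⊗[K] LeftDual hD)
    (h x y : H) : evalBal hD y (evalFirst hD h (Bal3.joinLeft _ _ (C.rTensor _ z))) x =
      evalFst hD (y * h) z x := by
  induction z with
  | zero => simp
  | add a b ha hb => simp only [map_add, add_apply, ha, hb]
  | tmul φ ψ =>
    rw [LinearMap.rTensor_tmul, evalFirst_joinLeft, evalBal_mk, evalFst_tmul, evalFst_tmul, hC]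

theorem bal3_ext (b : DualBasis hD) {w w' : Bal3 (rightSrcAct (src hD)) (rightTgtAct (tgt hD))}
    (h : ∀ y, evalFirst hD y w = evalFirst hD y w') : w = w' := by
  have key : ∀ w : Bal3 (rightSrcAct (src hD)) (rightTgtAct (tgt hD)),
      w = ∑ i, Bal3.joinRight _ _ (b.f i ⊗ₜ evalFirst hD (b.e i) w) := by
    intro w
    obtain ⟨z, rfl⟩ := Submodule.mkQ_surjective _ w
    -- The first leg is to be expanded together with the second, so the tensor is rebracketed to
    -- expose the first two legs as one factor.
    obtain ⟨z, rfl⟩ := (TensorProduct.assoc K _ _ _).surjective z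
    induction z with
    | zero => simp
    | add x y hx hy =>
      rw [map_add, map_add]
      nth_rewrite 1 [hx, hy]
      rw [← Finset.sum_add_distrib]
      exact Finset.sum_congr rfl fun i _ => by rw [map_add, TensorProduct.tmul_add, map_add]
    | tmul z χ =>
      have h₁ : ∀ z, (bal3Rel (rightSrcAct (src hD)) (rightTgtAct (tgt hD))).mkQ
          (TensorProduct.assoc K _ _ _ (z ⊗ₜ χ)) = Bal3.joinLeft _ _ (Bal.mk _ _ z ⊗ₜ χ) := by
        intro z
        induction z with
        | zero => simp
        | add x y hx hy => simp only [map_add, TensorProduct.add_tmul, hx, hy]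
        | tmul x y => rw [Bal3.joinLeft_tmul]; rfl
      simp only [h₁, evalFirst_joinLeft, Bal3.joinRight_tmul, evalBal_mk]
      rw [mk_eq_sum_evalFst b z, TensorProduct.sum_tmul, map_sum]
      exact Finset.sum_congr rfl fun i _ => Bal3.joinLeft_tmul ..
  rw [key w, key w']
  exact Finset.sum_congr rfl fun i _ => by rw [h]

theorem evalFst_mul_tmul (φ₁ φ₂ : LeftDual hD) (z : LeftDual hD ⊗[K] LeftDual hD) (x y : H) :
    evalFst hD y ((φ₁ ⊗ₜ φ₂) * z) x = evalFst hD (hook φ₁ y) z (hook φ₂ x) := by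
  induction z with
  | zero => simp
  | add a b ha hb => simp only [mul_add, map_add, add_apply, ha, hb]
  | tmul ψ₁ ψ₂ => simp [hook_mul_src]

theorem hook_add (φ ψ : LeftDual hD) (h : H) : hook (φ + ψ) h = hook φ h + hook ψ h := by
  obtain ⟨z, hz⟩ := Bal.exists_rep (D.comul h)
  simp only [hook_eq _ hz]
  clear hz
  induction z with
  | zero => simp
  | add a b ha hb => simp only [map_add, ha, hb]; abel
  | tmul x y => simp [add_mul]

theorem hook_zero (h : H) : hook (0 : LeftDual hD) h = 0 := by
  simpa using hook_add (0 : LeftDual hD) 0 h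

theorem hook_translate_src (φ : LeftDual hD) (r : R) (h : H) :
    hook (translate hD (D.src r) φ) h = hook φ h * D.tgt (op r) := by
  rw [show translate hD (D.src r) φ = φ * tgt hD (op r) by
    ext h; rw [mul_tgt_apply]; rfl, hook_mul]
  exact hook_tgtElt ..

/-- The hook of `x y` is `t(φ(x₍₂₎ y₍₂₎)) x₍₁₎ y₍₁₎`; it is now `φ(x₍₂₎ y₍₂₎)` that is split by the
characterization of `Δ(φ)`. -/
theorem hook_mul_apply (b : DualBasis hD) {φ : LeftDual hD} {z : LeftDual hD ⊗[K] LeftDual hD}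
    (hz : (data b).mk₂ z = (data b).comul φ) {ι : Type*} (s : Finset ι) (y₁ y₂ : ι → H) (x y : H)
    (hv : D.mk₂ (∑ i ∈ s, y₁ i ⊗ₜ y₂ i) = D.comul y) :
    hook φ (x * y) = ∑ i ∈ s, hook (evalFst hD (y₂ i) z) x * y₁ i := by
  obtain ⟨u, hu⟩ := Bal.exists_rep (D.comul x)
  rw [hook_eq φ (hD.comul_mul x y u _ hu hv).symm, Finset.mul_sum, map_sum]
  refine Finset.sum_congr rfl fun i _ => ?_
  rw [hook_eq _ hu]
  clear hu
  induction u with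
  | zero => simp
  | add a b ha hb => simp only [map_add, add_mul, ha, hb]
  | tmul a c => simp [evalFst_rep b hz, mul_assoc]

/-- For `z = φ₁ ⊗ φ₂` the left side is `ψ(hook φ₂ x * hook φ₁ y)`, with `hook φ₁ y = t(φ₁(y₍₂₎))
y₍₁₎`; the target factor is absorbed into `φ₂`. -/
theorem evalFst_mul (b : DualBasis hD) {φ ψ : LeftDual hD}
    {z z' : LeftDual hD ⊗[K] LeftDual hD} (hz : (data b).mk₂ z = (data b).comul φ)
    (hz' : (data b).mk₂ z' = (data b).comul ψ) (x y : H) :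
    evalFst hD y (z * z') x = (φ * ψ) (x * y) := by
  obtain ⟨v, hv⟩ := Bal.exists_rep (D.comul y)
  obtain ⟨s, rfl⟩ := TensorProduct.exists_finset v
  rw [mul_apply, hook_mul_apply b hz s _ _ x y hv]
  clear hz
  induction z with
  | zero => simp [hook_zero]
  | add a c ha hc =>
    simp only [add_mul, map_add, add_apply, ha, hc, hook_add, Finset.sum_add_distrib]
  | tmul φ₁ φ₂ =>
    rw [evalFst_mul_tmul, evalFst_rep b hz', hook_eq φ₁ hv, map_sum, Finset.mul_sum]
    refine congrArg ψ (Finset.sum_congr rfl fun i _ => ?_)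
    rw [hookAux_tmul, ← mul_assoc, ← hook_translate_src]
    rfl

/-- The left dual of a left bialgebroid with `_R H` finitely generated projective is a right
bialgebroid. -/
theorem isRightBialgebroid (b : DualBasis hD) : IsRightBialgebroid (data b) where
  comul_src r φ z hz := comul_eq_mk b fun x y => by
    have h : evalFst hD y (z * 1 ⊗ₜ src hD r) x = evalFst hD y z x * r := by
      clear hz
      induction z with
      | zero => simp
      | add a b ha hb => simp only [add_mul, map_add, add_apply, ha, hb]
      | tmul φ ψ => simpa [-mul_apply] using mul_src_apply ψ r _
    exact h.trans (by rw [evalFst_rep b hz]; exact (mul_src_apply φ r _).symm)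
  comul_tgt r φ z hz := comul_eq_mk b fun x y => by
    have h : evalFst hD y (z * tgt hD r ⊗ₜ 1) x = evalFst hD (y * D.src r.unop) z x := by
      clear hz
      induction z with
      | zero => simp
      | add a b ha hb => simp only [add_mul, map_add, add_apply, ha, hb]
      | tmul φ ψ =>
        rw [Algebra.TensorProduct.tmul_mul_tmul, evalFst_tmul, evalFst_tmul, mul_one,
          ← mul_tgt_apply φ, op_unop]
    exact h.trans (by rw [evalFst_rep b hz, ← mul_assoc, ← mul_tgt_apply]; rfl)
  coassoc φ z hz := bal3_ext b fun h => bal_ext b fun x y => by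
    refine (evalFirst_rTensor (evalBal_comul b) z h x y).trans ?_
    rw [evalFst_rep b hz, ← mul_assoc, ← evalFst_rep b hz]
    exact (evalFirst_lTensor (evalBal_comul b) z h x y).symm
  counit_src r φ := mul_src_apply φ r 1
  counit_tgt r φ := by
    refine (mul_tgt_apply φ r 1).trans ?_
    rw [one_mul, ← mul_one (D.src r), map_src]
    rfl
  counit_left φ z hz := by
    ext h
    rw [← mul_one h, ← evalFst_rep b hz]
    clear hz
    induction z with
    | zero => simp
    | add a b ha hb => simp only [map_add, add_apply, ha, hb]
    | tmul φ ψ =>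
      refine (mul_tgt_apply ψ (φ 1) (h * 1)).trans ?_
      rw [evalFst_tmul, mul_one]
  counit_right φ z hz := by
    ext h
    rw [← one_mul h, ← evalFst_rep b hz]
    clear hz
    induction z with
    | zero => simp
    | add a b ha hb => simp only [map_add, add_apply, ha, hb]
    | tmul φ ψ =>
      refine (mul_src_apply φ (ψ 1) (1 * h)).trans ?_
      rw [evalFst_tmul, one_mul, one_mul, ← map_src, mul_one]
  -- Both sides evaluate to `φ(x t(r) y)`.
  takeuchi r φ z hz := mk_eq_of_evalFst b fun x y => by
    have h₁ : ∀ z, evalFst hD y (src hD r ⊗ₜ 1 * z) x = evalFst hD (D.tgt (op r) * y) z x := by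
      intro z
      induction z with
      | zero => simp
      | add a b ha hb => simp only [mul_add, map_add, add_apply, ha, hb]
      | tmul φ ψ => simp [-mul_apply, src_mul_apply]
    have h₂ : ∀ z, evalFst hD y (1 ⊗ₜ tgt hD (op r) * z) x =
        evalFst hD y z (x * D.tgt (op r)) := by
      intro z
      induction z with
      | zero => simp
      | add a b ha hb => simp only [mul_add, map_add, add_apply, ha, hb]
      | tmul φ ψ => simp [-mul_apply, tgt_mul_apply, mul_assoc, D.src_comm_tgt]
    exact (h₁ z).trans ((h₂ z).trans
      (by rw [evalFst_rep b hz, evalFst_rep b hz, mul_assoc])).symm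
  comul_one := comul_eq_mk b fun x y => (hD.counit_mul_src x y).symm
  comul_mul φ ψ z z' hz hz' := comul_eq_mk b (evalFst_mul b hz hz')
  counit_one := hD.counit_one
  counit_mul_src φ ψ := congrArg ψ <| (hook_apply_one φ).trans <|
    ((hook_srcElt (φ 1) 1).trans (mul_one _)).symm
  counit_mul_tgt φ ψ := congrArg ψ <| (hook_apply_one φ).trans <|
    ((hook_tgtElt (op (φ 1)) 1).trans (one_mul _)).symm

end LeftDual

end LeftDual

/-! ### Left bialgebroids from faithful representations -/

section EndRep

variable {K R H : Type*} [CommRing K] [Ring R] [Algebra K R] [Ring H] [Algebra K H]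

/-- A faithful representation of `H` on an algebra `A ⊇ R` in which the source and target maps
act by left and right multiplications and the counit is evaluation at `1`. -/
structure EndRep (D : LeftBialgebroidData K R H) (A : Type*) [Ring A] [Algebra K A] where
  act : H →ₐ[K] Module.End K A
  incl : R →ₐ[K] A
  act_injective : Function.Injective act
  incl_injective : Function.Injective incl
  act_src : ∀ r a, act (D.src r) a = incl r * a
  act_tgt : ∀ r a, act (D.tgt r) a = a * incl r.unop
  incl_counit : ∀ h, incl (D.counit h) = act h 1

namespace EndRep

variable {A : Type*} [Ring A] [Algebra K A] {D : LeftBialgebroidData K R H} (ρ : EndRep D A)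

theorem ext {g h : H} (e : ∀ a, ρ.act g a = ρ.act h a) : g = h :=
  ρ.act_injective (LinearMap.ext e)

/-- `g ⊗ h ↦ g(x) h(y)`. -/
def ev₂ (x y : A) : H ⊗[K] H →ₗ[K] A :=
  LinearMap.mul' K A ∘ₗ TensorProduct.map (LinearMap.applyₗ x ∘ₗ ρ.act.toLinearMap)
    (LinearMap.applyₗ y ∘ₗ ρ.act.toLinearMap)

@[simp] theorem ev₂_tmul (x y : A) (g h : H) :
    ρ.ev₂ x y (g ⊗ₜ h) = ρ.act g x * ρ.act h y := rfl

/-- `g ⊗ h ↦ g(x) h(y)` on `H ⊗_R H`. -/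
def evSq (x y : A) : Bal (leftTgtAct D.tgt) (leftSrcAct D.src) →ₗ[K] A :=
  Bal.lift (TensorProduct.curry (ρ.ev₂ x y))
    (fun r g h => by simp [ρ.act_src, ρ.act_tgt, mul_assoc])

/-- `g ⊗ h ⊗ k ↦ g(x) h(y) k(z)`. -/
def ev₃ (x y z : A) : H ⊗[K] (H ⊗[K] H) →ₗ[K] A :=
  LinearMap.mul' K A ∘ₗ TensorProduct.map (LinearMap.applyₗ x ∘ₗ ρ.act.toLinearMap) (ρ.ev₂ y z)

@[simp] theorem ev₃_tmul (x y z : A) (g : H) (w : H ⊗[K] H) :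
    ρ.ev₃ x y z (g ⊗ₜ w) = ρ.act g x * ρ.ev₂ y z w := rfl

/-- `g ⊗ h ⊗ k ↦ g(x) h(y) k(z)` on `H ⊗_R H ⊗_R H`. -/
def evCube (x y z : A) : Bal3 (leftTgtAct D.tgt) (leftSrcAct D.src) →ₗ[K] A :=
  Bal3.lift (ρ.ev₃ x y z) (fun r g h k => by simp [ρ.act_src, ρ.act_tgt, mul_assoc])
    (fun r g h k => by simp [ρ.act_src, ρ.act_tgt, mul_assoc])

theorem evSq_mk (x y : A) (w : H ⊗[K] H) : ρ.evSq x y (D.mk₂ w) = ρ.ev₂ x y w := by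
  rw [evSq, Bal.lift_mk]
  congr 1
  exact TensorProduct.ext' fun _ _ => rfl

theorem evCube_joinRight (x y z : A) (g : H) (w : Bal (leftTgtAct D.tgt) (leftSrcAct D.src)) :
    ρ.evCube x y z (Bal3.joinRight _ _ (g ⊗ₜ w)) = ρ.act g x * ρ.evSq y z w := by
  obtain ⟨w, rfl⟩ := Bal.exists_rep w
  rw [evSq_mk]
  induction w with
  | zero => simp
  | add a b ha hb => simp only [map_add, TensorProduct.tmul_add, ha, hb, mul_add]
  | tmul a b => rw [Bal3.joinRight_tmul]; rfl

theorem evCube_joinLeft (x y z : A) (w : Bal (leftTgtAct D.tgt) (leftSrcAct D.src)) (k : H) :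
    ρ.evCube x y z (Bal3.joinLeft _ _ (w ⊗ₜ k)) = ρ.evSq x y w * ρ.act k z := by
  obtain ⟨w, rfl⟩ := Bal.exists_rep w
  rw [evSq_mk]
  induction w with
  | zero => simp
  | add a b ha hb => simp only [map_add, TensorProduct.add_tmul, ha, hb, add_mul]
  | tmul a b =>
    rw [Bal3.joinLeft_tmul, ev₂_tmul, mul_assoc]
    rfl

theorem ev₂_mul_tmul (x y : A) (w : H ⊗[K] H) (g h : H) :
    ρ.ev₂ x y (w * (g ⊗ₜ h)) = ρ.ev₂ (ρ.act g x) (ρ.act h y) w := by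
  induction w with
  | zero => simp
  | add a b ha hb => simp only [map_add, add_mul, ha, hb]
  | tmul a b => simp

section

variable (hΔ : ∀ h x y, ρ.evSq x y (D.comul h) = ρ.act h (x * y))
include hΔ

/-- If the coproduct satisfies `h₍₁₎(x) h₍₂₎(y) = h(x y)`, then the two sides of coassociativity
evaluate to `h((x y) z)` and, by the next lemma, `h(x (y z))`. -/
theorem evCube_rTensor (w : H ⊗[K] H) (x y z : A) :
    ρ.evCube x y z (Bal3.joinLeft _ _ (D.comul.rTensor _ w)) = ρ.ev₂ (x * y) z w := by
  induction w with
  | zero => simp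
  | add a b ha hb => simp only [map_add, ha, hb]
  | tmul g h => rw [LinearMap.rTensor_tmul, evCube_joinLeft, hΔ, ev₂_tmul]

theorem evCube_lTensor (w : H ⊗[K] H) (x y z : A) :
    ρ.evCube x y z (Bal3.joinRight _ _ (D.comul.lTensor _ w)) = ρ.ev₂ x (y * z) w := by
  induction w with
  | zero => simp
  | add a b ha hb => simp only [map_add, ha, hb]
  | tmul g h => rw [LinearMap.lTensor_tmul, evCube_joinRight, hΔ, ev₂_tmul]

/-- If `H ⊗_R H` and `H ⊗_R H ⊗_R H` embed in spaces of multilinear maps on `A`, then a coproduct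
with `h₍₁₎(x) h₍₂₎(y) = h(x y)` makes `H` a left bialgebroid. -/
theorem isLeftBialgebroid
    (h₂ : ∀ w w' : Bal (leftTgtAct D.tgt) (leftSrcAct D.src),
      (∀ x y, ρ.evSq x y w = ρ.evSq x y w') → w = w')
    (h₃ : ∀ w w' : Bal3 (leftTgtAct D.tgt) (leftSrcAct D.src),
      (∀ x y z, ρ.evCube x y z w = ρ.evCube x y z w') → w = w') :
    IsLeftBialgebroid D := by
  -- By `hrep` and `hmk`, a tensor represents `Δ(h)` exactly when it evaluates to `h(x y)`; the
  -- coproduct formulas are checked through this criterion.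
  have hrep : ∀ h w, D.mk₂ w = D.comul h → ∀ x y, ρ.ev₂ x y w = ρ.act h (x * y) :=
    fun h w hw x y => by rw [← hΔ, ← hw, evSq_mk]
  have hmk : ∀ h w, (∀ x y, ρ.ev₂ x y w = ρ.act h (x * y)) → D.comul h = D.mk₂ w :=
    fun h w hw => h₂ _ _ fun x y => by rw [hΔ, evSq_mk, hw]
  have hcs : ∀ r, D.counit (D.src r) = r := fun r => ρ.incl_injective <| by
    rw [ρ.incl_counit, ρ.act_src, mul_one]
  exact
  { comul_src := fun r h w hw => hmk _ _ fun x y => by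
      have e : ∀ w, ρ.ev₂ x y ((D.src r ⊗ₜ 1) * w) = ρ.incl r * ρ.ev₂ x y w := by
        intro w
        induction w with
        | zero => simp
        | add a b ha hb => simp only [map_add, mul_add, ha, hb]
        | tmul a b => simp [mul_assoc, ρ.act_src]
      rw [e, hrep h w hw, map_mul ρ.act, Module.End.mul_apply, ρ.act_src]
    comul_tgt := fun r h w hw => hmk _ _ fun x y => by
      have e : ∀ w, ρ.ev₂ x y ((1 ⊗ₜ D.tgt r) * w) = ρ.ev₂ x y w * ρ.incl r.unop := by
        intro w
        induction w with
        | zero => simp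
        | add a b ha hb => simp only [map_add, mul_add, add_mul, ha, hb]
        | tmul a b => simp [mul_assoc, ρ.act_tgt]
      rw [e, hrep h w hw, map_mul ρ.act, Module.End.mul_apply, ρ.act_tgt]
    coassoc := fun h w hw => h₃ _ _ fun x y z => by
      rw [ρ.evCube_rTensor hΔ, ρ.evCube_lTensor hΔ, hrep h w hw, hrep h w hw, mul_assoc]
    counit_src := fun r h => ρ.incl_injective <| by
      simp [ρ.incl_counit, ρ.act_src]
    counit_tgt := fun r h => ρ.incl_injective <| by
      simp [ρ.incl_counit, ρ.act_tgt]
    counit_left := fun h w hw => ρ.ext fun a => by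
      -- Evaluating the first leg at `1` produces its counit, so `h(1 · a) = ε(h₍₁₎) h₍₂₎(a)`.
      rw [← one_mul a, ← hrep h w hw, one_mul]
      clear hw
      induction w with
      | zero => simp
      | add a b ha hb => simp only [map_add, LinearMap.add_apply, ha, hb]
      | tmul a b => simp [ρ.act_src, ρ.incl_counit]
    counit_right := fun h w hw => ρ.ext fun a => by
      rw [← mul_one a, ← hrep h w hw, mul_one]
      clear hw
      induction w with
      | zero => simp
      | add a b ha hb => simp only [map_add, LinearMap.add_apply, ha, hb]
      | tmul a b => simp [ρ.act_tgt, ρ.incl_counit]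
    takeuchi := fun r h w hw => h₂ _ _ fun x y => by
      -- The common value is `h(x r y)`.
      rw [evSq_mk, evSq_mk, ev₂_mul_tmul, ev₂_mul_tmul, hrep h w hw, hrep h w hw]
      simp [mul_assoc, ρ.act_src, ρ.act_tgt]
    comul_one := hmk _ _ fun x y => by simp
    comul_mul := fun g h w w' hw hw' => hmk _ _ fun x y => by
      -- Right multiplication of `w` by `a ⊗ b` replaces the arguments by `a(x)` and `b(y)`; as `w`
      -- represents `Δ(g)`, the result is `g(a(x) b(y))`.
      have e : ∀ w', ρ.ev₂ x y (w * w') = ρ.act g (ρ.ev₂ x y w') := by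
        intro w'
        induction w' with
        | zero => simp
        | add a b ha hb => simp only [map_add, mul_add, ha, hb]
        | tmul a b => rw [ev₂_mul_tmul, hrep g w hw, ev₂_tmul]
      rw [e, hrep h w' hw', map_mul ρ.act, Module.End.mul_apply]
    counit_one := by simpa using hcs 1
    counit_mul_src := fun g h => ρ.incl_injective <| by
      simp [ρ.incl_counit, ρ.act_src]
    counit_mul_tgt := fun g h => ρ.incl_injective <| by
      simp [ρ.incl_counit, ρ.act_tgt] }

end

section Expansion

variable {J : Type*} [Fintype J] {e : J → H} {p : J → H →ₗ[K] R} {s : J → Finset (A × A)}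

/-- `g ⊗ h ↦ p(g)·h`. -/
def contractLeft (D : LeftBialgebroidData K R H) (p : H →ₗ[K] R) : H ⊗[K] H →ₗ[K] H :=
  LinearMap.mul' K H ∘ₗ (D.src.toLinearMap ∘ₗ p).rTensor _

/-- `g ⊗ h ↦ g·p(h)`. -/
def contractRight (D : LeftBialgebroidData K R H) (p : H →ₗ[K] R) : H ⊗[K] H →ₗ[K] H :=
  LinearMap.mul' K H ∘ₗ (D.tgt.toLinearMap ∘ₗ (opLinearEquiv K).toLinearMap ∘ₗ p).rTensor _ ∘ₗ
    (TensorProduct.comm K H H).toLinearMap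

@[simp] theorem contractLeft_tmul (p : H →ₗ[K] R) (g h : H) :
    contractLeft D p (g ⊗ₜ h) = D.src (p g) * h := by simp [contractLeft]

@[simp] theorem contractRight_tmul (p : H →ₗ[K] R) (g h : H) :
    contractRight D p (g ⊗ₜ h) = D.tgt (op (p h)) * g := by simp [contractRight]

/-- A coefficient functional of the form `h ↦ ∑ c₁ h(c₂)` is made of evaluations, so contracting a
leg with it loses no control: the action of the contraction is read off from the evaluations of `w`.
-/
theorem act_contractLeft {p : H →ₗ[K] R} {s : Finset (A × A)}
    (hp : ∀ h, ρ.incl (p h) = ∑ c ∈ s, c.1 * ρ.act h c.2) (w : H ⊗[K] H) (y : A) :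
    ρ.act (contractLeft D p w) y = ∑ c ∈ s, c.1 * ρ.ev₂ c.2 y w := by
  induction w with
  | zero => simp
  | add a b ha hb => simp only [map_add, LinearMap.add_apply, ha, hb, mul_add, Finset.sum_add_distrib]
  | tmul g h => simp [ρ.act_src, hp, Finset.sum_mul, mul_assoc]

theorem act_contractRight {p : H →ₗ[K] R} {s : Finset (A × A)}
    (hp : ∀ h, ρ.incl (p h) = ∑ c ∈ s, ρ.act h c.1 * c.2) (w : H ⊗[K] H) (x : A) :
    ρ.act (contractRight D p w) x = ∑ c ∈ s, ρ.ev₂ x c.1 w * c.2 := by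
  induction w with
  | zero => simp
  | add a b ha hb => simp only [map_add, LinearMap.add_apply, ha, hb, add_mul, Finset.sum_add_distrib]
  | tmul g h => simp [ρ.act_tgt, hp, Finset.mul_sum, mul_assoc]

/-- Expand the first leg as `g = ∑ e_j · p_j(g)` and move each coefficient across `⊗_R` to the
second leg. -/
theorem mk_eq_sum_contractLeft (he : ∀ h, h = ∑ j, D.tgt (op (p j h)) * e j) (w : H ⊗[K] H) :
    D.mk₂ w = ∑ j, D.mk₂ (e j ⊗ₜ contractLeft D (p j) w) := by
  induction w with
  | zero => simp
  | add x y hx hy => simp only [map_add, hx, hy, TensorProduct.tmul_add, Finset.sum_add_distrib]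
  | tmul g h =>
    conv_lhs => rw [he g, TensorProduct.sum_tmul, map_sum]
    refine Finset.sum_congr rfl fun j _ => ?_
    rw [contractLeft_tmul]
    exact Bal.balanced (leftTgtAct D.tgt) (leftSrcAct D.src) _ _ _

theorem mk_eq_sum_contractRight (he : ∀ h, h = ∑ j, D.src (p j h) * e j) (w : H ⊗[K] H) :
    D.mk₂ w = ∑ j, D.mk₂ (contractRight D (p j) w ⊗ₜ e j) := by
  induction w with
  | zero => simp
  | add x y hx hy => simp only [map_add, hx, hy, TensorProduct.add_tmul, Finset.sum_add_distrib]
  | tmul g h =>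
    conv_lhs => rw [he h, TensorProduct.tmul_sum, map_sum]
    refine Finset.sum_congr rfl fun j _ => ?_
    rw [contractRight_tmul]
    exact (Bal.balanced (leftTgtAct D.tgt) (leftSrcAct D.src) _ _ _).symm

theorem mkQ_assoc_tmul (w : H ⊗[K] H) (k : H) :
    (bal3Rel (leftTgtAct D.tgt) (leftSrcAct D.src)).mkQ (TensorProduct.assoc K H H H (w ⊗ₜ k)) =
      Bal3.joinLeft _ _ (D.mk₂ w ⊗ₜ k) := by
  induction w with
  | zero => simp
  | add x y hx hy => simp only [map_add, TensorProduct.add_tmul, hx, hy]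
  | tmul x y => rw [Bal3.joinLeft_tmul]; rfl

theorem mkQ_tmul (g : H) (w : H ⊗[K] H) :
    (bal3Rel (leftTgtAct D.tgt) (leftSrcAct D.src)).mkQ (g ⊗ₜ w) =
      Bal3.joinRight _ _ (g ⊗ₜ D.mk₂ w) := by
  induction w with
  | zero => simp
  | add x y hx hy => simp only [map_add, TensorProduct.tmul_add, hx, hy]
  | tmul x y => rw [Bal3.joinRight_tmul]

theorem ev₂_rTensor_contractLeft {p : H →ₗ[K] R} {s : Finset (A × A)}
    (hp : ∀ h, ρ.incl (p h) = ∑ c ∈ s, c.1 * ρ.act h c.2) (w : (H ⊗[K] H) ⊗[K] H) (x y : A) :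
    ρ.ev₂ x y ((contractLeft D p).rTensor H w) =
      ∑ c ∈ s, c.1 * ρ.ev₃ c.2 x y (TensorProduct.assoc K H H H w) := by
  induction w with
  | zero => simp
  | add a b ha hb => simp only [map_add, ha, hb, mul_add, Finset.sum_add_distrib]
  | tmul w k =>
    rw [LinearMap.rTensor_tmul, ev₂_tmul, ρ.act_contractLeft hp, Finset.sum_mul]
    refine Finset.sum_congr rfl fun c _ => ?_
    rw [mul_assoc]
    congr 1
    induction w with
    | zero => simp
    | add a b ha hb => simp only [map_add, add_mul, TensorProduct.add_tmul, ha, hb]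
    | tmul a b => simp [mul_assoc]

theorem ev₂_lTensor_contractRight {p : H →ₗ[K] R} {s : Finset (A × A)}
    (hp : ∀ h, ρ.incl (p h) = ∑ c ∈ s, ρ.act h c.1 * c.2) (w : H ⊗[K] (H ⊗[K] H)) (x y : A) :
    ρ.ev₂ x y ((contractRight D p).lTensor H w) = ∑ c ∈ s, ρ.ev₃ x y c.1 w * c.2 := by
  induction w with
  | zero => simp
  | add a b ha hb => simp only [map_add, ha, hb, add_mul, Finset.sum_add_distrib]
  | tmul g w =>
    rw [LinearMap.lTensor_tmul, ev₂_tmul, ρ.act_contractRight hp, Finset.mul_sum]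
    exact Finset.sum_congr rfl fun c _ => by rw [ev₃_tmul, mul_assoc]

theorem mkQ_eq_sum_contractLeft (he : ∀ h, h = ∑ j, D.tgt (op (p j h)) * e j)
    (w : (H ⊗[K] H) ⊗[K] H) :
    (bal3Rel (leftTgtAct D.tgt) (leftSrcAct D.src)).mkQ (TensorProduct.assoc K H H H w) =
      ∑ j, Bal3.joinRight _ _ (e j ⊗ₜ D.mk₂ ((contractLeft D (p j)).rTensor H w)) := by
  induction w with
  | zero => simp
  | add x y hx hy => simp only [map_add, hx, hy, TensorProduct.tmul_add, Finset.sum_add_distrib]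
  | tmul w k =>
    rw [mkQ_assoc_tmul, mk_eq_sum_contractLeft he w, TensorProduct.sum_tmul, map_sum]
    refine Finset.sum_congr rfl fun j _ => ?_
    rw [LinearMap.rTensor_tmul, Bal3.joinLeft_tmul, Bal3.joinRight_tmul]

theorem mkQ_eq_sum_contractRight (he : ∀ h, h = ∑ j, D.src (p j h) * e j)
    (w : H ⊗[K] (H ⊗[K] H)) :
    (bal3Rel (leftTgtAct D.tgt) (leftSrcAct D.src)).mkQ w =
      ∑ j, Bal3.joinLeft _ _ (D.mk₂ ((contractRight D (p j)).lTensor H w) ⊗ₜ e j) := by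
  induction w with
  | zero => simp
  | add x y hx hy => simp only [map_add, hx, hy, TensorProduct.add_tmul, Finset.sum_add_distrib]
  | tmul g w =>
    rw [mkQ_tmul, mk_eq_sum_contractRight he w, TensorProduct.tmul_sum, map_sum]
    refine Finset.sum_congr rfl fun j _ => ?_
    rw [LinearMap.lTensor_tmul, Bal3.joinLeft_tmul, Bal3.joinRight_tmul]

/-- An element of the square is `∑ e_j ⊗ k_j`, where the contraction `k_j` is known from its
faithful action on `A`, hence from evaluations. Contracting the first leg in the cube reduces to the
square. These are the two separation properties that `isLeftBialgebroid` needs. -/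
theorem isLeftBialgebroid_of_rightExpansion
    (hΔ : ∀ h x y, ρ.evSq x y (D.comul h) = ρ.act h (x * y))
    (he : ∀ h, h = ∑ j, D.tgt (op (p j h)) * e j)
    (hp : ∀ j h, ρ.incl (p j h) = ∑ c ∈ s j, c.1 * ρ.act h c.2) : IsLeftBialgebroid D := by
  have h₂ : ∀ w w' : Bal (leftTgtAct D.tgt) (leftSrcAct D.src),
      (∀ x y, ρ.evSq x y w = ρ.evSq x y w') → w = w' := by
    intro w w' h
    obtain ⟨z, rfl⟩ := Bal.exists_rep w
    obtain ⟨z', rfl⟩ := Bal.exists_rep w'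
    refine (mk_eq_sum_contractLeft he z).trans (Eq.trans ?_ (mk_eq_sum_contractLeft he z').symm)
    refine Finset.sum_congr rfl fun j _ => congrArg (fun g => D.mk₂ (e j ⊗ₜ g)) ?_
    refine ρ.ext fun y => ?_
    rw [ρ.act_contractLeft (hp j), ρ.act_contractLeft (hp j)]
    simp only [← evSq_mk, h]
  refine ρ.isLeftBialgebroid hΔ h₂ fun w w' h => ?_
  obtain ⟨z, rfl⟩ := Submodule.mkQ_surjective _ w
  obtain ⟨z', rfl⟩ := Submodule.mkQ_surjective _ w'
  -- Contraction combines the first two legs, so the cube is rebracketed as `(H ⊗ H) ⊗ H`.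
  obtain ⟨z, rfl⟩ := (TensorProduct.assoc K H H H).surjective z
  obtain ⟨z', rfl⟩ := (TensorProduct.assoc K H H H).surjective z'
  rw [mkQ_eq_sum_contractLeft he z, mkQ_eq_sum_contractLeft he z']
  refine Finset.sum_congr rfl fun j _ => ?_
  refine congrArg (fun v => Bal3.joinRight _ _ (e j ⊗ₜ v)) (h₂ _ _ fun x y => ?_)
  rw [evSq_mk, evSq_mk, ρ.ev₂_rTensor_contractLeft (hp j), ρ.ev₂_rTensor_contractLeft (hp j)]
  exact Finset.sum_congr rfl fun c _ => congrArg (c.1 * ·) (h c.2 x y)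

/-- Mirror image: the last leg is expanded and its coefficients move left. The right-nested cube
already has the last two legs grouped. -/
theorem isLeftBialgebroid_of_leftExpansion
    (hΔ : ∀ h x y, ρ.evSq x y (D.comul h) = ρ.act h (x * y))
    (he : ∀ h, h = ∑ j, D.src (p j h) * e j)
    (hp : ∀ j h, ρ.incl (p j h) = ∑ c ∈ s j, ρ.act h c.1 * c.2) : IsLeftBialgebroid D := by
  have h₂ : ∀ w w' : Bal (leftTgtAct D.tgt) (leftSrcAct D.src),
      (∀ x y, ρ.evSq x y w = ρ.evSq x y w') → w = w' := by
    intro w w' h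
    obtain ⟨z, rfl⟩ := Bal.exists_rep w
    obtain ⟨z', rfl⟩ := Bal.exists_rep w'
    refine (mk_eq_sum_contractRight he z).trans (Eq.trans ?_ (mk_eq_sum_contractRight he z').symm)
    refine Finset.sum_congr rfl fun j _ => congrArg (fun g => D.mk₂ (g ⊗ₜ e j)) ?_
    refine ρ.ext fun x => ?_
    rw [ρ.act_contractRight (hp j), ρ.act_contractRight (hp j)]
    simp only [← evSq_mk, h]
  refine ρ.isLeftBialgebroid hΔ h₂ fun w w' h => ?_
  obtain ⟨z, rfl⟩ := Submodule.mkQ_surjective _ w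
  obtain ⟨z', rfl⟩ := Submodule.mkQ_surjective _ w'
  rw [mkQ_eq_sum_contractRight he z, mkQ_eq_sum_contractRight he z']
  refine Finset.sum_congr rfl fun j _ => ?_
  refine congrArg (fun v => Bal3.joinLeft _ _ (v ⊗ₜ e j)) (h₂ _ _ fun x y => ?_)
  rw [evSq_mk, evSq_mk, ρ.ev₂_lTensor_contractRight (hp j), ρ.ev₂_lTensor_contractRight (hp j)]
  exact Finset.sum_congr rfl fun c _ => congrArg (· * c.2) (h x y c.1)

end Expansion

end EndRep

end EndRep

/-! ### Right depth two: `S`, its right dual, and `T` -/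

namespace DepthTwo

section

variable {K A B : Type*} [CommRing K] [Ring A] [Ring B] [Algebra K A] [Algebra K B]
  {f : B →ₐ[K] A}

theorem leftPairing_sandwich (w : TensorSq f) (α : S f) (b : B) (a : A) :
    leftPairing f (sandwich f w (f b) a) α = f b * leftPairing f w α * a := by
  induction w using tensorSq_induction with
  | h0 => simp
  | htm x y => simp [α.2.1, mul_assoc]
  | hadd v w hv hw => simp only [map_add, LinearMap.add_apply, hv, hw, mul_add, add_mul]

theorem exists_eq_sum_tm (w : TensorSq f) : ∃ s : Finset (A × A), w = ∑ p ∈ s, tm f p.1 p.2 := by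
  obtain ⟨z, rfl⟩ := Bal.exists_rep w
  obtain ⟨s, rfl⟩ := TensorProduct.exists_finset z
  exact ⟨s, map_sum ..⟩

/-- The pairing `⟨t ∣ α⟩ = t¹ α(t²)` of `T` and `S`, with values in the centralizer. -/
def T.rightPairing (t : T f) : S f →ₗ[K] R f :=
  (DepthTwo.rightPairing f (T.val f t)).codRestrict (Subalgebra.toSubmodule (R f)) (fun α => by
    refine (Subalgebra.mem_centralizer_iff K).2 ?_
    rintro _ ⟨b, rfl⟩
    have h := congrArg (fun w => DepthTwo.rightPairing f w α) (T.central t b)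
    have h₁ := rightPairing_sandwich f (T.val f t) α (f b) 1
    have h₂ := rightPairing_sandwich f (T.val f t) α 1 b
    rw [map_one, mul_one] at h₁
    rw [one_mul] at h₂
    rw [← h₁, ← h₂, h])

/-- The pairing `[α ∣ t] = α(t¹) t²` of `S` and `T`, with values in the centralizer. -/
def T.leftPairing (t : T f) : S f →ₗ[K] R f :=
  (DepthTwo.leftPairing f (T.val f t)).codRestrict (Subalgebra.toSubmodule (R f)) (fun α => by
    refine (Subalgebra.mem_centralizer_iff K).2 ?_
    rintro _ ⟨b, rfl⟩
    have h := congrArg (fun w => DepthTwo.leftPairing f w α) (T.central t b)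
    have h₁ := leftPairing_sandwich (T.val f t) α b 1
    have h₂ := leftPairing_sandwich (T.val f t) α 1 (f b)
    rw [mul_one] at h₁
    rw [map_one, one_mul] at h₂
    rw [← h₁, ← h₂, h])

@[simp] theorem T.coe_rightPairing (t : T f) (α : S f) :
    (t.rightPairing α : A) = DepthTwo.rightPairing f (T.val f t) α := rfl
@[simp] theorem T.coe_leftPairing (t : T f) (α : S f) :
    (t.leftPairing α : A) = DepthTwo.leftPairing f (T.val f t) α := rfl

theorem S.ext {α β : S f} (h : ∀ a, (α : Module.End K A) a = (β : Module.End K A) a) : α = β :=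
  Subtype.ext (LinearMap.ext h)

@[simp] theorem S.mul_apply (α β : S f) (a : A) :
    ((α * β : S f) : Module.End K A) a = (α : Module.End K A) ((β : Module.End K A) a) := rfl

theorem S.sum_apply {ι : Type*} (s : Finset ι) (α : ι → S f) (a : A) :
    ((∑ i ∈ s, α i : S f) : Module.End K A) a = ∑ i ∈ s, (α i : Module.End K A) a :=
  map_sum (LinearMap.applyₗ (R := K) a ∘ₗ (S f).val.toLinearMap) α s

@[simp] theorem S.twistRight_apply (u : T f) (α : S f) (a : A) :
    (S.twistRight f u α : Module.End K A) a = endRight f (T.val f u) α a := rfl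
@[simp] theorem S.twistLeft_apply (t : T f) (α : S f) (a : A) :
    (S.twistLeft f t α : Module.End K A) a = endLeft f (T.val f t) α a := rfl

namespace RightQuasibasis

variable (q : RightQuasibasis f)

/-- Pair `1 ⊗ a = ∑ γ_j(a) u_j` with `α`. This is the dual bases property of `S_R`. -/
theorem sum_mul_rightPairing (α : S f) (a : A) :
    ∑ j, (q.γ j : Module.End K A) a * rightPairing f (T.val f (q.u j)) α =
      (α : Module.End K A) a := by
  have h := congrArg (fun w => rightPairing f w α) (q.sum_eq 1 a)
  simp only [map_sum, LinearMap.sum_apply, rightPairing_tm, one_mul] at h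
  rw [h]
  refine Finset.sum_congr rfl fun j _ => ?_
  have := rightPairing_sandwich f (T.val f (q.u j)) α ((q.γ j : Module.End K A) a) 1
  rw [map_one, mul_one] at this
  exact this.symm

/-- Apply `w ↦ w¹ α(w² y)` to `1 ⊗ x = ∑ γ_j(x) u_j`. It says `α₍₁₎(x) α₍₂₎(y) = α(x y)` for the
coproduct of `S`. -/
theorem sum_mul_endRight (α : S f) (x y : A) :
    ∑ j, (q.γ j : Module.End K A) x * endRight f (T.val f (q.u j)) α y =
      (α : Module.End K A) (x * y) := by
  have h := congrArg (fun w => endRight f w α y) (q.sum_eq 1 x)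
  simp only [map_sum, LinearMap.sum_apply, endRight_tm, endRight_sandwich, one_mul] at h
  exact h.symm

theorem eq_sum_tgt_mul (α : S f) :
    α = ∑ j, S.tgt f (op ((q.u j).rightPairing α)) * q.γ j := S.ext fun a => by
  rw [← q.sum_mul_rightPairing α a, S.sum_apply]
  rfl

/-- The quasibasis identity is additive in the tensor. An element of `A ⊗_B A` is thus determined by
its pairings with the `γ_j`, which gives injectivity of `t ↦ ⟨t ∣ -⟩`. -/
theorem eq_sum_sandwich (w : TensorSq f) :
    w = ∑ j, sandwich f (T.val f (q.u j)) (rightPairing f w (q.γ j)) 1 := by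
  induction w using tensorSq_induction with
  | h0 => simp
  | htm x y => exact q.sum_eq x y
  | hadd v w hv hw =>
    nth_rewrite 1 [hv, hw]
    simp only [map_add, LinearMap.add_apply, Finset.sum_add_distrib]

/-- The action of `S` on `A`. -/
def endRep : EndRep q.bialgebroidS A where
  act := (S f).val
  incl := (R f).val
  act_injective := Subtype.val_injective
  incl_injective := Subtype.val_injective
  act_src _ _ := rfl
  act_tgt _ _ := rfl
  incl_counit _ := rfl

theorem comul_S (α : S f) : q.bialgebroidS.comul α =
    q.bialgebroidS.mk₂ (∑ j, q.γ j ⊗ₜ S.twistRight f (q.u j) α) :=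
  LeftBialgebroidData.comul_apply_of_eq_sum (D := q.bialgebroidS) (s := Finset.univ)
    (g := fun j => TensorProduct.mk K _ _ (q.γ j) ∘ₗ S.twistRight f (q.u j)) rfl α

theorem comul_T (t : T f) : q.bialgebroidT.comul t =
    q.bialgebroidT.mk₂ (∑ j, T.applyRight f (q.γ j) t ⊗ₜ q.u j) :=
  RightBialgebroidData.comul_apply_of_eq_sum (D := q.bialgebroidT) (s := Finset.univ)
    (g := fun j => (TensorProduct.mk K _ _).flip (q.u j) ∘ₗ T.applyRight f (q.γ j)) rfl t

theorem isLeftBialgebroid : IsLeftBialgebroid q.bialgebroidS := by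
  -- Writing `u_j = ∑ c₁ ⊗ c₂` exhibits `⟨u_j ∣ α⟩ = ∑ c₁ α(c₂)` as a sum of evaluations.
  choose s hs using fun j => exists_eq_sum_tm (T.val f (q.u j))
  refine q.endRep.isLeftBialgebroid_of_rightExpansion (e := q.γ)
    (p := fun j => (q.u j).rightPairing) (s := s) (fun α x y => ?_) q.eq_sum_tgt_mul
    (fun j α => ?_)
  · rw [comul_S, EndRep.evSq_mk, map_sum]
    exact q.sum_mul_endRight α x y
  · change rightPairing f (T.val f (q.u j)) α = _
    rw [hs, map_sum, LinearMap.sum_apply]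
    rfl

variable {q} (hS : IsLeftBialgebroid q.bialgebroidS)

theorem rightPairing_tgt_mul (w : TensorSq f) (r : R f) (α : S f) :
    rightPairing f w (S.tgt f (op r) * α) = rightPairing f w α * r := by
  induction w using tensorSq_induction with
  | h0 => simp
  | htm x y => simp [mul_assoc]
  | hadd v w hv hw => simp only [map_add, LinearMap.add_apply, hv, hw, add_mul]

theorem rightPairing_sandwich_eq (w : TensorSq f) (α : S f) (x y : A) :
    rightPairing f (sandwich f w x y) α = x * endRight f w α y := by
  induction w using tensorSq_induction with
  | h0 => simp
  | htm x y => simp [mul_assoc]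
  | hadd v w hv hw => simp only [map_add, LinearMap.add_apply, hv, hw, mul_add]

/-- Both sides are `w¹ t¹ α(t² w²)`. For `w` in `T` this computes the pairing with the product of
`t` and `w`. -/
theorem rightPairing_insert (t : T f) (w : TensorSq f) (α : S f) :
    rightPairing f (T.insert t w) α = rightPairing f w (S.twistRight f t α) := by
  induction w using tensorSq_induction with
  | h0 => simp
  | htm x y => simp [rightPairing_sandwich_eq]
  | hadd v w hv hw => simp only [map_add, LinearMap.add_apply, hv, hw]

/-- The functional `⟨t ∣ -⟩` on `S`. -/
def toDual : T f →ₗ[K] RightDual hS where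
  toFun t := RightDual.of t.rightPairing (fun r α => Subtype.ext (rightPairing_tgt_mul _ r α))
  map_add' t u := by
    ext α
    exact congrArg (fun φ : S f →ₗ[K] A => φ α) (map_add (rightPairing f) (T.val f t) (T.val f u))
  map_smul' k t := by
    ext α
    exact congrArg (fun φ : S f →ₗ[K] A => φ α) (map_smul (rightPairing f) k (T.val f t))

theorem coe_toDual_apply (t : T f) (α : S f) :
    ((toDual hS t α : R f) : A) = rightPairing f (T.val f t) α := rfl

/-- The hook at `a` is `∑ t¹ γ_j(t²) u_j¹ α(u_j² a)`, which collapses to `t¹ α(t² a)` by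
`sum_mul_endRight`. Together with `rightPairing_insert` this makes `t ↦ ⟨t ∣ -⟩` multiplicative. -/
theorem hook_toDual (t : T f) (α : S f) :
    RightDual.hook (toDual hS t) α = S.twistRight f t α := by
  rw [RightDual.hook_eq _ (q.comul_S α).symm, map_sum]
  refine S.ext fun a => ?_
  rw [S.sum_apply, S.twistRight_apply]
  have h : ∀ w, ∑ j, rightPairing f w (q.γ j) * endRight f (T.val f (q.u j)) α a =
      endRight f w α a := by
    intro w
    induction w using tensorSq_induction with
    | h0 => simp
    | htm x y =>
      simp only [rightPairing_tm, endRight_tm, ← q.sum_mul_endRight, Finset.mul_sum, mul_assoc]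
    | hadd v w hv hw =>
      simp only [map_add, LinearMap.add_apply, add_mul, Finset.sum_add_distrib, hv, hw]
  rw [← h]
  refine Finset.sum_congr rfl fun j _ => ?_
  rw [RightDual.hookAux_tmul]
  rfl

/-- The algebra homomorphism `t ↦ ⟨t ∣ -⟩`. -/
def toDualHom : T f →ₐ[K] RightDual hS :=
  AlgHom.ofLinearMap (toDual hS)
    (by
      ext α
      exact one_mul ((α : Module.End K A) 1))
    (fun t u => by
      ext α
      rw [RightDual.mul_apply, hook_toDual]
      exact rightPairing_insert t (T.val f u) α)

/-- The dual bases `γ_j`, `⟨u_j ∣ -⟩` of `S_R`. -/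
def dualBasis : RightDual.DualBasis hS where
  n := q.n
  e := q.γ
  f j := toDual hS (q.u j)
  sum_eq α := (q.eq_sum_tgt_mul α).symm

theorem toDualHom_src (r : R f) : toDualHom hS (T.src f r) = RightDual.src hS r := by
  ext α
  change 1 * (α : Module.End K A) r = (α : Module.End K A) (r * 1)
  rw [one_mul, mul_one]

theorem toDualHom_tgt (r : (R f)ᵐᵒᵖ) : toDualHom hS (T.tgt f r) = RightDual.tgt hS r := by
  ext α
  rfl

theorem toDualHom_bijective : Function.Bijective (toDualHom hS) := by
  refine ⟨fun t u h => T.ext ?_, fun φ => ?_⟩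
  · rw [q.eq_sum_sandwich (T.val f t), q.eq_sum_sandwich (T.val f u)]
    refine Finset.sum_congr rfl fun j _ => ?_
    rw [← coe_toDual_apply hS t, ← coe_toDual_apply hS u]
    exact congrArg (fun φ : RightDual hS => sandwich f (T.val f (q.u j)) (φ (q.γ j) : R f) 1) h
  -- The preimage comes from expanding `φ` in the dual functionals `⟨u_j ∣ -⟩`: the coefficients
  -- `φ(γ_j)` enter through the target map, which is preserved.
  · refine ⟨∑ j, q.u j * T.tgt f (op (φ (q.γ j))), ?_⟩
    rw [map_sum]
    conv_rhs => rw [RightDual.eq_sum_mul_tgt (dualBasis hS) φ]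
    refine Finset.sum_congr rfl fun j _ => ?_
    rw [map_mul, toDualHom_tgt]
    rfl

/-- The algebra isomorphism `T ≅ S^*`, `t ↦ ⟨t ∣ -⟩`. -/
noncomputable def toDualEquiv : T f ≃ₐ[K] RightDual hS :=
  AlgEquiv.ofBijective (toDualHom hS) (toDualHom_bijective hS)

/-- Each term is `w¹ α(γ_j(w²) ⟨u_j ∣ β⟩)`, and the argument of `α` sums to `β(w²)`. For `w` in `T`
the left side is the evaluation at `(α, β)` of the image of `Δ(w)` in the dual. -/
theorem sum_rightPairing_applyRight (w : TensorSq f) (α β : S f) :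
    ∑ j, rightPairing f (applyRight f (q.γ j) w) (α * S.tgt f (op ((q.u j).rightPairing β))) =
      rightPairing f w (α * β) := by
  induction w using tensorSq_induction with
  | h0 => simp
  | htm x y =>
    simp only [applyRight_tm, rightPairing_tm, S.mul_apply, S.tgt_apply, T.coe_rightPairing,
      unop_op, ← Finset.mul_sum, ← map_sum, q.sum_mul_rightPairing]
  | hadd v w hv hw =>
    simp only [map_add, LinearMap.add_apply, Finset.sum_add_distrib, hv, hw]

/-- The criterion `RightDual.comul_eq_mk` holds for every choice of dual bases, so `b` need not come
from `q`. -/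
theorem isRightBialgebroidIso (b : RightDual.DualBasis hS) :
    IsRightBialgebroidIso q.bialgebroidT (RightDual.data b) (toDualEquiv hS) := by
  refine .of_exists_rep (toDualHom_src hS) (toDualHom_tgt hS) (fun t => Subtype.ext ?_)
    (fun t => ⟨_, (q.comul_T t).symm, RightDual.comul_eq_mk b fun α β => Subtype.ext ?_⟩)
  · change rightPairing f (T.val f t) 1 = T.mulMap f (T.val f t)
    induction T.val f t using tensorSq_induction with
    | h0 => simp
    | htm x y => simp
    | hadd v w hv hw => simp only [map_add, LinearMap.add_apply, hv, hw]
  · refine Eq.trans ?_ (sum_rightPairing_applyRight (q := q) (T.val f t) α β)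
    rw [map_sum, map_sum, ← RightDual.toLin_apply, map_sum, LinearMap.sum_apply]
    exact AddSubmonoidClass.coe_finsetSum ..

end RightQuasibasis

end

end DepthTwo

/-! ### Left depth two: `S`, its left dual, and `T` -/

namespace DepthTwo

section

variable {K A B : Type*} [CommRing K] [Ring A] [Ring B] [Algebra K A] [Algebra K B]
  {f : B →ₐ[K] A}

namespace LeftQuasibasis

variable (q : LeftQuasibasis f)

/-- Pair `a ⊗ 1 = ∑ t_i β_i(a)` with `α`; the second tensor factor is now `1`, and the coefficients
end up on the left. -/
theorem sum_leftPairing_mul (α : S f) (a : A) :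
    ∑ i, leftPairing f (T.val f (q.t i)) α * (q.β i : Module.End K A) a =
      (α : Module.End K A) a := by
  have h := congrArg (fun w => leftPairing f w α) (q.sum_eq a 1)
  simp only [map_sum, LinearMap.sum_apply, leftPairing_tm, mul_one] at h
  rw [h]
  refine Finset.sum_congr rfl fun i _ => ?_
  have := leftPairing_sandwich (T.val f (q.t i)) α 1 ((q.β i : Module.End K A) a)
  rw [map_one, one_mul] at this
  exact this.symm

/-- Apply `w ↦ α(x w¹) w²` to `y ⊗ 1 = ∑ t_i β_i(y)`. It is again the relation `α₍₁₎(x) α₍₂₎(y) =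
α(x y)`. -/
theorem sum_endLeft_mul (α : S f) (x y : A) :
    ∑ i, endLeft f (T.val f (q.t i)) α x * (q.β i : Module.End K A) y =
      (α : Module.End K A) (x * y) := by
  have h := congrArg (fun w => endLeft f w α x) (q.sum_eq y 1)
  simp only [map_sum, LinearMap.sum_apply, endLeft_tm, endLeft_sandwich, mul_one] at h
  exact h.symm

theorem eq_sum_src_mul (α : S f) :
    α = ∑ i, S.src f ((q.t i).leftPairing α) * q.β i := S.ext fun a => by
  rw [← q.sum_leftPairing_mul α a, S.sum_apply]
  rfl

theorem eq_sum_sandwich (w : TensorSq f) :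
    w = ∑ i, sandwich f (T.val f (q.t i)) 1 (leftPairing f w (q.β i)) := by
  induction w using tensorSq_induction with
  | h0 => simp
  | htm x y => exact q.sum_eq x y
  | hadd v w hv hw =>
    nth_rewrite 1 [hv, hw]
    simp only [map_add, LinearMap.add_apply, Finset.sum_add_distrib]

/-- The action of `S` on `A`. -/
def endRep : EndRep q.bialgebroidS A where
  act := (S f).val
  incl := (R f).val
  act_injective := Subtype.val_injective
  incl_injective := Subtype.val_injective
  act_src _ _ := rfl
  act_tgt _ _ := rfl
  incl_counit _ := rfl

theorem comul_S (α : S f) : q.bialgebroidS.comul α =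
    q.bialgebroidS.mk₂ (∑ i, S.twistLeft f (q.t i) α ⊗ₜ q.β i) :=
  LeftBialgebroidData.comul_apply_of_eq_sum (D := q.bialgebroidS) (s := Finset.univ)
    (g := fun i => (TensorProduct.mk K _ _).flip (q.β i) ∘ₗ S.twistLeft f (q.t i)) rfl α

theorem comul_T (t : T f) : q.bialgebroidT.comul t =
    q.bialgebroidT.mk₂ (∑ i, q.t i ⊗ₜ T.applyLeft f (q.β i) t) :=
  RightBialgebroidData.comul_apply_of_eq_sum (D := q.bialgebroidT) (s := Finset.univ)
    (g := fun i => TensorProduct.mk K _ _ (q.t i) ∘ₗ T.applyLeft f (q.β i)) rfl t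

theorem isLeftBialgebroid : IsLeftBialgebroid q.bialgebroidS := by
  choose s hs using fun i => exists_eq_sum_tm (T.val f (q.t i))
  refine q.endRep.isLeftBialgebroid_of_leftExpansion (e := q.β)
    (p := fun i => (q.t i).leftPairing) (s := s) (fun α x y => ?_) q.eq_sum_src_mul
    (fun i α => ?_)
  · rw [comul_S, EndRep.evSq_mk, map_sum]
    exact q.sum_endLeft_mul α x y
  · change leftPairing f (T.val f (q.t i)) α = _
    rw [hs, map_sum, LinearMap.sum_apply]
    rfl

variable {q} (hS : IsLeftBialgebroid q.bialgebroidS)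

theorem leftPairing_src_mul (w : TensorSq f) (r : R f) (α : S f) :
    leftPairing f w (S.src f r * α) = r * leftPairing f w α := by
  induction w using tensorSq_induction with
  | h0 => simp
  | htm x y => simp [mul_assoc]
  | hadd v w hv hw => simp only [map_add, LinearMap.add_apply, hv, hw, mul_add]

theorem leftPairing_sandwich_eq (w : TensorSq f) (α : S f) (x y : A) :
    leftPairing f (sandwich f w x y) α = endLeft f w α x * y := by
  induction w using tensorSq_induction with
  | h0 => simp
  | htm x y => simp [mul_assoc]
  | hadd v w hv hw => simp only [map_add, LinearMap.add_apply, hv, hw, add_mul]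

theorem leftPairing_insert (t : T f) (w : TensorSq f) (α : S f) :
    leftPairing f (T.insert t w) α = leftPairing f w (S.twistLeft f t α) := by
  induction w using tensorSq_induction with
  | h0 => simp
  | htm x y => simp [leftPairing_sandwich_eq]
  | hadd v w hv hw => simp only [map_add, LinearMap.add_apply, hv, hw]

/-- The functional `[- ∣ t]` on `S`. -/
def toDual : T f →ₗ[K] LeftDual hS where
  toFun t := LeftDual.of t.leftPairing (fun r α => Subtype.ext (leftPairing_src_mul _ r α))
  map_add' t u := by
    ext α
    exact congrArg (fun φ : S f →ₗ[K] A => φ α) (map_add (leftPairing f) (T.val f t) (T.val f u))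
  map_smul' k t := by
    ext α
    exact congrArg (fun φ : S f →ₗ[K] A => φ α) (map_smul (leftPairing f) k (T.val f t))

theorem coe_toDual_apply (t : T f) (α : S f) :
    ((toDual hS t α : R f) : A) = leftPairing f (T.val f t) α := rfl

/-- The hook at `a` is `∑ α(a t_i¹) t_i² β_i(t¹) t²`, which collapses to `α(a t¹) t²`. -/
theorem hook_toDual (t : T f) (α : S f) :
    LeftDual.hook (toDual hS t) α = S.twistLeft f t α := by
  rw [LeftDual.hook_eq _ (q.comul_S α).symm, map_sum]
  refine S.ext fun a => ?_
  rw [S.sum_apply, S.twistLeft_apply]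
  have h : ∀ w, ∑ i, endLeft f (T.val f (q.t i)) α a * leftPairing f w (q.β i) =
      endLeft f w α a := by
    intro w
    induction w using tensorSq_induction with
    | h0 => simp
    | htm x y =>
      simp only [leftPairing_tm, endLeft_tm, ← q.sum_endLeft_mul, Finset.sum_mul, mul_assoc]
    | hadd v w hv hw =>
      simp only [map_add, LinearMap.add_apply, mul_add, Finset.sum_add_distrib, hv, hw]
  rw [← h]
  refine Finset.sum_congr rfl fun i _ => ?_
  rw [LeftDual.hookAux_tmul]
  rfl

/-- The algebra homomorphism `t ↦ [- ∣ t]`. -/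
def toDualHom : T f →ₐ[K] LeftDual hS :=
  AlgHom.ofLinearMap (toDual hS)
    (by
      ext α
      exact mul_one ((α : Module.End K A) 1))
    (fun t u => by
      ext α
      rw [LeftDual.mul_apply, hook_toDual]
      exact leftPairing_insert t (T.val f u) α)

/-- The dual bases `β_i`, `[- ∣ t_i]` of `_R S`. -/
def dualBasis : LeftDual.DualBasis hS where
  n := q.n
  e := q.β
  f i := toDual hS (q.t i)
  sum_eq α := (q.eq_sum_src_mul α).symm

theorem toDualHom_src (r : R f) : toDualHom hS (T.src f r) = LeftDual.src hS r := by
  ext α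
  rfl

theorem toDualHom_tgt (r : (R f)ᵐᵒᵖ) : toDualHom hS (T.tgt f r) = LeftDual.tgt hS r := by
  ext α
  change (α : Module.End K A) r.unop * 1 = (α : Module.End K A) (1 * r.unop)
  rw [one_mul, mul_one]

theorem toDualHom_bijective : Function.Bijective (toDualHom hS) := by
  refine ⟨fun t u h => T.ext ?_, fun φ => ?_⟩
  · rw [q.eq_sum_sandwich (T.val f t), q.eq_sum_sandwich (T.val f u)]
    refine Finset.sum_congr rfl fun i _ => ?_
    rw [← coe_toDual_apply hS t, ← coe_toDual_apply hS u]
    exact congrArg (fun φ : LeftDual hS => sandwich f (T.val f (q.t i)) 1 (φ (q.β i) : R f)) h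
  -- In `_R S` the coefficients of the expansion of `φ` are right factors of the values, so they
  -- enter through the source map.
  · refine ⟨∑ i, q.t i * T.src f (φ (q.β i)), ?_⟩
    rw [map_sum]
    conv_rhs => rw [LeftDual.eq_sum_mul_src (dualBasis hS) φ]
    refine Finset.sum_congr rfl fun i _ => ?_
    rw [map_mul, toDualHom_src]
    rfl

/-- The algebra isomorphism `T ≅ *S`, `t ↦ [- ∣ t]`. -/
noncomputable def toDualEquiv : T f ≃ₐ[K] LeftDual hS :=
  AlgEquiv.ofBijective (toDualHom hS) (toDualHom_bijective hS)

/-- Each term is `α([β ∣ t_i] β_i(w¹)) w²`, and the argument of `α` sums to `β(w¹)`. -/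
theorem sum_leftPairing_applyLeft (w : TensorSq f) (α β : S f) :
    ∑ i, leftPairing f (applyLeft f (q.β i) w) (α * S.src f ((q.t i).leftPairing β)) =
      leftPairing f w (α * β) := by
  induction w using tensorSq_induction with
  | h0 => simp
  | htm x y =>
    simp only [applyLeft_tm, leftPairing_tm, S.mul_apply, S.src_apply, T.coe_leftPairing,
      ← Finset.sum_mul, ← map_sum, q.sum_leftPairing_mul]
  | hadd v w hv hw =>
    simp only [map_add, LinearMap.add_apply, Finset.sum_add_distrib, hv, hw]

theorem isRightBialgebroidIso (b : LeftDual.DualBasis hS) :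
    IsRightBialgebroidIso q.bialgebroidT (LeftDual.data b) (toDualEquiv hS) := by
  refine .of_exists_rep (toDualHom_src hS) (toDualHom_tgt hS) (fun t => Subtype.ext ?_)
    (fun t => ⟨_, (q.comul_T t).symm, LeftDual.comul_eq_mk b fun α β => Subtype.ext ?_⟩)
  · change leftPairing f (T.val f t) 1 = T.mulMap f (T.val f t)
    induction T.val f t using tensorSq_induction with
    | h0 => simp
    | htm x y => simp
    | hadd v w hv hw => simp only [map_add, LinearMap.add_apply, hv, hw]
  · refine Eq.trans ?_ (sum_leftPairing_applyLeft (q := q) (T.val f t) α β)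
    rw [map_sum, map_sum, ← LeftDual.toLin_apply, map_sum, LinearMap.sum_apply]
    exact AddSubmonoidClass.coe_finsetSum ..

end LeftQuasibasis

end

end DepthTwo

/-! ### Quasibases from a direct summand decomposition, and the conclusion -/

namespace DepthTwo

section

variable {K A B : Type*} [CommRing K] [Ring A] [Ring B] [Algebra K A] [Algebra K B]
  {f : B →ₐ[K] A}

theorem mul_single_mul {n : ℕ} (a x c : A) (j : Fin n) :
    (fun k => a * Pi.single (M := fun _ => A) j x k * c) = Pi.single j (a * x * c) := by
  ext k
  rcases eq_or_ne k j with rfl | hk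
  · simp
  · simp [hk]

/-- Take `u_j = p(e_j)` for the standard basis vectors and `γ_j(a)` the `j`-th coordinate of `i(1 ⊗
a)`. Then `u_j` is `B`-central because `b e_j = e_j b` in `A^n`, and `γ_j` is left `B`-linear
because `1 ⊗ b a = b ⊗ a`. The quasibasis identity is `p(i(a ⊗ a')) = a ⊗ a'` with `i(a ⊗ a') = a
i(1 ⊗ a')` written in coordinates. -/
theorem nonempty_rightQuasibasis (h : IsRightD2 f) : Nonempty (RightQuasibasis f) := by
  obtain ⟨n, i, p, hi, hp, hpi⟩ := h
  have hp' : ∀ (a : A) (b : B) (j : Fin n),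
      sandwich f (p (Pi.single j 1)) a (f b) = p (Pi.single j (a * f b)) := fun a b j => by
    rw [← hp, mul_single_mul, mul_one]
  have hp₁ : ∀ (a : A) (j : Fin n),
      sandwich f (p (Pi.single j 1)) a 1 = p (Pi.single j a) := fun a j => by
    simpa using hp' a 1 j
  refine ⟨⟨n, fun j => T.of (p (Pi.single j 1)) fun b => ?_, fun j =>
    ⟨{ toFun := fun a => i (tm f 1 a) j
       map_add' := fun a a' => by rw [tm_add, map_add, Pi.add_apply]
       map_smul' := fun k a => by rw [tm_smul, map_smul]; rfl }, fun b a => ?_, fun b a => ?_⟩,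
    fun a a' => ?_⟩⟩
  · rw [hp₁, hp', one_mul]
  · have := congrFun (hi (f b) 1 (tm f 1 a)) j
    simpa [← tm_balanced] using this
  · have := congrFun (hi 1 b (tm f 1 a)) j
    simpa using this
  · have h₁ := congrFun (hi a 1 (tm f 1 a'))
    simp only [sandwich_tm, map_one, mul_one] at h₁
    rw [← hpi (tm f a a'), ← Finset.univ_sum_single (i (tm f a a')), map_sum]
    refine Finset.sum_congr rfl fun j _ => ?_
    rw [h₁]
    exact (hp₁ _ j).symm

/-- The mirror choice is `t_j = p(e_j)` and `β_j(a)` the `j`-th coordinate of `i(a ⊗ 1)`; now right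
`B`-linearity is the one that uses `a b ⊗ 1 = a ⊗ b`. -/
theorem nonempty_leftQuasibasis (h : IsLeftD2 f) : Nonempty (LeftQuasibasis f) := by
  obtain ⟨n, i, p, hi, hp, hpi⟩ := h
  have hp' : ∀ (b : B) (a : A) (j : Fin n),
      sandwich f (p (Pi.single j 1)) (f b) a = p (Pi.single j (f b * a)) := fun b a j => by
    rw [← hp, mul_single_mul, mul_one]
  have hp₁ : ∀ (a : A) (j : Fin n),
      sandwich f (p (Pi.single j 1)) 1 a = p (Pi.single j a) := fun a j => by
    simpa using hp' 1 a j
  refine ⟨⟨n, fun j => T.of (p (Pi.single j 1)) fun b => ?_, fun j =>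
    ⟨{ toFun := fun a => i (tm f a 1) j
       map_add' := fun a a' => by rw [add_tm, map_add, Pi.add_apply]
       map_smul' := fun k a => by rw [smul_tm, map_smul]; rfl }, fun b a => ?_, fun b a => ?_⟩,
    fun a a' => ?_⟩⟩
  · rw [hp₁, hp', mul_one]
  · have := congrFun (hi b 1 (tm f a 1)) j
    simpa using this
  · have := congrFun (hi 1 (f b) (tm f a 1)) j
    simpa [tm_balanced] using this
  · have h₁ := congrFun (hi 1 a' (tm f a 1))
    simp only [sandwich_tm, map_one, one_mul] at h₁
    rw [← hpi (tm f a a'), ← Finset.univ_sum_single (i (tm f a a')), map_sum]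
    refine Finset.sum_congr rfl fun j _ => ?_
    rw [h₁]
    exact (hp₁ _ j).symm

end

end DepthTwo

/-- Let `f : B → A` be an algebra extension with centralizer `R`, `S = End(_B A_B)` and
`T = (A ⊗_B A)^B`.  If the extension is right D2, then (with the structure maps given by any right
D2 quasibases, which exist) `T` is a right and `S` a left bialgebroid over `R`, the right dual
`S^*` is a right bialgebroid, and `t ↦ ⟨t ∣ -⟩ = t¹ (-)(t²)` is an isomorphism `T ≅ S^*` of right
bialgebroids over `R`.  If the extension is left D2, the same holds for left quasibases, the left
dual `*S` and `t ↦ [- ∣ t] = (-)(t¹) t²`. -/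
theorem corollary3p2 {K A B : Type*} [CommRing K] [Ring A] [Ring B] [Algebra K A] [Algebra K B]
    (f : B →ₐ[K] A) :
    (DepthTwo.IsRightD2 f →
      Nonempty (DepthTwo.RightQuasibasis f) ∧
      ∀ q : DepthTwo.RightQuasibasis f,
        IsRightBialgebroid q.bialgebroidT ∧
        ∃ hS : IsLeftBialgebroid q.bialgebroidS,
          Nonempty (RightDual.DualBasis hS) ∧
          ∀ b : RightDual.DualBasis hS,
            IsRightBialgebroid (RightDual.data b) ∧
            ∃ η : DepthTwo.T f ≃ₐ[K] RightDual hS,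
              IsRightBialgebroidIso q.bialgebroidT (RightDual.data b) η ∧
              ∀ (t : DepthTwo.T f) (α : DepthTwo.S f),
                ((η t α : DepthTwo.R f) : A)
                  = DepthTwo.rightPairing f (DepthTwo.T.val f t) α) ∧
    (DepthTwo.IsLeftD2 f →
      Nonempty (DepthTwo.LeftQuasibasis f) ∧
      ∀ q : DepthTwo.LeftQuasibasis f,
        IsRightBialgebroid q.bialgebroidT ∧
        ∃ hS : IsLeftBialgebroid q.bialgebroidS,
          Nonempty (LeftDual.DualBasis hS) ∧
          ∀ b : LeftDual.DualBasis hS,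
            IsRightBialgebroid (LeftDual.data b) ∧
            ∃ η : DepthTwo.T f ≃ₐ[K] LeftDual hS,
              IsRightBialgebroidIso q.bialgebroidT (LeftDual.data b) η ∧
              ∀ (t : DepthTwo.T f) (α : DepthTwo.S f),
                ((η t α : DepthTwo.R f) : A)
                  = DepthTwo.leftPairing f (DepthTwo.T.val f t) α) := by
  refine ⟨fun h => ⟨DepthTwo.nonempty_rightQuasibasis h, fun q => ?_⟩,
    fun h => ⟨DepthTwo.nonempty_leftQuasibasis h, fun q => ?_⟩⟩
  · have hS := q.isLeftBialgebroid
    have e := DepthTwo.RightQuasibasis.isRightBialgebroidIso hS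
    -- The axioms for `T` do not involve dual bases of `S_R`; those provided by `q` are used to pull
    -- them back from the right dual.
    exact ⟨(e (DepthTwo.RightQuasibasis.dualBasis hS)).isRightBialgebroid
        (RightDual.isRightBialgebroid _), hS, ⟨DepthTwo.RightQuasibasis.dualBasis hS⟩,
      fun b => ⟨RightDual.isRightBialgebroid b, _, e b, fun t α => rfl⟩⟩
  · have hS := q.isLeftBialgebroid
    have e := DepthTwo.LeftQuasibasis.isRightBialgebroidIso hS
    exact ⟨(e (DepthTwo.LeftQuasibasis.dualBasis hS)).isRightBialgebroid
        (LeftDual.isRightBialgebroid _), hS, ⟨DepthTwo.LeftQuasibasis.dualBasis hS⟩,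
      fun b => ⟨LeftDual.isRightBialgebroid b, _, e b, fun t α => rfl⟩⟩
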